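/- Fix $\alpha\in(1,2)$. **Intensity process.** Let $p:\mathbb R\to\mathbb R^+$ be the continuous density of $L_1$, where $L$ is the spectrally positive $\alpha$-stable Lévy process with $\mathbb E[e^{-\lambda L_t}]=e^{t\lambda^\alpha}$ for $\lambda,t\ge 0$; equivalently $p(x)=\frac1{2\pi}\int_{\mathbb R}e^{-iux}e^{(-iu)^\alpha}\,du$. Let $(\sigma_t)_{t\ge0}$ be an increasing càdlàg Lévy process with $\mathbb E[e^{-\lambda\sigma_t}]=e^{-t\alpha\lambda^{\alpha-1}}$, and put $M_t=\exp\left(\int_0^t\sigma_s\,ds\right)\frac{p(-\sigma_t)}{p(0)}$. Let $\widetilde\sigma=(\widetilde\sigma_t)_{t\ge0}$ be an increasing càdlàg process with values in $\mathbb R^+$ such that, for every $t\ge 0$ and every bounded measurable $F$, $\mathbb E[F((\widetilde\sigma_s)_{s\le t})]=\mathbb E[M_tF((\sigma_s)_{s\le t})]$. **Cut and attachment points.** Conditionally given $\widetilde\sigma$, let $Y_1<Y_2<\cdots$ be the jump times of an inhomogeneous Poisson process on $\mathbb R^+$ with intensity $\widetilde\sigma_t\,dt$. Let $U_1,U_2,\dots$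 be i.i.d. uniform on $[0,1]$, independent of $(\widetilde\sigma,(Y_k)_{k\ge 1})$, and set $Z_k=\inf\{t>0:\widetilde\sigma_t>U_k\widetilde\sigma_{Y_k-}\}$. **Tree.** Given a strictly increasing sequence $Y_k\uparrow\infty$ in $\mathbb R^+$ and points $Z_k\in[0,Y_k)$, let $d^\circ$ be the metric on $\mathbb R^+$ obtained by gluing, inductively in $k\ge1$, the open end of the segment $(Y_k,Y_{k+1}]$ to $[0,Y_k]$ at the point $Z_k$: on $[0,Y_1]$ it is the usual metric; for $u\le Y_k<v\le Y_{k+1}$ it is $d^\circ(u,v)=d^\circ(u,Z_k)+|v-Y_k|$; for $u,v\in(Y_k,Y_{k+1}]$ it is $|u-v|$. Let $(\mathcal T,d)$ be the completion of $(\mathbb R^+,d^\circ)$, let $\mathcal T(k)\subset\mathcal T$ be the image of $[0,Y_k]$, and let $\mu_k=\frac1k\sum_{i=1}^k\delta_{Y_i}$. **Theorem.** Almost surely the following holds. The sequence $(Y_k)$ is strictly increasing to $\infty$ and $Z_k<Y_k$ for all $k$, so that $(\mathcal T,d)$ is defined; $(\mathcal T,d)$ is compact; there is a Borel probability measure $\mu$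 on $\mathcal T$ such that $\mu_k\to\mu$ weakly as $k\to\infty$; and $$(\mathcal T(k),d|_{\mathcal T(k)},\mu_k)\longrightarrow(\mathcal T,d,\mu)\qquad(k\to\infty)$$ for the Gromov–Hausdorff–Prokhorov distance, i.e. the infimum, over all isometric embeddings of the two spaces into a common metric space, of the maximum of the Hausdorff distance between the images and the Lévy–Prokhorov distance between the image measures. -/

import Mathlib

open MeasureTheory ProbabilityTheory Filter Topology
open scoped NNReal ENNReal

noncomputable section

namespace LineBreaking

/-! ### Deterministic line-breaking trees

Sequences are indexed from `0`: `y k` and `z k` stand for the cut point `y_{k+1}` and the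
attachment point `z_{k+1}` of the usual `1`-based numbering. -/

/-- Admissible cut points `y` and attachment points `z`: the cut points increase strictly to
infinity, and every attachment point lies strictly before its cut point. -/
structure IsLineBreaking (y z : ℕ → ℝ≥0) : Prop where
  strictMono : StrictMono y
  tendsto_atTop : Tendsto y atTop atTop
  lt : ∀ k, z k < y k

/-- The metric on `[0, y k]`, defined inductively. It is the usual metric on `[0, y 0]`; the open
end of the segment `(y k, y (k+1)]` is glued at the position `z k`. Only the values at points of
`[0, y k]` are meaningful. -/
def distUpTo (y z : ℕ → ℝ≥0) : ℕ → ℝ≥0 → ℝ≥0 → ℝ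
  | 0, u, v => |(u : ℝ) - v|
  | k + 1, u, v =>
    if u ≤ y k then
      if v ≤ y k then distUpTo y z k u v
      else distUpTo y z k u (z k) + |(v : ℝ) - y k|
    else
      if v ≤ y k then distUpTo y z k v (z k) + |(u : ℝ) - y k|
      else |(u : ℝ) - v|

/-- The metric on the whole half-line that restricts to `distUpTo y z k` on every `[0, y k]`
(see `treeDist_eq`). -/
def treeDist (y z : ℕ → ℝ≥0) (u v : ℝ≥0) : ℝ :=
  distUpTo y z (sInf {k | u ≤ y k ∧ v ≤ y k}) u v

section Deterministic

variable {y z : ℕ → ℝ≥0}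

theorem distUpTo_self (k : ℕ) (u : ℝ≥0) : distUpTo y z k u u = 0 := by
  induction k with
  | zero => simp [distUpTo]
  | succ k ih => by_cases h : u ≤ y k <;> simp [distUpTo, h, ih]

theorem distUpTo_comm (k : ℕ) (u v : ℝ≥0) : distUpTo y z k u v = distUpTo y z k v u := by
  induction k with
  | zero => simp [distUpTo, abs_sub_comm]
  | succ k ih =>
    by_cases h : u ≤ y k <;> by_cases h' : v ≤ y k <;> simp [distUpTo, h, h', ih, abs_sub_comm]

theorem distUpTo_nonneg (k : ℕ) (u v : ℝ≥0) : 0 ≤ distUpTo y z k u v := by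
  induction k generalizing u v with
  | zero => simp [distUpTo]
  | succ k ih =>
    have h1 := ih u v
    have h2 := ih u (z k)
    have h3 := ih v (z k)
    by_cases h : u ≤ y k <;> by_cases h' : v ≤ y k <;> simp only [distUpTo, h, h', if_true, if_false]
    all_goals positivity

theorem distUpTo_triangle (h : IsLineBreaking y z) (k : ℕ) (u v w : ℝ≥0)
    (hu : u ≤ y k) (hv : v ≤ y k) (hw : w ≤ y k) :
    distUpTo y z k u w ≤ distUpTo y z k u v + distUpTo y z k v w := by
  induction k generalizing u v w with
  | zero => simpa [distUpTo] using abs_sub_le (u : ℝ) v w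
  | succ k ih =>
    have hz : z k ≤ y k := (h.lt k).le
    have e1 := abs_sub_le (u : ℝ) v w
    have e2 := abs_sub_le (u : ℝ) v (y k)
    have e3 := abs_sub_le (v : ℝ) u (y k)
    have e4 := abs_sub_le (w : ℝ) v (y k)
    have e5 := abs_sub_le (v : ℝ) w (y k)
    have e6 := abs_sub_comm (u : ℝ) v
    have e7 := abs_sub_comm (w : ℝ) v
    have e8 := abs_sub_le (u : ℝ) (y k) w
    have e9 := abs_sub_comm (w : ℝ) (y k)
    have n1 := distUpTo_nonneg (y := y) (z := z) k u (z k)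
    have n2 := distUpTo_nonneg (y := y) (z := z) k v (z k)
    have n3 := distUpTo_nonneg (y := y) (z := z) k w (z k)
    have a1 := abs_nonneg ((v : ℝ) - y k)
    have c1 := distUpTo_comm (y := y) (z := z) k (z k) w
    have c2 := distUpTo_comm (y := y) (z := z) k v w
    have c3 := distUpTo_comm (y := y) (z := z) k u v
    by_cases h1 : u ≤ y k <;> by_cases h2 : v ≤ y k <;> by_cases h3 : w ≤ y k <;>
      simp only [distUpTo, h1, h2, h3, if_true, if_false]
    · exact ih u v w h1 h2 h3
    · linarith [ih u v (z k) h1 h2 hz]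
    · linarith [ih u (z k) w h1 hz h3]
    · linarith
    · linarith [ih w v (z k) h3 h2 hz]
    · linarith
    · linarith
    · exact e1

theorem distUpTo_eq_zero (k : ℕ) (u v : ℝ≥0)
    (hu : u ≤ y k) (hv : v ≤ y k) (huv : distUpTo y z k u v = 0) : u = v := by
  induction k generalizing u v with
  | zero => simpa [distUpTo, sub_eq_zero] using huv
  | succ k ih =>
    have n1 := distUpTo_nonneg (y := y) (z := z) k u (z k)
    have n2 := distUpTo_nonneg (y := y) (z := z) k v (z k)
    by_cases h1 : u ≤ y k <;> by_cases h2 : v ≤ y k <;>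
      simp only [distUpTo, h1, h2, if_true, if_false] at huv
    · exact ih u v h1 h2 huv
    · have h0 : |(v : ℝ) - y k| = 0 := le_antisymm (by linarith) (abs_nonneg _)
      rw [abs_eq_zero, sub_eq_zero, NNReal.coe_inj] at h0
      exact absurd h0.le h2
    · have h0 : |(u : ℝ) - y k| = 0 := le_antisymm (by linarith) (abs_nonneg _)
      rw [abs_eq_zero, sub_eq_zero, NNReal.coe_inj] at h0
      exact absurd h0.le h1
    · rwa [abs_eq_zero, sub_eq_zero, NNReal.coe_inj] at huv

theorem distUpTo_eq_of_le (h : IsLineBreaking y z) {j k : ℕ} (hjk : j ≤ k) {u v : ℝ≥0}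
    (hu : u ≤ y j) (hv : v ≤ y j) : distUpTo y z k u v = distUpTo y z j u v := by
  induction k, hjk using Nat.le_induction with
  | base => rfl
  | succ k hk ih =>
    have hm := h.strictMono.monotone hk
    simp only [distUpTo, hu.trans hm, hv.trans hm, if_true, ih]

theorem exists_le (h : IsLineBreaking y z) (u : ℝ≥0) : ∃ k, u ≤ y k :=
  (h.tendsto_atTop.eventually_ge_atTop u).exists

theorem treeDist_eq (h : IsLineBreaking y z) {k : ℕ} {u v : ℝ≥0} (hu : u ≤ y k) (hv : v ≤ y k) :
    treeDist y z u v = distUpTo y z k u v := by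
  have hmem : k ∈ {k | u ≤ y k ∧ v ≤ y k} := ⟨hu, hv⟩
  have hs := Nat.sInf_mem ⟨k, hmem⟩
  exact (distUpTo_eq_of_le h (Nat.sInf_le hmem) hs.1 hs.2).symm

/-- The half-line with the line-breaking metric. -/
def Skeleton (_h : IsLineBreaking y z) : Type := ℝ≥0

instance (h : IsLineBreaking y z) : MetricSpace (Skeleton h) where
  dist u v := treeDist y z u v
  dist_self u := distUpTo_self _ u
  dist_comm u v := by
    obtain ⟨k, hk⟩ := exists_le h (max u v)
    obtain ⟨hu, hv⟩ := max_le_iff.1 hk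
    rw [treeDist_eq h hu hv, treeDist_eq h hv hu]
    exact distUpTo_comm k _ _
  dist_triangle u v w := by
    obtain ⟨k, hk⟩ := exists_le h (max u (max v w))
    obtain ⟨hu, hk⟩ := max_le_iff.1 hk
    obtain ⟨hv, hw⟩ := max_le_iff.1 hk
    rw [treeDist_eq h hu hv, treeDist_eq h hv hw, treeDist_eq h hu hw]
    exact distUpTo_triangle h k u v w hu hv hw
  eq_of_dist_eq_zero := by
    intro u v huv
    obtain ⟨k, hk⟩ := exists_le h (max u v)
    obtain ⟨hu, hv⟩ := max_le_iff.1 hk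
    change treeDist y z u v = 0 at huv
    rw [treeDist_eq h hu hv] at huv
    exact distUpTo_eq_zero k u v hu hv huv

/-- The tree `𝒯`: the completion of the half-line for the line-breaking metric. -/
abbrev Tree (h : IsLineBreaking y z) : Type := UniformSpace.Completion (Skeleton h)

instance (h : IsLineBreaking y z) : MeasurableSpace (Tree h) := borel _

instance (h : IsLineBreaking y z) : BorelSpace (Tree h) := ⟨rfl⟩

/-- The point of the tree given by a point of the half-line. -/
def point (h : IsLineBreaking y z) (u : ℝ≥0) : Tree h :=
  ((show Skeleton h from u : Skeleton h) : UniformSpace.Completion (Skeleton h))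

/-- The subtree made of `[0, y k]`; in `1`-based numbering this is `𝒯(k+1)`. -/
def subtree (h : IsLineBreaking y z) (k : ℕ) : Set (Tree h) := point h '' Set.Iic (y k)

/-- The empirical measure of the first `k + 1` cut points as a measure on the tree; in `1`-based
numbering this is `μ_{k+1}`. -/
def empirical (h : IsLineBreaking y z) (k : ℕ) : ProbabilityMeasure (Tree h) :=
  ⟨((k : ℝ≥0∞) + 1)⁻¹ • ∑ i : Fin (k + 1), Measure.dirac (point h (y i)), ⟨by
    have h0 : (k : ℝ≥0∞) + 1 ≠ 0 := by simp
    have h1 : (k : ℝ≥0∞) + 1 ≠ ∞ := by simp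
    simp [ENNReal.inv_mul_cancel h0 h1]⟩⟩

/-- The same empirical measure, as a measure on the subtree that carries it. -/
def empiricalSubtree (h : IsLineBreaking y z) (k : ℕ) : Measure (subtree h k) :=
  ((k : ℝ≥0∞) + 1)⁻¹ • ∑ i : Fin (k + 1), Measure.dirac
    (⟨point h (y i), y i, h.strictMono.monotone (Nat.lt_succ_iff.1 i.2), rfl⟩ : subtree h k)

end Deterministic

/-! ### The Gromov–Hausdorff–Prokhorov distance -/

/-- The Gromov–Hausdorff–Prokhorov distance of two metric measure spaces: the infimum, over all
isometric embeddings into a common metric space, of the larger of the Hausdorff distance of the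
images and the Lévy–Prokhorov distance of the image measures. -/
def ghpEDist (X Y : Type) [MetricSpace X] [MeasurableSpace X] [MetricSpace Y] [MeasurableSpace Y]
    (μ : Measure X) (ν : Measure Y) : ℝ≥0∞ :=
  ⨅ (Z : Type) (_ : MetricSpace Z) (_ : MeasurableSpace Z) (_ : BorelSpace Z)
    (φ : X → Z) (ψ : Y → Z) (_ : Isometry φ) (_ : Isometry ψ),
    max (Metric.hausdorffEDist (Set.range φ) (Set.range ψ))
      (levyProkhorovEDist (μ.map φ) (ν.map ψ))

/-! ### The intensity process -/

/-- The continuous density `p` of `L₁`, for the spectrally positive `α`-stable Lévy process `L` with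
`E[exp (-q L_t)] = exp (t q ^ α)` for `q ≥ 0`. It is the inverse Fourier transform of the
characteristic function `E[exp (i u L₁)] = exp ((-i u) ^ α)` (principal branch). -/
def stableDensity (α x : ℝ) : ℝ :=
  (2 * Real.pi)⁻¹ *
    (∫ u : ℝ, Complex.exp (-(Complex.I * u * x)) *
      Complex.exp ((-(Complex.I * u)) ^ (α : ℂ))).re

/-- `σ` is an increasing càdlàg Lévy process with `E[exp (-q σ_t)] = exp (-t α q ^ (α - 1))`.
(An increasing function has left limits, so that càdlàg reduces to right-continuity.) -/
structure IsStableSubordinator {Ω : Type*} [MeasurableSpace Ω] (α : ℝ) (σ : ℝ≥0 → Ω → ℝ)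
    (P : Measure Ω) : Prop where
  measurable : ∀ t, Measurable (σ t)
  mono : ∀ ω, Monotone fun t => σ t ω
  rightCts : ∀ ω t, ContinuousWithinAt (fun s => σ s ω) (Set.Ici t) t
  zero : ∀ ω, σ 0 ω = 0
  indep : HasIndepIncrements σ P
  stationary : ∀ s t, IdentDistrib (fun ω => σ (s + t) ω - σ s ω) (σ t) P P
  laplace : ∀ (t : ℝ≥0) (q : ℝ), 0 ≤ q →
    ∫ ω, Real.exp (-(q * σ t ω)) ∂P = Real.exp (-(t * α * q ^ (α - 1)))

/-- The integral of a path over the time interval `[s, t]`. -/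
def pathIntegral (x : ℝ≥0 → ℝ) (s t : ℝ≥0) : ℝ := ∫ r in (s : ℝ)..t, x r.toNNReal

/-- The density process `M_t = exp (∫₀ᵗ σ_s ds) p(-σ_t) / p(0)`, as a function of the path. -/
def tilt (α : ℝ) (x : ℝ≥0 → ℝ) (t : ℝ≥0) : ℝ :=
  Real.exp (pathIntegral x 0 t) * stableDensity α (-(x t)) / stableDensity α 0

/-- `τ` is an increasing càdlàg process whose law up to every fixed time `t` has density `M_t` with
respect to the law of `σ` up to time `t`, that is,
`E[F((τ_s)_{s ≤ t})] = E[M_t F((σ_s)_{s ≤ t})]` for all test functions `F`. -/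
structure IsTilted {Ω' Ω : Type*} [MeasurableSpace Ω'] [MeasurableSpace Ω] (α : ℝ)
    (σ : ℝ≥0 → Ω' → ℝ) (P' : Measure Ω') (τ : ℝ≥0 → Ω → ℝ) (P : Measure Ω) : Prop where
  measurable : ∀ t, Measurable (τ t)
  mono : ∀ ω, Monotone fun t => τ t ω
  rightCts : ∀ ω t, ContinuousWithinAt (fun s => τ s ω) (Set.Ici t) t
  nonneg : ∀ ω t, 0 ≤ τ t ω
  law : ∀ t : ℝ≥0,
    P.map (fun ω (s : Set.Iic t) => τ s ω) =
      (P'.withDensity fun ω => ENNReal.ofReal (tilt α (fun s => σ s ω) t)).map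
        fun ω (s : Set.Iic t) => σ s ω

/-! ### Random cut points and attachment points -/

/-- Conditionally on `τ`, the points `Y 0 < Y 1 < ...` are the jump times, in increasing order, of
an inhomogeneous Poisson process with intensity `τ_t dt`: given `τ`, the numbers of points in
the consecutive intervals `(t i, t (i+1)]` are independent Poisson variables with means
`∫ r in t i..t (i+1), τ_r dr`. -/
structure IsCoxPoints {Ω : Type*} [MeasurableSpace Ω] (P : Measure Ω) (τ : ℝ≥0 → Ω → ℝ)
    (Y : ℕ → Ω → ℝ≥0) : Prop where
  measurable : ∀ k, Measurable (Y k)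
  pos : ∀ᵐ ω ∂P, 0 < Y 0 ω
  strictMono : ∀ᵐ ω ∂P, StrictMono fun k => Y k ω
  counts : ∀ (t : ℕ → ℝ≥0), Monotone t → ∀ (m : ℕ) (n : ℕ → ℕ) (A : Set (ℝ≥0 → ℝ)),
    MeasurableSet A →
    P {ω | (fun s => τ s ω) ∈ A ∧
        ∀ i < m, Set.encard {k | Y k ω ∈ Set.Ioc (t i) (t (i + 1))} = n i} =
      ∫⁻ ω in {ω | (fun s => τ s ω) ∈ A},
        ∏ i ∈ Finset.range m, ENNReal.ofReal
          (Real.exp (-pathIntegral (fun s => τ s ω) (t i) (t (i + 1))) *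
            pathIntegral (fun s => τ s ω) (t i) (t (i + 1)) ^ n i / (n i).factorial) ∂P

/-- The `U k` are i.i.d. uniform on `[0, 1]` and independent of `(τ, Y)`. -/
structure IsUniformMarks {Ω : Type*} [MeasurableSpace Ω] (P : Measure Ω) (τ : ℝ≥0 → Ω → ℝ)
    (Y : ℕ → Ω → ℝ≥0) (U : ℕ → Ω → ℝ) : Prop where
  measurable : ∀ k, Measurable (U k)
  uniform : ∀ k, P.map (U k) = volume.restrict (Set.Icc 0 1)
  iIndep : iIndepFun U P
  indep : IndepFun (fun ω k => U k ω) (fun ω => ((fun t => τ t ω), fun k => Y k ω)) P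

/-- The attachment point `inf {t > 0 : τ_t > u τ_{y-}}`, for a path `x` of `τ`, a cut point `y` and
a mark `u`. -/
def attach (x : ℝ≥0 → ℝ) (y : ℝ≥0) (u : ℝ) : ℝ≥0 :=
  sInf {t | 0 < t ∧ u * Function.leftLim x y < x t}

end LineBreaking

end

/-! Write `w k` for the intensity at the cut point `Y k`. Given `τ`, the cut points avoid the jumps
of `τ` (`IsCoxPoints.ae_leftLim_eq`), so `w k` is also the left limit there. For `s` a cut point or
a rational time, the attachment point is at most `s` exactly when `U k * w k < τ s`, almost surely
(`attach_le_iff`). Hence, given `(τ, Y)`, a new branch picks its parent among the earlier ones with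
probability proportional to the increment of `w` over that parent: a weighted recursive tree driven
by independent uniforms. Labels inherited along this tree carry both halves of the theorem.

Compactness. If a branch multiplies its parent's label by `exp (l * length)`, the label dominates
the exponential of `l` times the distance to the first `n` branches (`exp_treeDist_proj_le`). The
mean label satisfies an explicit recursion. When the lengths are `O(1 / √w)`, it stays below `exp 5`
as long as `l` is at most of order `√(w n)` (`integral_label_exp_le`). Markov's inequality and
Borel–Cantelli along `n = 2 ^ i` bound the distances between dyadic stages by a geometric sequence
(`eventually_label_exp_le`). So the projections on the first branches converge uniformly to the
identity, which gives compactness and Hausdorff convergence.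

Measure. With all factors equal to `1`, the label indicates that a branch projects into a given
initial segment. The labelled proportion of mass is a bounded martingale, as in a Pólya urn. The
labels minus their conditional means average to zero by an `L²` martingale and Kronecker's lemma
(`ae_tendsto_average_label`). Step functions of the projections approximate continuous functions, so
averages of continuous functions at the cut points converge (`hasMean_continuous`), and compactness
of the space of probability measures supplies the limit `μ`.

Inputs on `(τ, Y)`. The tilt is at most a constant times `exp (t * x)` on `{σ t ≤ x}`, while the
subordinator is small with tiny probability. So `τ` grows at least like a power of time
(`exists_ae_eventually_le_tilted_pow`). Poisson estimates then give gaps at most `4 / √w`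
(`IsCoxPoints.ae_gap_le`) and polynomial growth of `w k` in `k` (`IsCoxPoints.ae_index_le`). The
properties required of the marks form a measurable set (`IsTypical`), so Fubini allows `(τ, Y)` to
be frozen. -/

noncomputable section

namespace LineBreaking

/-! ### Labels propagated along the attachment process

The interval `[w (j - 1), w j)` stands for the mass of the `j`-th branch. Branch `k + 1` is attached
to the branch that contains `u k * w k`. -/

/-- Labels of the branches: branches up to `n` carry no label, and the branch `k + 1` receives
`g (k + 1)` times the label of the branch to which it is attached, where the part `[0, c)` of the
mass of the first `n` branches has label `1` and the rest of that mass has label `0`. -/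
def label (n : ℕ) (c : ℝ) (g w u : ℕ → ℝ) : ℕ → ℝ
  | 0 => 0
  | k + 1 => if k < n then 0 else
      g (k + 1) * ((if u k * w k < c then 1 else 0) +
        ∑ j : Fin (k + 1), if w (j - 1) ≤ u k * w k ∧ u k * w k < w j then
          label n c g w u j else 0)

/-- The total label of the mass of the first `k` branches. -/
def labelMass (n : ℕ) (c : ℝ) (g w u : ℕ → ℝ) (k : ℕ) : ℝ :=
  c + ∑ j ∈ Finset.range (k + 1), (w j - w (j - 1)) * label n c g w u j

section Label

variable {n : ℕ} {c : ℝ} {g w u : ℕ → ℝ}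

theorem label_of_le {k : ℕ} (hk : k ≤ n) : label n c g w u k = 0 := by
  cases k with
  | zero => rw [label]
  | succ k => rw [label, if_pos (by omega)]

theorem label_succ {k : ℕ} (hk : n ≤ k) : label n c g w u (k + 1) =
    g (k + 1) * ((if u k * w k < c then 1 else 0) +
      ∑ j ∈ Finset.range (k + 1), if w (j - 1) ≤ u k * w k ∧ u k * w k < w j then
        label n c g w u j else 0) := by
  rw [label, if_neg (by omega), Finset.sum_range]

theorem sum_label_of_lt (hw : Monotone w) {k : ℕ} {x : ℝ} (hx : x < w n) :
    (∑ j ∈ Finset.range (k + 1), if w (j - 1) ≤ x ∧ x < w j then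
        label n c g w u j else 0) = 0 := by
  refine Finset.sum_eq_zero fun j _ => ?_
  split_ifs with h
  · refine label_of_le ?_
    by_contra hj
    have := hw (show n ≤ j - 1 by omega)
    linarith [h.1]
  · rfl

/-- The intervals of distinct branches are disjoint because `w` is monotone, so one term survives.
-/
theorem sum_label_of_mem (hw : Monotone w) {j k : ℕ} {x : ℝ} (hj : 0 < j) (hjk : j ≤ k)
    (h1 : w (j - 1) ≤ x) (h2 : x < w j) :
    (∑ j ∈ Finset.range (k + 1), if w (j - 1) ≤ x ∧ x < w j then
        label n c g w u j else 0) = label n c g w u j := by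
  rw [Finset.sum_eq_single j, if_pos ⟨h1, h2⟩]
  · intro i _ hij
    rcases Nat.eq_zero_or_pos i with rfl | hi
    · rw [label_of_le (Nat.zero_le _), ite_self]
    rw [if_neg]
    rintro ⟨h3, h4⟩
    rcases lt_or_gt_of_ne hij with h | h
    · have := hw (show i ≤ j - 1 by omega)
      linarith
    · have := hw (show j ≤ i - 1 by omega)
      linarith
  · intro h
    exact absurd (Finset.mem_range.2 (by omega)) h

theorem label_succ_of_lt (hw : Monotone w) (hc : c ≤ w n) {k : ℕ} (hk : n ≤ k)
    (hx : u k * w k < c) : label n c g w u (k + 1) = g (k + 1) := by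
  rw [label_succ hk, if_pos hx, sum_label_of_lt hw (hx.trans_le hc)]
  ring

theorem label_succ_of_le_of_lt (hw : Monotone w) {k : ℕ} (hk : n ≤ k)
    (hx : c ≤ u k * w k) (hx' : u k * w k < w n) : label n c g w u (k + 1) = 0 := by
  rw [label_succ hk, if_neg hx.not_gt, sum_label_of_lt hw hx']
  ring

theorem label_succ_of_mem (hw : Monotone w) (hc : c ≤ w n) {j k : ℕ} (hj : n < j) (hjk : j ≤ k)
    (h1 : w (j - 1) ≤ u k * w k) (h2 : u k * w k < w j) :
    label n c g w u (k + 1) = g (k + 1) * label n c g w u j := by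
  have := hw (show n ≤ j - 1 by omega)
  rw [label_succ (by omega), if_neg (by linarith), sum_label_of_mem hw (by omega) hjk h1 h2,
    zero_add]

theorem exists_branch {w : ℕ → ℝ} {k : ℕ} {x : ℝ} (h1 : w n ≤ x) (h2 : x < w k) (hnk : n ≤ k) :
    ∃ j, n < j ∧ j ≤ k ∧ w (j - 1) ≤ x ∧ x < w j := by
  induction k, hnk using Nat.le_induction with
  | base => exact absurd h2 h1.not_gt
  | succ k hk ih =>
    rcases lt_or_ge x (w k) with h | h
    · obtain ⟨j, a, b, c⟩ := ih h
      exact ⟨j, a, by omega, c⟩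
    · exact ⟨k + 1, by omega, le_rfl, h, h2⟩

theorem label_nonneg (hg : ∀ k, 0 ≤ g k) (k : ℕ) : 0 ≤ label n c g w u k := by
  induction k using Nat.strong_induction_on with
  | _ k ih =>
    cases k with
    | zero => rw [label]
    | succ k =>
      rcases lt_or_ge k n with h | h
      · rw [label_of_le (by omega)]
      rw [label_succ h]
      refine mul_nonneg (hg _) (add_nonneg (by positivity) (Finset.sum_nonneg fun j hj => ?_))
      split_ifs
      · exact ih j (Finset.mem_range.1 hj)
      · exact le_rfl

/-- Uniformity in `u` makes labels of random marks bounded, hence integrable. -/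
theorem exists_label_le (n : ℕ) (c : ℝ) {g : ℕ → ℝ} (hg : ∀ k, 0 ≤ g k) (w : ℕ → ℝ) (k : ℕ) :
    ∃ B, ∀ u, label n c g w u k ≤ B := by
  induction k using Nat.strong_induction_on with
  | _ k ih =>
    cases k with
    | zero => exact ⟨0, fun u => by rw [label]⟩
    | succ k =>
      rcases lt_or_ge k n with h | h
      · exact ⟨0, fun u => by rw [label_of_le (by omega)]⟩
      choose! B hB using ih
      refine ⟨g (k + 1) * (1 + ∑ j ∈ Finset.range (k + 1), B j), fun u => ?_⟩
      rw [label_succ h]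
      refine mul_le_mul_of_nonneg_left (add_le_add (by split_ifs <;> norm_num)
        (Finset.sum_le_sum fun j hj => ?_)) (hg _)
      have hj' := hB j (Finset.mem_range.1 hj) u
      split_ifs
      · exact hj'
      · exact (label_nonneg hg j).trans hj'

theorem label_one_mem (hw : Monotone w) (hc : c ≤ w n) (k : ℕ) :
    label n c 1 w u k = 0 ∨ label n c 1 w u k = 1 := by
  induction k using Nat.strong_induction_on with
  | _ k ih =>
    cases k with
    | zero => left; rw [label]
    | succ k =>
      rcases lt_or_ge k n with h | h
      · left; rw [label_of_le (by omega)]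
      rcases lt_or_ge (u k * w k) c with h1 | h1
      · right; rw [label_succ_of_lt hw hc h h1]; rfl
      rcases lt_or_ge (u k * w k) (w n) with h2 | h2
      · left; rw [label_succ_of_le_of_lt hw h h1 h2]
      rcases lt_or_ge (u k * w k) (w k) with h3 | h3
      · obtain ⟨j, a, b, h4, h5⟩ := exists_branch h2 h3 h
        rw [label_succ_of_mem hw hc a b h4 h5, Pi.one_apply, one_mul]
        exact ih j (by omega)
      -- Nothing bounds `u k` by `1` here; a position beyond the total mass meets no branch and
      -- yields label `0`.
      · left
        rw [label_succ h, if_neg h1.not_gt, Finset.sum_eq_zero, add_zero, mul_zero]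
        intro j hj
        rw [if_neg]
        rintro ⟨-, h4⟩
        have := hw (show j ≤ k by have := Finset.mem_range.1 hj; omega)
        linarith

/-- Only the marks before `k` matter, which gives adaptedness. The general `β` serves both for the
`σ`-algebra of the past and for the space of all data in `measurableSet_isTypical`. -/
theorem measurable_label {β : Type*} [MeasurableSpace β] {c : β → ℝ} {g w u : ℕ → β → ℝ}
    (hc : Measurable c) (hg : ∀ k, Measurable (g k)) (hw : ∀ k, Measurable (w k)) (k : ℕ)
    (hu : ∀ j < k, Measurable (u j)) :
    Measurable fun b => label n (c b) (fun i => g i b) (fun i => w i b) (fun i => u i b) k := by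
  induction k using Nat.strong_induction_on with
  | _ k ih =>
    cases k with
    | zero => simp only [label]; exact measurable_const
    | succ k =>
      rcases lt_or_ge k n with h | h
      · simp only [label_of_le (show k + 1 ≤ n by omega)]; exact measurable_const
      simp only [label_succ h]
      have hx : Measurable fun b => u k b * w k b := (hu k (by omega)).mul (hw k)
      refine (hg _).mul (Measurable.add ?_ (Finset.measurable_fun_sum _ fun j hj => ?_))
      · exact Measurable.ite (measurableSet_lt hx hc) measurable_const measurable_const
      · have hj := Finset.mem_range.1 hj
        exact Measurable.ite ((measurableSet_le (hw _) hx).inter (measurableSet_lt hx (hw _)))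
          (ih j hj fun i hi => hu i (by omega)) measurable_const

theorem labelMass_succ (k : ℕ) : labelMass n c g w u (k + 1) =
    labelMass n c g w u k + (w (k + 1) - w k) * label n c g w u (k + 1) := by
  simp only [labelMass, Finset.sum_range_succ _ (k + 1), add_tsub_cancel_right]
  ring

theorem labelMass_of_le {k : ℕ} (hk : k ≤ n) : labelMass n c g w u k = c := by
  rw [labelMass, Finset.sum_eq_zero, add_zero]
  intro j hj
  rw [label_of_le (by have := Finset.mem_range.1 hj; omega), mul_zero]

theorem labelMass_nonneg (hw : Monotone w) (hg : ∀ k, 0 ≤ g k) (hc : 0 ≤ c) (k : ℕ) :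
    0 ≤ labelMass n c g w u k :=
  add_nonneg hc (Finset.sum_nonneg fun j _ =>
    mul_nonneg (sub_nonneg.2 (hw (Nat.sub_le _ _))) (label_nonneg hg j))

theorem labelMass_one_le (hw : Monotone w) (hc : c ≤ w n) {k : ℕ} (hk : n ≤ k) :
    labelMass n c 1 w u k ≤ w k := by
  induction k, hk using Nat.le_induction with
  | base => rwa [labelMass_of_le le_rfl]
  | succ k hk ih =>
    rw [labelMass_succ]
    have := hw (show k ≤ k + 1 by omega)
    rcases label_one_mem (u := u) hw hc (k + 1) with h | h <;> rw [h] <;> linarith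

theorem exists_labelMass_le (n : ℕ) (c : ℝ) {g : ℕ → ℝ} (hg : ∀ k, 0 ≤ g k) {w : ℕ → ℝ}
    (hw : Monotone w) (k : ℕ) : ∃ B, ∀ u, labelMass n c g w u k ≤ B := by
  choose B hB using exists_label_le n c hg w
  exact ⟨c + ∑ j ∈ Finset.range (k + 1), (w j - w (j - 1)) * B j, fun u =>
    add_le_add le_rfl (Finset.sum_le_sum fun j _ =>
      mul_le_mul_of_nonneg_left (hB j u) (sub_nonneg.2 (hw (Nat.sub_le _ _))))⟩

theorem measurable_labelMass {β : Type*} [MeasurableSpace β] {c : β → ℝ} {g w u : ℕ → β → ℝ}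
    (hc : Measurable c) (hg : ∀ k, Measurable (g k)) (hw : ∀ k, Measurable (w k)) (k : ℕ)
    (hu : ∀ j < k, Measurable (u j)) :
    Measurable fun b =>
      labelMass n (c b) (fun i => g i b) (fun i => w i b) (fun i => u i b) k := by
  simp only [labelMass]
  refine hc.add (Finset.measurable_fun_sum _ fun j hj => ((hw _).sub (hw _)).mul ?_)
  exact measurable_label hc hg hw j fun i hi => hu i (by have := Finset.mem_range.1 hj; omega)

end Label

/-! ### Labels driven by independent uniform marks: the one-step identity -/

section RandomLabel

variable {Ω : Type*} {U : ℕ → Ω → ℝ} {n : ℕ} {c : ℝ} {g w : ℕ → ℝ}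

/-- The `σ`-algebra generated by the first `k` variables of a sequence. -/
@[reducible] def past (U : ℕ → Ω → ℝ) (k : ℕ) : MeasurableSpace Ω :=
  ⨆ j ∈ Set.Iio k, MeasurableSpace.comap (U j) inferInstance

theorem past_mono (U : ℕ → Ω → ℝ) : Monotone (past U) := fun _ _ h =>
  biSup_mono fun _ hj => lt_of_lt_of_le hj h

theorem measurable_past {j k : ℕ} (h : j < k) : Measurable[past U k] (U j) :=
  Measurable.mono (comap_measurable (U j))
    (le_iSup₂_of_le (f := fun j (_ : j ∈ Set.Iio k) =>
      MeasurableSpace.comap (U j) inferInstance) j h le_rfl) le_rfl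

theorem measurable_label_past (n : ℕ) (c : ℝ) (g w : ℕ → ℝ) (k : ℕ) :
    Measurable[past U k] fun ω => label n c g w (fun i => U i ω) k :=
  @measurable_label n Ω (past U k) (fun _ => c) (fun i _ => g i) (fun i _ => w i) U
    measurable_const (fun _ => measurable_const) (fun _ => measurable_const) k
    fun _ hj => measurable_past hj

theorem measurable_labelMass_past (n : ℕ) (c : ℝ) (g w : ℕ → ℝ) (k : ℕ) :
    Measurable[past U k] fun ω => labelMass n c g w (fun i => U i ω) k :=
  @measurable_labelMass n Ω (past U k) (fun _ => c) (fun i _ => g i) (fun i _ => w i) U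
    measurable_const (fun _ => measurable_const) (fun _ => measurable_const) k
    fun _ hj => measurable_past hj

variable [mΩ : MeasurableSpace Ω] {P : Measure Ω}

theorem past_le (hm : ∀ k, Measurable (U k)) (k : ℕ) : past U k ≤ mΩ :=
  iSup₂_le fun j _ => (hm j).comap_le

/-- The filtration generated by a sequence of random variables after the first `n`, the variable
with index `n + k` being known only at time `k + 1`. -/
def pastFiltration (hm : ∀ k, Measurable (U k)) (n : ℕ) : Filtration ℕ mΩ where
  seq k := past U (n + k)
  mono' _ _ h := past_mono U (Nat.add_le_add_left h n)
  le' _ := past_le hm _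

theorem indepFun_past (hm : ∀ k, Measurable (U k)) (hi : iIndepFun U P) {k : ℕ} {H : Ω → ℝ}
    (hH : Measurable[past U k] H) : IndepFun (U k) H P := by
  have h1 := indep_iSup_of_disjoint (fun j => (hm j).comap_le) hi
    (S := {k}) (T := Set.Iio k) (by simp)
  rw [iSup_singleton] at h1
  exact indep_of_indep_of_le_right h1 hH.comap_le

theorem integral_uniform_mul (hm : ∀ k, Measurable (U k))
    (hu : ∀ k, P.map (U k) = volume.restrict (Set.Icc 0 1)) (hi : iIndepFun U P) {k : ℕ}
    {H : Ω → ℝ} (hH : Measurable[past U k] H) {s : Set ℝ} [DecidablePred (· ∈ s)]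
    (hs : MeasurableSet s) {a b : ℝ}
    (hab : a ≤ b) (hs' : s ∩ Set.Icc 0 1 = Set.Ico a b) :
    ∫ ω, (if U k ω ∈ s then 1 else 0) * H ω ∂P = (b - a) * ∫ ω, H ω ∂P := by
  have hf : Measurable fun x : ℝ => if x ∈ s then (1 : ℝ) else 0 :=
    Measurable.ite hs measurable_const measurable_const
  have h1 := (indepFun_past hm hi hH).integral_fun_comp_mul_comp (f := fun x : ℝ =>
    if x ∈ s then (1 : ℝ) else 0) (g := id) (hm k).aemeasurable
    (hH.mono (past_le hm k) le_rfl).aemeasurable hf.aestronglyMeasurable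
    measurable_id.aestronglyMeasurable
  have h2 : ∫ ω, (if U k ω ∈ s then (1 : ℝ) else 0) ∂P = b - a := by
    rw [← integral_map (φ := U k) (f := fun x : ℝ => if x ∈ s then (1 : ℝ) else 0)
      (hm k).aemeasurable hf.aestronglyMeasurable, hu k]
    have : (fun x : ℝ => if x ∈ s then (1 : ℝ) else 0) = s.indicator 1 := by
      ext x; simp [Set.indicator]
    rw [this, integral_indicator_one hs, measureReal_restrict_apply hs, hs',
      Real.volume_real_Ico_of_le hab]
  simpa [h2] using h1

variable [IsProbabilityMeasure P]

theorem integrable_of_abs_le {f : Ω → ℝ} (hf : Measurable f) {B : ℝ} (hB : ∀ ω, |f ω| ≤ B) :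
    Integrable f P :=
  Integrable.of_bound hf.aestronglyMeasurable B (.of_forall hB)

/-- Given the past, `U k * w k` is uniform on `[0, w k]`, so it falls in the interval of branch `j`
with probability `(w j - w (j - 1)) / w k`. Testing against a bounded `H` from the past replaces
conditional expectation. -/
theorem integral_mul_label (hm : ∀ k, Measurable (U k))
    (hu : ∀ k, P.map (U k) = volume.restrict (Set.Icc 0 1)) (hi : iIndepFun U P)
    (hw : Monotone w) (hw0 : ∀ k, 0 < w k) (hc0 : 0 ≤ c) (hc : c ≤ w n) (hg : ∀ k, 0 ≤ g k)
    {k : ℕ} (hk : n ≤ k) {H : Ω → ℝ} (hH : Measurable[past U k] H) {B : ℝ}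
    (hB : ∀ ω, |H ω| ≤ B) :
    ∫ ω, H ω * label n c g w (fun i => U i ω) (k + 1) ∂P =
      g (k + 1) / w k * ∫ ω, H ω * labelMass n c g w (fun i => U i ω) k ∂P := by
  have hk0 := hw0 k
  have hHm : Measurable H := hH.mono (past_le hm k) le_rfl
  have hHint : Integrable H P := integrable_of_abs_le hHm hB
  have hX : ∀ j ≤ k, Measurable[past U k] fun ω => H ω * label n c g w (fun i => U i ω) j :=
    fun j hj => @Measurable.mul _ _ _ _ (past U k) H
      (fun ω => label n c g w (fun i => U i ω) j) _ hH
      ((measurable_label_past n c g w j).mono (past_mono U hj) le_rfl)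
  have hXint : ∀ j ≤ k, Integrable (fun ω => H ω * label n c g w (fun i => U i ω) j) P := by
    intro j hj
    obtain ⟨C, hC⟩ := exists_label_le n c hg w j
    refine integrable_of_abs_le ((hX j hj).mono (past_le hm k) le_rfl) (B := B * C) fun ω => ?_
    rw [abs_mul, abs_of_nonneg (label_nonneg hg j)]
    exact mul_le_mul (hB ω) (hC _) (label_nonneg hg j) ((abs_nonneg _).trans (hB ω))
  have hUw : Measurable fun x : ℝ => x * w k := measurable_id.mul_const _
  have hs1 : MeasurableSet {x : ℝ | x * w k < c} := measurableSet_lt hUw measurable_const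
  have hs2 : ∀ j, MeasurableSet {x : ℝ | w (j - 1) ≤ x * w k ∧ x * w k < w j} := fun j =>
    (measurableSet_le measurable_const hUw).inter (measurableSet_lt hUw measurable_const)
  have e1 : ∫ ω, (if U k ω ∈ {x : ℝ | x * w k < c} then 1 else 0) * H ω ∂P =
      c / w k * ∫ ω, H ω ∂P := by
    rw [integral_uniform_mul hm hu hi hH hs1 (a := 0) (b := c / w k) (by positivity), sub_zero]
    -- This makes the constraint `x ≤ 1` automatic on `x * w k < c`.
    have hc' : c ≤ w k := hc.trans (hw hk)
    ext x
    simp only [Set.mem_inter_iff, Set.mem_ofPred_eq, Set.mem_Icc, Set.mem_Ico, lt_div_iff₀ hk0]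
    refine ⟨fun h => ⟨h.2.1, h.1⟩, fun h => ⟨h.2, h.1, ?_⟩⟩
    by_contra hx
    nlinarith
  have e2 : ∀ j ≤ k, ∫ ω, (if U k ω ∈ {x : ℝ | w (j - 1) ≤ x * w k ∧ x * w k < w j} then 1 else 0) *
      (H ω * label n c g w (fun i => U i ω) j) ∂P =
      (w j - w (j - 1)) / w k * ∫ ω, H ω * label n c g w (fun i => U i ω) j ∂P := by
    intro j hj
    rw [integral_uniform_mul hm hu hi (hX j hj) (hs2 j) (a := w (j - 1) / w k) (b := w j / w k)
      (by gcongr; exact hw (Nat.sub_le _ _)), sub_div]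
    have hj' := hw hj
    have := hw0 (j - 1)
    ext x
    simp only [Set.mem_inter_iff, Set.mem_ofPred_eq, Set.mem_Icc, Set.mem_Ico, lt_div_iff₀ hk0,
      div_le_iff₀ hk0]
    refine ⟨fun h => h.1, fun h => ⟨h, ?_, ?_⟩⟩
    · by_contra hx
      nlinarith
    · by_contra hx
      nlinarith
  have i1 : Integrable
      (fun ω => (if U k ω ∈ {x : ℝ | x * w k < c} then 1 else 0) * H ω) P :=
    hHint.bdd_mul (c := 1) (Measurable.ite (hm k hs1) measurable_const
      measurable_const).aestronglyMeasurable (.of_forall fun ω => by split_ifs <;> simp)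
  have i2 : ∀ j ≤ k, Integrable (fun ω =>
      (if U k ω ∈ {x : ℝ | w (j - 1) ≤ x * w k ∧ x * w k < w j} then 1 else 0) *
      (H ω * label n c g w (fun i => U i ω) j)) P := fun j hj =>
    (hXint j hj).bdd_mul (c := 1) (Measurable.ite (hm k (hs2 j)) measurable_const
      measurable_const).aestronglyMeasurable (.of_forall fun ω => by split_ifs <;> simp)
  have l1 : ∀ ω, H ω * label n c g w (fun i => U i ω) (k + 1) = g (k + 1) *
      ((if U k ω ∈ {x : ℝ | x * w k < c} then 1 else 0) * H ω +
        ∑ j ∈ Finset.range (k + 1),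
          (if U k ω ∈ {x : ℝ | w (j - 1) ≤ x * w k ∧ x * w k < w j} then 1 else 0) *
          (H ω * label n c g w (fun i => U i ω) j)) := by
    intro ω
    rw [label_succ hk, mul_left_comm, mul_add, Finset.mul_sum]
    simp only [Set.mem_ofPred_eq, ite_mul, one_mul, zero_mul, mul_ite, mul_one, mul_zero]
  have l2 : ∀ ω, H ω * labelMass n c g w (fun i => U i ω) k = c * H ω +
      ∑ j ∈ Finset.range (k + 1), (w j - w (j - 1)) *
        (H ω * label n c g w (fun i => U i ω) j) := by
    intro ω
    rw [labelMass, mul_add, Finset.mul_sum, mul_comm (H ω) c]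
    exact congrArg _ (Finset.sum_congr rfl fun j _ => by ring)
  have hr : ∀ j ∈ Finset.range (k + 1), j ≤ k := fun j hj => by
    have := Finset.mem_range.1 hj; omega
  simp only [l1, l2]
  rw [integral_const_mul, integral_add i1 (integrable_finsetSum _ fun j hj => i2 j (hr j hj)),
    integral_finsetSum _ fun j hj => i2 j (hr j hj), e1,
    Finset.sum_congr rfl fun j hj => e2 j (hr j hj),
    integral_add (hHint.const_mul _)
      (integrable_finsetSum _ fun j hj => (hXint j (hr j hj)).const_mul _),
    integral_finsetSum _ fun j hj => (hXint j (hr j hj)).const_mul _]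
  simp only [integral_const_mul, mul_add, Finset.mul_sum]
  congr 1
  · ring
  · exact Finset.sum_congr rfl fun j _ => by ring

end RandomLabel

/-- **Kronecker's lemma** for the weights `i + 1`. -/
theorem tendsto_average_zero_of_tendsto_sum_div {a : ℕ → ℝ} {l : ℝ}
    (h : Tendsto (fun m => ∑ i ∈ Finset.range m, a i / (i + 1)) atTop (𝓝 l)) :
    Tendsto (fun m : ℕ => (m : ℝ)⁻¹ * ∑ i ∈ Finset.range m, a i) atTop (𝓝 0) := by
  set s : ℕ → ℝ := fun m => ∑ i ∈ Finset.range m, a i / (i + 1) with hs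
  -- Summation by parts; after division by `m` both terms tend to `l`.
  have key : ∀ m : ℕ, ∑ i ∈ Finset.range m, a i = m * s m - ∑ i ∈ Finset.range m, s i := by
    intro m
    induction m with
    | zero => simp
    | succ m ih =>
      have h1 : s (m + 1) = s m + a m / (m + 1) := Finset.sum_range_succ _ _
      have h2 : (m : ℝ) + 1 ≠ 0 := by positivity
      rw [Finset.sum_range_succ, Finset.sum_range_succ, ih, h1]
      push_cast
      field_simp
      ring
  have h3 : Tendsto (fun m : ℕ => s m - (m : ℝ)⁻¹ * ∑ i ∈ Finset.range m, s i) atTop (𝓝 0) := by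
    simpa using h.sub h.cesaro
  refine h3.congr' ?_
  filter_upwards [eventually_gt_atTop 0] with m hm
  have : (m : ℝ) ≠ 0 := by positivity
  rw [key]
  field_simp

/-- An exponential of an exponential beats every geometric growth. -/
theorem summable_pow_mul_exp_neg_pow {b : ℝ} (a : ℝ) (hb : 1 < b) :
    Summable fun i : ℕ => a ^ i * Real.exp (-b ^ i) := by
  -- With `b ^ N > 2 * |a|`, the bound `exp (-x) ≤ N! / x ^ N` at `x = b ^ i` leaves a geometric
  -- series of ratio at most `1 / 2`.
  obtain ⟨N, hN⟩ := pow_unbounded_of_one_lt (2 * |a|) hb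
  have hbN : 0 < b ^ N := by positivity
  refine Summable.of_norm_bounded (g := fun i : ℕ => (N.factorial : ℝ) * (1 / 2) ^ i)
    (summable_geometric_two.mul_left _) fun i => ?_
  have h1 := Real.pow_div_factorial_le_exp (b ^ i) (by positivity) N
  have h2 : Real.exp (-b ^ i) ≤ N.factorial / (b ^ N) ^ i := by
    rw [Real.exp_neg, inv_le_comm₀ (Real.exp_pos _) (by positivity), inv_div, ← pow_mul,
      mul_comm N, pow_mul]
    exact h1
  rw [Real.norm_eq_abs, abs_mul, abs_pow, Real.abs_exp]
  calc |a| ^ i * Real.exp (-b ^ i) ≤ |a| ^ i * (N.factorial / (b ^ N) ^ i) := by gcongr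
    _ = N.factorial * (|a| / b ^ N) ^ i := by rw [div_pow]; ring
    _ ≤ _ := by
      have h3 : |a| / b ^ N ≤ 1 / 2 := by
        rw [div_le_div_iff₀ hbN two_pos]
        linarith
      exact mul_le_mul_of_nonneg_left (pow_le_pow_left₀ (by positivity) h3 i) (by positivity)

/-! ### Exponential moments of labels and control of the dyadic stages -/

section RandomLabel

variable {Ω : Type*} [mΩ : MeasurableSpace Ω] {P : Measure Ω} [IsProbabilityMeasure P]
  {U : ℕ → Ω → ℝ} {n : ℕ} {c : ℝ} {g w : ℕ → ℝ}

theorem integrable_label (hm : ∀ k, Measurable (U k)) (hg : ∀ k, 0 ≤ g k) (n : ℕ) (c : ℝ) (k : ℕ) :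
    Integrable (fun ω => label n c g w (fun i => U i ω) k) P := by
  obtain ⟨C, hC⟩ := exists_label_le n c hg w k
  refine integrable_of_abs_le ((measurable_label_past n c g w k).mono (past_le hm k) le_rfl)
    (B := C) fun ω => ?_
  rw [abs_of_nonneg (label_nonneg hg k)]
  exact hC _

theorem integrable_labelMass (hm : ∀ k, Measurable (U k)) (hg : ∀ k, 0 ≤ g k) (hw : Monotone w)
    (hc : 0 ≤ c) (n : ℕ) (k : ℕ) :
    Integrable (fun ω => labelMass n c g w (fun i => U i ω) k) P := by
  obtain ⟨C, hC⟩ := exists_labelMass_le n c hg hw k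
  refine integrable_of_abs_le ((measurable_labelMass_past n c g w k).mono (past_le hm k) le_rfl)
    (B := C) fun ω => ?_
  rw [abs_of_nonneg (labelMass_nonneg hw hg hc k)]
  exact hC _

theorem integral_label_succ (hm : ∀ k, Measurable (U k))
    (hu : ∀ k, P.map (U k) = volume.restrict (Set.Icc 0 1)) (hi : iIndepFun U P)
    (hw : Monotone w) (hw0 : ∀ k, 0 < w k) (hc0 : 0 ≤ c) (hc : c ≤ w n) (hg : ∀ k, 0 ≤ g k)
    {k : ℕ} (hk : n ≤ k) :
    ∫ ω, label n c g w (fun i => U i ω) (k + 1) ∂P =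
      g (k + 1) / w k * ∫ ω, labelMass n c g w (fun i => U i ω) k ∂P := by
  have := integral_mul_label hm hu hi hw hw0 hc0 hc hg hk (H := fun _ => 1) measurable_const
    (B := 1) (by simp)
  simpa using this

/-- Put `a = √(w k)`, `b = √(w (k + 1))` and `x = l * L (k + 1)`. Relative to `w`, the mean mass is
multiplied at each step by `1 + (b² - a²) / b² * (exp x - 1)`. As `exp x - 1 ≤ 2 * l * C / a`, the
excess is at most `4 * l * C * (1 / a - 1 / b)`, which telescopes. -/
theorem integral_labelMass_exp_le (hm : ∀ k, Measurable (U k))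
    (hu : ∀ k, P.map (U k) = volume.restrict (Set.Icc 0 1)) (hi : iIndepFun U P)
    (hw : Monotone w) (hw0 : ∀ k, 0 < w k) {L : ℕ → ℝ} {l C : ℝ} (hl : 0 ≤ l) (hC : 0 ≤ C)
    (hL : ∀ k, L (k + 1) ≤ C / √(w k)) (hl1 : l * (C / √(w n)) ≤ 1) {k : ℕ} (hk : n ≤ k) :
    ∫ ω, labelMass n (w n) (fun j => Real.exp (l * L j)) w (fun i => U i ω) k ∂P ≤
      w k * Real.exp (4 * l * C * (1 / √(w n) - 1 / √(w k))) := by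
  have hg : ∀ k, 0 ≤ Real.exp (l * L k) := fun _ => (Real.exp_pos _).le
  induction k, hk using Nat.le_induction with
  | base => simp [labelMass_of_le le_rfl]
  | succ k hk ih =>
    simp only [labelMass_succ]
    rw [integral_add (integrable_labelMass hm hg hw (hw0 n).le n k)
      ((integrable_label hm hg n _ _).const_mul _), integral_const_mul,
      integral_label_succ hm hu hi hw hw0 (hw0 n).le le_rfl hg hk]
    set I := ∫ ω, labelMass n (w n) (fun j => Real.exp (l * L j)) w (fun i => U i ω) k ∂P
    have hwk := hw0 k
    have hwk1 := hw0 (k + 1)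
    have hm1 := hw (show k ≤ k + 1 by omega)
    set a := √(w k) with ha
    set b := √(w (k + 1)) with hb
    have ha0 : 0 < a := Real.sqrt_pos.2 hwk
    have hb0 : 0 < b := Real.sqrt_pos.2 hwk1
    have hab : a ≤ b := Real.sqrt_le_sqrt hm1
    have ha2 : w k = a ^ 2 := (Real.sq_sqrt hwk.le).symm
    have hb2 : w (k + 1) = b ^ 2 := (Real.sq_sqrt hwk1.le).symm
    set x := l * L (k + 1) with hx
    have hx1 : x ≤ l * C / a := by
      rw [hx, mul_div_assoc]; gcongr; exact hL k
    have hx2 : x ≤ 1 := by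
      refine hx1.trans (le_trans ?_ hl1)
      rw [mul_div_assoc]
      gcongr
      · exact Real.sqrt_pos.2 (hw0 n)
      · exact Real.sqrt_le_sqrt (hw hk)
    have hgx : Real.exp x - 1 ≤ 2 * l * C / a := by
      -- For `0 ≤ x ≤ 1` one has `exp x - 1 ≤ 2 * x`. The sign of `L` is not prescribed, but a
      -- negative `x` only helps.
      rcases le_or_gt 0 x with h0 | h0
      · have := Real.exp_bound' h0 hx2 (n := 2) (by norm_num)
        simp [Finset.sum_range_succ, Nat.factorial] at this
        have h3 : Real.exp x - 1 ≤ 2 * x := by nlinarith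
        calc _ ≤ 2 * x := h3
          _ ≤ 2 * (l * C / a) := by linarith
          _ = _ := by ring
      · have : Real.exp x ≤ 1 := Real.exp_le_one_iff.2 h0.le
        have : 0 ≤ 2 * l * C / a := by positivity
        linarith
    have h4 : (w (k + 1) - w k) / w (k + 1) * (Real.exp x - 1) ≤
        4 * l * C * (1 / a - 1 / b) := by
      calc _ ≤ (w (k + 1) - w k) / w (k + 1) * (2 * l * C / a) :=
            mul_le_mul_of_nonneg_left hgx (div_nonneg (by linarith) hwk1.le)
        _ = 2 * l * C * ((b - a) * (b + a) / (b ^ 2 * a)) := by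
            rw [ha2, hb2]; field_simp; ring
        _ ≤ 2 * l * C * ((b - a) * (2 * b) / (b ^ 2 * a)) := by
            gcongr
            linarith
        _ = _ := by field_simp; ring
    have h5 : I + (w (k + 1) - w k) * (Real.exp x / w k * I) =
        (1 + (w (k + 1) - w k) / w (k + 1) * (Real.exp x - 1)) * (w (k + 1) / w k) * I := by
      field_simp; ring
    have h6 : 1 + (w (k + 1) - w k) / w (k + 1) * (Real.exp x - 1) ≤
        Real.exp (4 * l * C * (1 / a - 1 / b)) := by
      linarith [Real.add_one_le_exp (4 * l * C * (1 / a - 1 / b))]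
    have hI : 0 ≤ I := integral_nonneg fun ω => labelMass_nonneg hw hg (hw0 n).le k
    rw [h5]
    calc _ ≤ Real.exp (4 * l * C * (1 / a - 1 / b)) * (w (k + 1) / w k) *
          (w k * Real.exp (4 * l * C * (1 / √(w n) - 1 / a))) := by gcongr
      _ = w (k + 1) * (Real.exp (4 * l * C * (1 / √(w n) - 1 / a)) *
          Real.exp (4 * l * C * (1 / a - 1 / b))) := by field_simp
      _ = _ := by rw [← Real.exp_add]; congr 2; ring

theorem integral_label_exp_le (hm : ∀ k, Measurable (U k))
    (hu : ∀ k, P.map (U k) = volume.restrict (Set.Icc 0 1)) (hi : iIndepFun U P)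
    (hw : Monotone w) (hw0 : ∀ k, 0 < w k) {L : ℕ → ℝ} {l C : ℝ} (hl : 0 ≤ l) (hC : 0 ≤ C)
    (hL : ∀ k, L (k + 1) ≤ C / √(w k)) (hl1 : l * (C / √(w n)) ≤ 1) {k : ℕ} (hk : n ≤ k) :
    ∫ ω, label n (w n) (fun j => Real.exp (l * L j)) w (fun i => U i ω) (k + 1) ∂P ≤
      Real.exp 5 := by
  have hg : ∀ k, 0 ≤ Real.exp (l * L k) := fun _ => (Real.exp_pos _).le
  have hwk := hw0 k
  have h1 : L (k + 1) ≤ C / √(w n) := (hL k).trans <| by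
    gcongr
    · exact Real.sqrt_pos.2 (hw0 n)
    · exact hw hk
  rw [integral_label_succ hm hu hi hw hw0 (hw0 n).le le_rfl hg hk]
  calc _ ≤ Real.exp (l * L (k + 1)) / w k *
        (w k * Real.exp (4 * l * C * (1 / √(w n) - 1 / √(w k)))) := by
        gcongr
        exact integral_labelMass_exp_le hm hu hi hw hw0 hl hC hL hl1 hk
    _ = Real.exp (l * L (k + 1) + 4 * l * C * (1 / √(w n) - 1 / √(w k))) := by
        rw [Real.exp_add]; field_simp
    -- The exponent `5` is `1` for the last branch plus `4` for the telescoped sum.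
    _ ≤ Real.exp 5 := by
        gcongr
        have h2 : l * L (k + 1) ≤ 1 := (mul_le_mul_of_nonneg_left h1 hl).trans hl1
        have h3 : 4 * l * C * (1 / √(w n) - 1 / √(w k)) ≤ 4 * (l * (C / √(w n))) := by
          have : 0 ≤ 4 * l * C * (1 / √(w k)) := by positivity
          calc _ = 4 * (l * (C / √(w n))) - 4 * l * C * (1 / √(w k)) := by ring
            _ ≤ _ := by linarith
        linarith

/-- At stage `i` take `l = κ ^ (2 * i)`, negligible against `√(w (2 ^ i)) ≥ c₀ * κ ^ (3 * i)`.
Markov's inequality at level `exp (κ ^ i)` and a union bound over `2 ^ i` branches cost `2 ^ i * exp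
(5 - κ ^ i)`, which is summable. For distances this means at most `κ ^ (-i)`. -/
theorem eventually_label_exp_le (hm : ∀ k, Measurable (U k))
    (hu : ∀ k, P.map (U k) = volume.restrict (Set.Icc 0 1)) (hi : iIndepFun U P)
    (hw : Monotone w) (hw0 : ∀ k, 0 < w k) {L : ℕ → ℝ} {C c₀ κ : ℝ} (hC : 0 ≤ C)
    (hL : ∀ k, L (k + 1) ≤ C / √(w k)) (hκ : 1 < κ) (hc₀ : 0 < c₀)
    (hwκ : ∀ i : ℕ, c₀ * κ ^ (3 * i) ≤ √(w (2 ^ i))) :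
    ∀ᵐ ω ∂P, ∀ᶠ i : ℕ in atTop, ∀ k ∈ Finset.Ico (2 ^ i) (2 ^ (i + 1)),
      label (2 ^ i) (w (2 ^ i)) (fun j => Real.exp (κ ^ (2 * i) * L j)) w (fun i => U i ω) (k + 1)
        ≤ Real.exp (κ ^ i) := by
  -- From `i₀` on, `C ≤ c₀ * κ ^ i`, which gives the condition `l * (C / √(w n)) ≤ 1`.
  obtain ⟨i₀, hi₀⟩ := pow_unbounded_of_one_lt (C / c₀) hκ
  have hκ0 : 0 < κ := by linarith
  have hg : ∀ (l : ℝ) k, 0 ≤ Real.exp (l * L k) := fun _ _ => (Real.exp_pos _).le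
  set X : ℕ → ℕ → Ω → ℝ := fun i k ω =>
    label (2 ^ i) (w (2 ^ i)) (fun j => Real.exp (κ ^ (2 * i) * L j)) w (fun i => U i ω) (k + 1)
    with hX
  have h1 : ∀ i, i₀ ≤ i → ∀ k ∈ Finset.Ico (2 ^ i) (2 ^ (i + 1)),
      P {ω | Real.exp (κ ^ i) < X i k ω} ≤ ENNReal.ofReal (Real.exp 5 * Real.exp (-κ ^ i)) := by
    intro i hii k hk
    have h2 : κ ^ (2 * i) * (C / √(w (2 ^ i))) ≤ 1 := by
      have h3 : C ≤ c₀ * κ ^ i := by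
        rw [div_lt_iff₀' hc₀] at hi₀
        exact hi₀.le.trans (by gcongr; exact hκ.le)
      have h4 := hwκ i
      have h5 : 0 < √(w (2 ^ i)) := Real.sqrt_pos.2 (hw0 _)
      rw [← mul_div_assoc, div_le_one h5]
      calc κ ^ (2 * i) * C ≤ κ ^ (2 * i) * (c₀ * κ ^ i) := by gcongr
        _ = c₀ * κ ^ (3 * i) := by ring
        _ ≤ _ := h4
    have h6 : ∫ ω, X i k ω ∂P ≤ Real.exp 5 :=
      integral_label_exp_le hm hu hi hw hw0 (by positivity) hC hL h2 (Finset.mem_Ico.1 hk).1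
    have h7 := mul_meas_ge_le_integral_of_nonneg (μ := P) (f := X i k)
      (.of_forall fun ω => label_nonneg (hg _) _) (integrable_label hm (hg _) _ _ _)
      (Real.exp (κ ^ i))
    have h8 : P.real {ω | Real.exp (κ ^ i) ≤ X i k ω} ≤ Real.exp 5 * Real.exp (-κ ^ i) := by
      rw [Real.exp_neg, ← div_eq_mul_inv, le_div_iff₀' (Real.exp_pos _)]
      exact h7.trans h6
    calc P {ω | Real.exp (κ ^ i) < X i k ω} ≤ P {ω | Real.exp (κ ^ i) ≤ X i k ω} :=
          measure_mono fun ω hω => le_of_lt (Set.mem_ofPred_eq ▸ hω)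
      _ ≤ _ := by
        rw [← ofReal_measureReal]
        exact ENNReal.ofReal_le_ofReal h8
  have h9 : ∀ i, P (⋃ k ∈ Finset.Ico (2 ^ (i + i₀)) (2 ^ (i + i₀ + 1)),
      {ω | Real.exp (κ ^ (i + i₀)) < X (i + i₀) k ω}) ≤
      ENNReal.ofReal (Real.exp 5 * (2 ^ (i + i₀) * Real.exp (-κ ^ (i + i₀)))) := by
    intro i
    refine (measure_biUnion_finset_le _ _).trans ((Finset.sum_le_card_nsmul _ _ _
      (h1 (i + i₀) (by omega))).trans ?_)
    rw [Nat.card_Ico, nsmul_eq_mul, ← ENNReal.ofReal_natCast,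
      ← ENNReal.ofReal_mul (Nat.cast_nonneg _)]
    refine ENNReal.ofReal_le_ofReal (le_of_eq ?_)
    rw [show 2 ^ (i + i₀ + 1) - 2 ^ (i + i₀) = 2 ^ (i + i₀) by rw [pow_succ]; omega]
    push_cast
    ring
  have h10 := ((summable_nat_add_iff i₀).2 (summable_pow_mul_exp_neg_pow 2 hκ)).mul_left
    (Real.exp 5)
  have h11 := ae_eventually_notMem (ne_top_of_le_ne_top h10.tsum_ofReal_ne_top
    (ENNReal.tsum_le_tsum h9))
  filter_upwards [h11] with ω hω
  obtain ⟨N, hN⟩ := eventually_atTop.1 hω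
  filter_upwards [eventually_ge_atTop (N + i₀)] with i hii k hk
  have := hN (i - i₀) (by omega)
  rw [Nat.sub_add_cancel (by omega)] at this
  by_contra hcon
  exact this (Set.mem_iUnion₂.2 ⟨k, hk, not_le.1 hcon⟩)

end RandomLabel

/-! ### Martingale convergence of the labelled proportions -/

section RandomLabel

variable {Ω : Type*} [mΩ : MeasurableSpace Ω] {P : Measure Ω} [IsProbabilityMeasure P]
  {U : ℕ → Ω → ℝ} {n : ℕ} {c : ℝ} {w : ℕ → ℝ}

/-- An adapted process which is orthogonal to the past and bounded in `L¹` converges. -/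
theorem ae_tendsto_of_integral_mul_eq {ℱ : Filtration ℕ mΩ} {f : ℕ → Ω → ℝ} {R : ℝ}
    (hf : ∀ m, Measurable[ℱ m] (f m)) (hint : ∀ m, Integrable (f m) P)
    (hmul : ∀ m (H : Ω → ℝ), Measurable[ℱ m] H → (∀ ω, |H ω| ≤ 1) →
      ∫ ω, H ω * f (m + 1) ω ∂P = ∫ ω, H ω * f m ω ∂P)
    (hR : ∀ m, ∫ ω, |f m ω| ∂P ≤ R) :
    ∀ᵐ ω ∂P, ∃ l, Tendsto (fun m => f m ω) atTop (𝓝 l) := by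
  have hmart : Martingale f ℱ P := by
    refine martingale_of_setIntegral_eq_succ (fun m => (hf m).stronglyMeasurable) hint
      fun m s hs => ?_
    have h1 : ∀ j, ∫ ω in s, f j ω ∂P = ∫ ω, s.indicator (fun _ => (1 : ℝ)) ω * f j ω ∂P := by
      intro j
      rw [← integral_indicator (ℱ.le m s hs)]
      congr 1
      ext ω
      by_cases h : ω ∈ s <;> simp [h]
    rw [h1, h1]
    refine (hmul m _ (Measurable.indicator measurable_const hs) fun ω => ?_).symm
    by_cases h : ω ∈ s <;> simp [h]
  refine hmart.submartingale.exists_ae_tendsto_of_bdd (R := R.toNNReal) fun m => ?_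
  rw [eLpNorm_one_eq_lintegral_enorm, ← ofReal_integral_norm_eq_lintegral_enorm (hint m)]
  exact ENNReal.ofReal_le_ofReal (hR m)

/-- With factors `1` the labelled fraction is the conditional probability that the next branch is
labelled, so adding that branch's mass keeps the fraction a martingale, with values in `[0, 1]`. -/
theorem ae_tendsto_labelMass_div (hm : ∀ k, Measurable (U k))
    (hu : ∀ k, P.map (U k) = volume.restrict (Set.Icc 0 1)) (hi : iIndepFun U P)
    (hw : Monotone w) (hw0 : ∀ k, 0 < w k) (hc0 : 0 ≤ c) (hc : c ≤ w n) :
    ∀ᵐ ω ∂P, ∃ l, Tendsto (fun m => labelMass n c 1 w (fun i => U i ω) (n + m) / w (n + m))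
      atTop (𝓝 l) := by
  have hg : ∀ k, 0 ≤ (1 : ℕ → ℝ) k := fun _ => zero_le_one
  have hb : ∀ m ω, |labelMass n c 1 w (fun i => U i ω) (n + m) / w (n + m)| ≤ 1 := fun m ω => by
    rw [abs_of_nonneg (div_nonneg (labelMass_nonneg hw hg hc0 _) (hw0 _).le), div_le_one (hw0 _)]
    exact labelMass_one_le hw hc (by omega)
  have hf : ∀ m, Measurable[pastFiltration hm n m]
      fun ω => labelMass n c 1 w (fun i => U i ω) (n + m) / w (n + m) := fun m =>
    (measurable_labelMass_past n c 1 w (n + m)).div_const _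
  have hint : ∀ m, Integrable
      (fun ω => labelMass n c 1 w (fun i => U i ω) (n + m) / w (n + m)) P := fun m =>
    integrable_of_abs_le ((hf m).mono ((pastFiltration hm n).le m) le_rfl) (hb m)
  refine ae_tendsto_of_integral_mul_eq (ℱ := pastFiltration hm n) (R := 1) hf hint ?_ ?_
  · intro m H hH hH1
    have hHm : AEStronglyMeasurable H P :=
      (hH.mono ((pastFiltration hm n).le m) le_rfl).aestronglyMeasurable
    have hw1 := hw0 (n + m)
    have hw2 := hw0 (n + m + 1)
    have i1 : Integrable (fun ω => H ω * labelMass n c 1 w (fun i => U i ω) (n + m)) P :=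
      (integrable_labelMass hm hg hw hc0 n _).bdd_mul hHm (.of_forall hH1)
    have i2 : Integrable (fun ω => H ω * label n c 1 w (fun i => U i ω) (n + m + 1)) P :=
      (integrable_label hm hg n c _).bdd_mul hHm (.of_forall hH1)
    have e1 := integral_mul_label hm hu hi hw hw0 hc0 hc hg (show n ≤ n + m by omega) hH hH1
    have e2 : ∀ ω, H ω * (labelMass n c 1 w (fun i => U i ω) (n + (m + 1)) / w (n + (m + 1))) =
        (w (n + m + 1))⁻¹ * (H ω * labelMass n c 1 w (fun i => U i ω) (n + m)) +
        ((w (n + m + 1))⁻¹ * (w (n + m + 1) - w (n + m))) *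
          (H ω * label n c 1 w (fun i => U i ω) (n + m + 1)) := by
      intro ω
      rw [← add_assoc, labelMass_succ]
      ring
    simp only [e2]
    rw [integral_add (i1.const_mul _) (i2.const_mul _), integral_const_mul, integral_const_mul, e1]
    simp only [mul_div_assoc', integral_div, Pi.one_apply]
    field_simp
    ring
  · intro m
    calc _ ≤ ∫ _, (1 : ℝ) ∂P := integral_mono (hint m).abs (integrable_const _) (hb m)
      _ = 1 := by simp

/-- The summands are labels minus their conditional means, hence orthogonal martingale increments
bounded by `1 / (i + 1)`, with summable squares. The weights are those of Kronecker's lemma. -/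
theorem ae_tendsto_sum_label_sub (hm : ∀ k, Measurable (U k))
    (hu : ∀ k, P.map (U k) = volume.restrict (Set.Icc 0 1)) (hi : iIndepFun U P)
    (hw : Monotone w) (hw0 : ∀ k, 0 < w k) (hc0 : 0 ≤ c) (hc : c ≤ w n) :
    ∀ᵐ ω ∂P, ∃ l, Tendsto (fun m => ∑ i ∈ Finset.range m,
      (label n c 1 w (fun i => U i ω) (n + i + 1) -
        labelMass n c 1 w (fun i => U i ω) (n + i) / w (n + i)) / ((i : ℝ) + 1))
      atTop (𝓝 l) := by
  have hg : ∀ k, 0 ≤ (1 : ℕ → ℝ) k := fun _ => zero_le_one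
  set D : ℕ → Ω → ℝ := fun i ω => label n c 1 w (fun i => U i ω) (n + i + 1) -
    labelMass n c 1 w (fun i => U i ω) (n + i) / w (n + i) with hD
  set T : ℕ → Ω → ℝ := fun m ω => ∑ i ∈ Finset.range m, D i ω / ((i : ℝ) + 1) with hT
  have hDb : ∀ i ω, |D i ω| ≤ 1 := fun i ω => by
    have h1 : 0 ≤ labelMass n c 1 w (fun i => U i ω) (n + i) / w (n + i) :=
      div_nonneg (labelMass_nonneg hw hg hc0 _) (hw0 _).le
    have h2 : labelMass n c 1 w (fun i => U i ω) (n + i) / w (n + i) ≤ 1 := by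
      rw [div_le_one (hw0 _)]
      exact labelMass_one_le hw hc (by omega)
    rw [abs_le]
    rcases label_one_mem (u := fun i => U i ω) hw hc (n + i + 1) with h | h <;>
      simp only [hD, h] <;> constructor <;> linarith
  have hDm : ∀ i, Measurable[past U (n + (i + 1))] (D i) := fun i =>
    (measurable_label_past n c 1 w (n + i + 1)).sub
      (((measurable_labelMass_past n c 1 w (n + i)).mono (past_mono U (by omega)) le_rfl).div_const _)
  have hTm : ∀ m, Measurable[past U (n + m)] (T m) := fun m =>
    Finset.measurable_fun_sum _ fun i hi => ((hDm i).mono (past_mono U (by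
      have := Finset.mem_range.1 hi; omega)) le_rfl).div_const _
  have hTs : ∀ m ω, T (m + 1) ω = T m ω + D m ω / ((m : ℝ) + 1) := fun m ω =>
    Finset.sum_range_succ _ _
  have hTb : ∀ m ω, |T m ω| ≤ m := by
    intro m ω
    induction m with
    | zero => simp [hT]
    | succ m ih =>
      rw [hTs]
      push_cast
      refine (abs_add_le _ _).trans (add_le_add ih ?_)
      rw [abs_div, abs_of_pos (by positivity : (0 : ℝ) < m + 1), div_le_one (by positivity)]
      exact (hDb m ω).trans (by linarith [(Nat.cast_nonneg m : (0 : ℝ) ≤ m)])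
  have hmeas : ∀ {k} {f : Ω → ℝ}, Measurable[past U k] f → Measurable f := fun h =>
    h.mono (past_le hm _) le_rfl
  have hDint : ∀ i, Integrable (D i) P := fun i => integrable_of_abs_le (hmeas (hDm i)) (hDb i)
  have hTint : ∀ m, Integrable (T m) P := fun m => integrable_of_abs_le (hmeas (hTm m)) (hTb m)
  have hortho : ∀ m (H : Ω → ℝ), Measurable[past U (n + m)] H → ∀ B, (∀ ω, |H ω| ≤ B) →
      ∫ ω, H ω * D m ω ∂P = 0 := by
    intro m H hH B hB
    have hHm : AEStronglyMeasurable H P := (hmeas hH).aestronglyMeasurable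
    have hw1 := hw0 (n + m)
    have i1 : Integrable (fun ω => H ω * labelMass n c 1 w (fun i => U i ω) (n + m)) P :=
      (integrable_labelMass hm hg hw hc0 n _).bdd_mul hHm (.of_forall hB)
    have i2 : Integrable (fun ω => H ω * label n c 1 w (fun i => U i ω) (n + m + 1)) P :=
      (integrable_label hm hg n c _).bdd_mul hHm (.of_forall hB)
    have e1 := integral_mul_label hm hu hi hw hw0 hc0 hc hg (show n ≤ n + m by omega) hH hB
    simp only [hD, mul_sub, mul_div_assoc']
    rw [integral_sub i2 (i1.div_const _), e1, integral_div, Pi.one_apply]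
    ring
  have hsq : ∀ m, ∫ ω, T m ω ^ 2 ∂P ≤ ∑ i ∈ Finset.range m, 1 / ((i : ℝ) + 1) ^ 2 := by
    intro m
    induction m with
    | zero => simp [hT]
    | succ m ih =>
      have i1 : Integrable (fun ω => T m ω ^ 2) P :=
        integrable_of_abs_le ((hmeas (hTm m)).pow_const 2) (B := (m : ℝ) ^ 2) fun ω => by
          rw [abs_pow]; exact pow_le_pow_left₀ (abs_nonneg _) (hTb m ω) 2
      have i2 : Integrable (fun ω => T m ω * D m ω) P :=
        (hDint m).bdd_mul (hmeas (hTm m)).aestronglyMeasurable (.of_forall (hTb m))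
      have i3 : Integrable (fun ω => D m ω ^ 2) P :=
        integrable_of_abs_le ((hmeas (hDm m)).pow_const 2) (B := (1 : ℝ) ^ 2) fun ω => by
          rw [abs_pow]; exact pow_le_pow_left₀ (abs_nonneg _) (hDb m ω) 2
      have e1 : ∀ ω, T (m + 1) ω ^ 2 = T m ω ^ 2 + 2 / ((m : ℝ) + 1) * (T m ω * D m ω) +
          1 / ((m : ℝ) + 1) ^ 2 * D m ω ^ 2 := fun ω => by rw [hTs]; field_simp; ring
      have i4 : Integrable (fun ω => T m ω ^ 2 + 2 / ((m : ℝ) + 1) * (T m ω * D m ω)) P :=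
        i1.add (i2.const_mul _)
      simp only [e1]
      rw [integral_add i4 (i3.const_mul _),
        integral_add i1 (i2.const_mul _), integral_const_mul, integral_const_mul,
        hortho m (T m) (hTm m) m (hTb m), mul_zero, add_zero, Finset.sum_range_succ]
      refine add_le_add ih (mul_le_of_le_one_right (by positivity) ?_)
      calc _ ≤ ∫ _, (1 : ℝ) ∂P := integral_mono i3 (integrable_const _) fun ω =>
            (sq_le_one_iff_abs_le_one _).2 (hDb m ω)
        _ = 1 := by simp
  have hsum : Summable fun i : ℕ => 1 / ((i : ℝ) + 1) ^ 2 := by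
    have := (summable_nat_add_iff 1).2 (Real.summable_one_div_nat_pow.2 (show 1 < 2 by norm_num))
    simpa using this
  refine ae_tendsto_of_integral_mul_eq (ℱ := pastFiltration hm n) (f := T)
    (R := 1 + ∑' i : ℕ, 1 / ((i : ℝ) + 1) ^ 2) hTm hTint ?_ ?_
  · intro m H hH hH1
    have hHm : AEStronglyMeasurable H P := (hmeas hH).aestronglyMeasurable
    simp only [hTs, mul_add, mul_div_assoc']
    rw [integral_add ((hTint m).bdd_mul hHm (.of_forall hH1))
      (((hDint m).bdd_mul hHm (.of_forall hH1)).div_const _), integral_div,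
      hortho m H hH 1 hH1, zero_div, add_zero]
  · intro m
    have i1 : Integrable (fun ω => T m ω ^ 2) P :=
      integrable_of_abs_le ((hmeas (hTm m)).pow_const 2) (B := (m : ℝ) ^ 2) fun ω => by
        rw [abs_pow]; exact pow_le_pow_left₀ (abs_nonneg _) (hTb m ω) 2
    calc ∫ ω, |T m ω| ∂P ≤ ∫ ω, (1 + T m ω ^ 2) ∂P :=
          integral_mono (hTint m).abs ((integrable_const _).add i1) fun ω => by
            -- The `L¹` bound comes from the `L²` bound through `|T| ≤ 1 + T²`.
            have := sq_abs (T m ω)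
            show |T m ω| ≤ 1 + T m ω ^ 2
            nlinarith [sq_nonneg (|T m ω| - 1), abs_nonneg (T m ω)]
      _ = 1 + ∫ ω, T m ω ^ 2 ∂P := by
          rw [integral_add (integrable_const _) i1]; simp
      _ ≤ _ := by
          gcongr
          exact (hsq m).trans (hsum.sum_le_tsum _ fun i _ => by positivity)

/-- The proportion of branches with a given label converges. -/
theorem ae_tendsto_average_label (hm : ∀ k, Measurable (U k))
    (hu : ∀ k, P.map (U k) = volume.restrict (Set.Icc 0 1)) (hi : iIndepFun U P)
    (hw : Monotone w) (hw0 : ∀ k, 0 < w k) (hc0 : 0 ≤ c) (hc : c ≤ w n) :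
    ∀ᵐ ω ∂P, ∃ l, Tendsto (fun m : ℕ => (m : ℝ)⁻¹ * ∑ k ∈ Finset.range m,
      label n c 1 w (fun i => U i ω) k) atTop (𝓝 l) := by
  filter_upwards [ae_tendsto_labelMass_div hm hu hi hw hw0 hc0 hc,
    ae_tendsto_sum_label_sub hm hu hi hw hw0 hc0 hc] with ω ⟨l, hl⟩ ⟨l', hl'⟩
  -- A label is its centred part plus a convergent fraction; the remaining steps discard the first
  -- `n + 1` labels, which vanish.
  have h1 := (tendsto_average_zero_of_tendsto_sum_div hl').add hl.cesaro
  refine ⟨l, ?_⟩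
  rw [← tendsto_add_atTop_iff_nat (n + 1)]
  have h2 : Tendsto (fun m : ℕ => (m : ℝ) / ((m : ℝ) + (n + 1 : ℕ))) atTop (𝓝 1) :=
    tendsto_natCast_div_add_atTop _
  have h3 := h2.mul h1
  rw [zero_add, one_mul] at h3
  refine h3.congr' ?_
  filter_upwards [eventually_gt_atTop 0] with m hm0
  have hm1 : (m : ℝ) ≠ 0 := by positivity
  rw [← mul_add, ← Finset.sum_add_distrib, add_comm m (n + 1), Finset.sum_range_add,
    Finset.sum_eq_zero (s := Finset.range (n + 1)), zero_add]
  · simp only [sub_add_cancel, add_right_comm n _ 1]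
    push_cast
    field_simp
    ring
  · intro k hk
    exact label_of_le (by have := Finset.mem_range.1 hk; omega)

end RandomLabel

/-! ### Projection on the first branches -/

/-- The projection of `[0, y (n + m)]` on `[0, y n]` for the line-breaking metric. -/
def projUpTo (y z : ℕ → ℝ≥0) (n : ℕ) : ℕ → ℝ≥0 → ℝ≥0
  | 0, u => u
  | m + 1, u => if u ≤ y (n + m) then projUpTo y z n m u else projUpTo y z n m (z (n + m))

/-- The projection of the half-line on `[0, y n]` for the line-breaking metric. -/
def proj (y z : ℕ → ℝ≥0) (n : ℕ) (u : ℝ≥0) : ℝ≥0 :=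
  projUpTo y z n (sInf {m | u ≤ y (n + m)}) u

section Projection

variable {y z : ℕ → ℝ≥0}

theorem projUpTo_eq_of_le (h : IsLineBreaking y z) {n i m : ℕ} (him : i ≤ m) {u : ℝ≥0}
    (hu : u ≤ y (n + i)) : projUpTo y z n m u = projUpTo y z n i u := by
  induction m, him using Nat.le_induction with
  | base => rfl
  | succ m hm ih =>
    rw [projUpTo, if_pos (hu.trans (h.strictMono.monotone (by omega))), ih]

theorem proj_eq (h : IsLineBreaking y z) {n m : ℕ} {u : ℝ≥0} (hu : u ≤ y (n + m)) :
    proj y z n u = projUpTo y z n m u := by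
  have hs : sInf {m | u ≤ y (n + m)} ∈ {m | u ≤ y (n + m)} := Nat.sInf_mem ⟨m, hu⟩
  exact (projUpTo_eq_of_le h (Nat.sInf_le hu) hs).symm

theorem proj_of_le (h : IsLineBreaking y z) {n : ℕ} {u : ℝ≥0} (hu : u ≤ y n) :
    proj y z n u = u :=
  proj_eq h (m := 0) hu

theorem proj_of_mem (h : IsLineBreaking y z) {n k : ℕ} (hk : n ≤ k) {u : ℝ≥0} (h1 : y k < u)
    (h2 : u ≤ y (k + 1)) : proj y z n u = proj y z n (z k) := by
  obtain ⟨m, rfl⟩ := Nat.exists_eq_add_of_le hk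
  rw [proj_eq h (m := m + 1) h2, proj_eq h (m := m) (h.lt _).le, projUpTo, if_neg h1.not_ge]

theorem exists_mem_branch (h : IsLineBreaking y z) {n : ℕ} {u : ℝ≥0} (hu : y n < u) :
    ∃ k, n ≤ k ∧ y k < u ∧ u ≤ y (k + 1) := by
  classical
  have hex := exists_le h u
  have hs := Nat.find_spec hex
  have hn : n < Nat.find hex := by
    by_contra hc
    exact absurd (hu.trans_le hs) (not_lt.2 (h.strictMono.monotone (not_lt.1 hc)))
  refine ⟨Nat.find hex - 1, by omega, ?_, ?_⟩
  · exact not_le.1 (Nat.find_min hex (by omega))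
  · rwa [Nat.sub_add_cancel (by omega)]

/-- Induction along the attachment process: a property that holds on `[0, y n]` and passes from the
attachment point of a branch to all points of the branch holds everywhere. -/
theorem branch_induction (h : IsLineBreaking y z) (n : ℕ) {p : ℝ≥0 → Prop}
    (hn : ∀ u ≤ y n, p u)
    (hs : ∀ k, n ≤ k → p (z k) → ∀ u, y k < u → u ≤ y (k + 1) → p u) (u : ℝ≥0) : p u := by
  have key : ∀ k, n ≤ k → ∀ u ≤ y k, p u := by
    intro k hk
    induction k, hk using Nat.le_induction with
    | base => exact hn
    | succ k hk ih =>
      intro u hu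
      rcases le_or_gt u (y k) with h1 | h1
      · exact ih u h1
      · exact hs k hk (ih _ (h.lt k).le) u h1 hu
  obtain ⟨k, hk⟩ := exists_le h u
  exact key (max n k) (le_max_left _ _) u
    (hk.trans (h.strictMono.monotone (le_max_right _ _)))

theorem proj_le (h : IsLineBreaking y z) (n : ℕ) (u : ℝ≥0) : proj y z n u ≤ y n := by
  refine branch_induction h n (p := fun u => proj y z n u ≤ y n) (fun u hu => ?_)
    (fun k hk hz u h1 h2 => ?_) u
  · rwa [proj_of_le h hu]
  · rwa [proj_of_mem h hk h1 h2]

theorem proj_proj (h : IsLineBreaking y z) {n m : ℕ} (hnm : n ≤ m) (u : ℝ≥0) :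
    proj y z n (proj y z m u) = proj y z n u := by
  refine branch_induction h m (p := fun u => proj y z n (proj y z m u) = proj y z n u)
    (fun u hu => ?_) (fun k hk hz u h1 h2 => ?_) u
  · rw [proj_of_le h hu]
  · rwa [proj_of_mem h hk h1 h2, proj_of_mem h (hnm.trans hk) h1 h2]

theorem dist_point (h : IsLineBreaking y z) (u v : ℝ≥0) :
    dist (point h u) (point h v) = treeDist y z u v :=
  UniformSpace.Completion.dist_eq (α := Skeleton h) _ _

theorem treeDist_triangle (h : IsLineBreaking y z) (u v w : ℝ≥0) :
    treeDist y z u w ≤ treeDist y z u v + treeDist y z v w := by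
  simpa only [dist_point] using dist_triangle (point h u) (point h v) (point h w)

theorem treeDist_self (h : IsLineBreaking y z) (u : ℝ≥0) : treeDist y z u u = 0 := by
  rw [← dist_point h, dist_self]

theorem treeDist_of_mem (h : IsLineBreaking y z) {k : ℕ} {u v : ℝ≥0} (hu : y k < u)
    (hu' : u ≤ y (k + 1)) (hv : y k < v) (hv' : v ≤ y (k + 1)) :
    treeDist y z u v = |(u : ℝ) - v| := by
  rw [treeDist_eq h hu' hv', distUpTo, if_neg hu.not_ge, if_neg hv.not_ge]

theorem treeDist_of_le (h : IsLineBreaking y z) {u v : ℝ≥0} (hu : u ≤ y 0) (hv : v ≤ y 0) :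
    treeDist y z u v = |(u : ℝ) - v| := by
  rw [treeDist_eq h hu hv, distUpTo]

theorem treeDist_attach (h : IsLineBreaking y z) {k : ℕ} {u : ℝ≥0} (hu : y k < u)
    (hu' : u ≤ y (k + 1)) : treeDist y z u (z k) = (u : ℝ) - y k := by
  have hz := (h.lt k).le
  rw [treeDist_eq h hu' (hz.trans (h.strictMono.monotone (Nat.le_succ k))), distUpTo,
    if_neg hu.not_ge, if_pos hz, distUpTo_self, zero_add,
    abs_of_nonneg (sub_nonneg.2 (NNReal.coe_le_coe.2 hu.le))]

/-- The exponential of the distance to the first branches is controlled by labels. -/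
theorem exp_treeDist_proj_le (h : IsLineBreaking y z) {w u : ℕ → ℝ} (hw : Monotone w)
    (hz : ∀ k j, z k ≤ y j ↔ u k * w k < w j) (hu : ∀ k, u k * w k < w k) {l : ℝ} (hl : 0 ≤ l)
    {n k : ℕ} (hk : n ≤ k) {v : ℝ≥0} (h1 : y k < v) (h2 : v ≤ y (k + 1)) :
    Real.exp (l * treeDist y z v (proj y z n v)) ≤
      label n (w n) (fun j => Real.exp (l * ((y j : ℝ) - y (j - 1)))) w u (k + 1) := by
  induction k using Nat.strong_induction_on generalizing v with
  | _ k ih =>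
    have hd : treeDist y z v (z k) ≤ (y (k + 1) : ℝ) - y k := by
      rw [treeDist_attach h h1 h2]
      have := NNReal.coe_le_coe.2 h2
      linarith
    rw [proj_of_mem h hk h1 h2]
    rcases lt_or_ge (u k * w k) (w n) with h3 | h3
    · rw [label_succ_of_lt hw le_rfl hk h3, proj_of_le h ((hz k n).2 h3)]
      gcongr
      simpa using hd
    -- The attachment point lies in an earlier branch, to which the induction applies; the path from
    -- `v` runs through this point, and lengths add while labels multiply.
    · obtain ⟨j, a, b, h4, h5⟩ := exists_branch h3 (hu k) hk
      rw [label_succ_of_mem hw le_rfl a b h4 h5]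
      obtain ⟨j, rfl⟩ : ∃ i, j = i + 1 := ⟨j - 1, by omega⟩
      have h6 : y j < z k := by
        by_contra hc
        exact absurd ((hz k j).1 (not_lt.1 hc)) (not_lt.2 h4)
      have h7 := ih j (by omega) (by omega) h6 ((hz k _).2 h5)
      have h8 := treeDist_triangle h v (z k) (proj y z n (z k))
      calc _ ≤ Real.exp (l * ((y (k + 1) : ℝ) - y k) +
            l * treeDist y z (z k) (proj y z n (z k))) := by
            rw [← mul_add]
            gcongr
            linarith
        _ = Real.exp (l * ((y (k + 1) : ℝ) - y k)) *
            Real.exp (l * treeDist y z (z k) (proj y z n (z k))) := Real.exp_add _ _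
        _ ≤ _ := mul_le_mul le_rfl h7 (Real.exp_pos _).le (Real.exp_pos _).le

/-- Labels tell which branches are projected on an initial segment. -/
theorem label_eq_ite_proj (h : IsLineBreaking y z) {w u : ℕ → ℝ} (hw : Monotone w)
    (hz : ∀ k j, z k ≤ y j ↔ u k * w k < w j) (hu : ∀ k, u k * w k < w k) {n : ℕ} {c : ℝ}
    (hc : c ≤ w n) {s : ℝ≥0} (hs : ∀ k, z k ≤ s ↔ u k * w k < c)
    {k : ℕ} (hk : n ≤ k) {v : ℝ≥0} (h1 : y k < v) (h2 : v ≤ y (k + 1)) :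
    label n c 1 w u (k + 1) = if proj y z n v ≤ s then 1 else 0 := by
  induction k using Nat.strong_induction_on generalizing v with
  | _ k ih =>
    rw [proj_of_mem h hk h1 h2]
    rcases lt_or_ge (u k * w k) (w n) with h3 | h3
    · rw [proj_of_le h ((hz k n).2 h3)]
      rcases lt_or_ge (u k * w k) c with h4 | h4
      · rw [label_succ_of_lt hw hc hk h4, if_pos ((hs k).2 h4)]; rfl
      · rw [label_succ_of_le_of_lt hw hk h4 h3, if_neg fun h => h4.not_gt ((hs k).1 h)]
    · obtain ⟨j, a, b, h4, h5⟩ := exists_branch h3 (hu k) hk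
      rw [label_succ_of_mem hw hc a b h4 h5, Pi.one_apply, one_mul]
      obtain ⟨j, rfl⟩ : ∃ i, j = i + 1 := ⟨j - 1, by omega⟩
      have h6 : y j < z k := by
        by_contra hc
        exact absurd ((hz k j).1 (not_lt.1 hc)) (not_lt.2 h4)
      exact ih j (by omega) (by omega) h6 ((hz k _).2 h5)

/-- If the distances between successive dyadic stages are summable, the projections on the first
branches are uniformly close to the identity. -/
theorem exists_forall_treeDist_proj_le (h : IsLineBreaking y z) {r : ℕ → ℝ} (hr : Summable r)
    (hr0 : ∀ i, 0 ≤ r i)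
    (hd : ∀ᶠ i : ℕ in atTop, ∀ k ∈ Finset.Ico (2 ^ i) (2 ^ (i + 1)), ∀ v, y k < v → v ≤ y (k + 1) →
      treeDist y z v (proj y z (2 ^ i) v) ≤ r i) {ε : ℝ} (hε : 0 < ε) :
    ∃ n, ∀ v, treeDist y z v (proj y z n v) ≤ ε := by
  obtain ⟨i₀, hi₀⟩ := eventually_atTop.1
    (hd.and ((tendsto_sum_nat_add r).eventually (gt_mem_nhds hε)))
  have htail := (hi₀ i₀ le_rfl).2
  -- Descend one dyadic stage at a time: projecting first on a later stage does not change the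
  -- projection on the stage `2 ^ i₀`.
  have key : ∀ m v, v ≤ y (2 ^ (i₀ + m)) →
      treeDist y z v (proj y z (2 ^ i₀) v) ≤ ∑ i ∈ Finset.range m, r (i + i₀) := by
    intro m
    induction m with
    | zero =>
      intro v hv
      rw [proj_of_le h (show v ≤ y (2 ^ i₀) from hv), treeDist_self h]
      simp
    | succ m ih =>
      intro v hv
      rw [Finset.sum_range_succ]
      rcases le_or_gt v (y (2 ^ (i₀ + m))) with h1 | h1
      · linarith [ih v h1, hr0 (m + i₀)]
      · obtain ⟨k, a, b, c⟩ := exists_mem_branch h h1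
        have h2 : k < 2 ^ (i₀ + m + 1) := by
          by_contra hc
          exact absurd (b.trans_le hv) (not_lt.2 (h.strictMono.monotone (not_lt.1 hc)))
        have h3 := (hi₀ (i₀ + m) (by omega)).1 k (Finset.mem_Ico.2 ⟨a, h2⟩) v b c
        have h4 := ih _ (proj_le h (2 ^ (i₀ + m)) v)
        rw [proj_proj h (Nat.pow_le_pow_right two_pos (by omega))] at h4
        have h5 := treeDist_triangle h v (proj y z (2 ^ (i₀ + m)) v) (proj y z (2 ^ i₀) v)
        rw [add_comm i₀ m] at h3 h4 h5
        linarith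
  refine ⟨2 ^ i₀, fun v => ?_⟩
  obtain ⟨k, hk⟩ := exists_le h v
  have h1 := key k v (hk.trans (h.strictMono.monotone
    (k.lt_two_pow_self.le.trans (Nat.pow_le_pow_right two_pos (by omega)))))
  exact h1.trans ((((summable_nat_add_iff i₀).2 hr).sum_le_tsum _ fun i _ => hr0 _).trans htail.le)

/-- On such a set `point h` is isometric for the usual distance, so nets of a bounded interval
transfer. Each single branch qualifies. -/
theorem totallyBounded_image_point (h : IsLineBreaking y z) {s : Set ℝ≥0} {b : ℝ≥0}
    (hb : s ⊆ Set.Iic b) (hs : ∀ u ∈ s, ∀ v ∈ s, treeDist y z u v = |(u : ℝ) - v|) :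
    TotallyBounded (point h '' s) := by
  have h1 : TotallyBounded s := (isCompact_Icc (a := (0 : ℝ≥0)) (b := b)).totallyBounded.subset
    fun u hu => Set.mem_Icc.2 ⟨zero_le, hb hu⟩
  refine Metric.totallyBounded_iff.2 fun ε hε => ?_
  obtain ⟨t, ht, htf, hc⟩ := Metric.finite_approx_of_totallyBounded h1 ε hε
  refine ⟨point h '' t, htf.image _, ?_⟩
  rintro _ ⟨u, hu, rfl⟩
  obtain ⟨v, hv, huv⟩ := Set.mem_iUnion₂.1 (hc hu)
  refine Set.mem_iUnion₂.2 ⟨_, ⟨v, hv, rfl⟩, ?_⟩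
  rw [Metric.mem_ball, dist_point, hs u hu v (ht hv)]
  exact huv

theorem totallyBounded_subtree (h : IsLineBreaking y z) (k : ℕ) :
    TotallyBounded (subtree h k) := by
  induction k with
  | zero =>
    exact totallyBounded_image_point h le_rfl fun u hu v hv => treeDist_of_le h hu hv
  | succ k ih =>
    have h1 : TotallyBounded (point h '' Set.Ioc (y k) (y (k + 1))) :=
      totallyBounded_image_point h (fun u hu => hu.2) fun u hu v hv =>
        treeDist_of_mem h hu.1 hu.2 hv.1 hv.2
    have : subtree h (k + 1) = subtree h k ∪ point h '' Set.Ioc (y k) (y (k + 1)) := by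
      rw [subtree, subtree, ← Set.image_union,
        Set.Iic_union_Ioc_eq_Iic (h.strictMono.monotone (Nat.le_succ k))]
    rw [this]
    exact ih.union h1

theorem exists_dist_point_lt (h : IsLineBreaking y z) (t : Tree h) {ε : ℝ} (hε : 0 < ε) :
    ∃ v, dist t (point h v) < ε := by
  obtain ⟨_, hv, v, rfl⟩ := Metric.dense_iff.1
    (UniformSpace.Completion.denseRange_coe (α := Skeleton h)) t ε hε
  exact ⟨v, by rw [dist_comm]; exact hv⟩

theorem exists_dist_subtree_lt (h : IsLineBreaking y z) {n : ℕ} {ε : ℝ} (hε : 0 < ε)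
    (hn : ∀ v, treeDist y z v (proj y z n v) ≤ ε) (t : Tree h) :
    ∃ v ≤ y n, dist t (point h v) < 2 * ε := by
  obtain ⟨v, hv⟩ := exists_dist_point_lt h t hε
  refine ⟨proj y z n v, proj_le h n v, ?_⟩
  have h1 := dist_triangle t (point h v) (point h (proj y z n v))
  have h2 := hn v
  rw [← dist_point h] at h2
  linarith

/-- The completion is complete, and it lies in a small neighbourhood of a totally bounded subtree.
-/
theorem compactSpace_tree (h : IsLineBreaking y z)
    (hn : ∀ ε > 0, ∃ n, ∀ v, treeDist y z v (proj y z n v) ≤ ε) : CompactSpace (Tree h) := by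
  refine ⟨isCompact_iff_totallyBounded_isComplete.2 ⟨?_, isComplete_univ⟩⟩
  refine Metric.totallyBounded_iff.2 fun ε hε => ?_
  obtain ⟨n, hn⟩ := hn (ε / 4) (by positivity)
  obtain ⟨t, ht, hc⟩ := Metric.totallyBounded_iff.1 (totallyBounded_subtree h n) (ε / 2)
    (by positivity)
  refine ⟨t, ht, fun x _ => ?_⟩
  obtain ⟨v, hv, hxv⟩ := exists_dist_subtree_lt h (show 0 < ε / 4 by positivity) hn x
  obtain ⟨a, ha, hav⟩ := Set.mem_iUnion₂.1 (hc ⟨v, hv, rfl⟩)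
  refine Set.mem_iUnion₂.2 ⟨a, ha, ?_⟩
  rw [Metric.mem_ball] at hav ⊢
  linarith [dist_triangle x (point h v) a]

end Projection

/-! ### Convergence of averages -/

/-- The arithmetic means of a sequence converge. -/
def HasMean (a : ℕ → ℝ) : Prop :=
  ∃ l, Tendsto (fun m : ℕ => (m : ℝ)⁻¹ * ∑ k ∈ Finset.range m, a k) atTop (𝓝 l)

theorem HasMean.add {a b : ℕ → ℝ} (ha : HasMean a) (hb : HasMean b) :
    HasMean fun k => a k + b k := by
  obtain ⟨l, hl⟩ := ha
  obtain ⟨l', hl'⟩ := hb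
  exact ⟨l + l', by simpa only [Finset.sum_add_distrib, mul_add] using hl.add hl'⟩

theorem HasMean.const_mul {a : ℕ → ℝ} (ha : HasMean a) (x : ℝ) : HasMean fun k => x * a k := by
  obtain ⟨l, hl⟩ := ha
  refine ⟨x * l, ?_⟩
  simpa only [← Finset.mul_sum, mul_left_comm] using hl.const_mul x

theorem HasMean.sub {a b : ℕ → ℝ} (ha : HasMean a) (hb : HasMean b) :
    HasMean fun k => a k - b k := by
  simpa only [neg_one_mul, ← sub_eq_add_neg] using ha.add (hb.const_mul (-1))

/-- Arithmetic means are contractive for the eventual uniform distance, so the means of `a` form a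
Cauchy sequence. -/
theorem hasMean_of_approx {a : ℕ → ℝ}
    (h : ∀ ε > 0, ∃ b, HasMean b ∧ ∀ᶠ k in atTop, |a k - b k| ≤ ε) : HasMean a := by
  refine cauchySeq_tendsto_of_complete (Metric.cauchySeq_iff'.2 fun ε hε => ?_)
  obtain ⟨b, ⟨l, hl⟩, hab⟩ := h (ε / 5) (by positivity)
  -- The excess over `ε / 5` is nonzero only finitely often, so its averages vanish.
  have h1 : Tendsto (fun k => max (|a k - b k| - ε / 5) 0) atTop (𝓝 0) :=
    tendsto_const_nhds.congr' (hab.mono fun k hk => (max_eq_right (by linarith)).symm)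
  have h2 : ∀ᶠ m : ℕ in atTop, |(m : ℝ)⁻¹ * ∑ k ∈ Finset.range m, a k - l| < ε / 2 := by
    filter_upwards [h1.cesaro.eventually (gt_mem_nhds (show 0 < ε / 10 by positivity)),
      hl.eventually (Metric.ball_mem_nhds _ (show 0 < ε / 10 by positivity)),
      eventually_gt_atTop 0] with m h3 h4 hm
    have hm' : (0 : ℝ) < m := by positivity
    have h5 : |(m : ℝ)⁻¹ * ∑ k ∈ Finset.range m, a k - (m : ℝ)⁻¹ * ∑ k ∈ Finset.range m, b k| ≤
        ε / 5 + (m : ℝ)⁻¹ * ∑ k ∈ Finset.range m, max (|a k - b k| - ε / 5) 0 := by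
      rw [← mul_sub, ← Finset.sum_sub_distrib, abs_mul, abs_of_pos (inv_pos.2 hm')]
      have h6 : |∑ k ∈ Finset.range m, (a k - b k)| ≤
          m * (ε / 5) + ∑ k ∈ Finset.range m, max (|a k - b k| - ε / 5) 0 := by
        calc _ ≤ ∑ k ∈ Finset.range m, |a k - b k| := Finset.abs_sum_le_sum_abs _ _
          _ ≤ ∑ k ∈ Finset.range m, (ε / 5 + max (|a k - b k| - ε / 5) 0) :=
            Finset.sum_le_sum fun k _ => by linarith [le_max_left (|a k - b k| - ε / 5) 0]
          _ = _ := by simp [Finset.sum_add_distrib]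
      calc _ ≤ (m : ℝ)⁻¹ * (m * (ε / 5) + ∑ k ∈ Finset.range m, max (|a k - b k| - ε / 5) 0) := by
            gcongr
        _ = _ := by field_simp
    rw [Real.dist_eq] at h4
    have h7 := abs_sub_le ((m : ℝ)⁻¹ * ∑ k ∈ Finset.range m, a k)
      ((m : ℝ)⁻¹ * ∑ k ∈ Finset.range m, b k) l
    linarith
  obtain ⟨N, hN⟩ := eventually_atTop.1 h2
  refine ⟨N, fun m hm => ?_⟩
  have h8 := hN m hm
  have h9 := hN N le_rfl
  rw [Real.dist_eq]
  have h10 := abs_sub_le ((m : ℝ)⁻¹ * ∑ k ∈ Finset.range m, a k) l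
    ((N : ℝ)⁻¹ * ∑ k ∈ Finset.range N, a k)
  rw [abs_sub_comm l] at h10
  linarith

/-- If the proportions of a sequence of points in initial segments converge, so do the averages of
suitable step functions. -/
theorem exists_step_hasMean {p : ℕ → ℝ≥0} {q : ℕ → Prop} [DecidablePred q] (F : ℝ≥0 → ℝ)
    (S : Finset ℝ≥0)
    (hS : ∀ s ∈ S, HasMean fun k => if q k ∧ p k ≤ s then 1 else 0) :
    ∃ f : ℝ≥0 → ℝ, HasMean (fun k => if q k then f (p k) else 0) ∧
      (∀ v, (∀ s ∈ S, s < v) → f v = 0) ∧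
      ∀ v, (∃ s ∈ S, v ≤ s) → ∃ s ∈ S, v ≤ s ∧ (∀ t ∈ S, v ≤ t → s ≤ t) ∧ f v = F s := by
  classical
  -- Adding a new maximum `a` adds one step, on the interval from the old maximum to `a`; its
  -- indicator is a difference of two initial segments.
  induction S using Finset.induction_on_max with
  | empty => exact ⟨0, ⟨0, by simp⟩, fun _ _ => rfl, fun v ⟨s, hs, _⟩ => absurd hs (by simp)⟩
  | insert a S ha ih =>
    obtain ⟨f, hf, hf0, hf1⟩ := ih fun s hs => hS s (Finset.mem_insert_of_mem hs)
    have hmean : HasMean fun k => if q k then (if ∀ s ∈ S, s < p k then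
        if p k ≤ a then (1 : ℝ) else 0 else 0) else 0 := by
      have h1 := hS a (Finset.mem_insert_self _ _)
      rcases S.eq_empty_or_nonempty with rfl | hne
      · convert h1 using 2 with k
        by_cases hq : q k <;> simp [hq]
      · convert h1.sub (hS (S.max' hne) (Finset.mem_insert_of_mem (S.max'_mem hne))) using 2 with k
        have h2 : (∀ s ∈ S, s < p k) ↔ ¬ p k ≤ S.max' hne := by
          rw [not_le, Finset.max'_lt_iff]
        have h3 := ha _ (S.max'_mem hne)
        rw [if_congr h2 rfl rfl]
        by_cases hq : q k <;> by_cases h4 : p k ≤ S.max' hne <;> simp [hq, h4]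
        rw [if_pos (h4.trans h3.le), sub_self]
    refine ⟨fun v => f v + F a * (if ∀ s ∈ S, s < v then if v ≤ a then 1 else 0 else 0), ?_, ?_, ?_⟩
    · convert hf.add (hmean.const_mul (F a)) using 2 with k
      by_cases hq : q k <;> simp [hq]
    · intro v hv
      have h1 := hv a (Finset.mem_insert_self _ _)
      simp [h1.not_ge, hf0 v fun s hs => hv s (Finset.mem_insert_of_mem hs)]
    · rintro v ⟨s, hs, hvs⟩
      by_cases hv : ∀ s ∈ S, s < v
      · have hva : v ≤ a := by
          rcases Finset.mem_insert.1 hs with rfl | hs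
          · exact hvs
          · exact absurd hvs (hv s hs).not_ge
        refine ⟨a, Finset.mem_insert_self _ _, hva, fun t ht hvt => ?_, ?_⟩
        · rcases Finset.mem_insert.1 ht with rfl | ht
          · exact le_rfl
          · exact absurd hvt (hv t ht).not_ge
        · simp only [hf0 v hv, if_pos hv, if_pos hva]; ring
      · have hv' := hv
        push Not at hv'
        obtain ⟨s', hs', h1, h2, h3⟩ := hf1 v hv'
        refine ⟨s', Finset.mem_insert_of_mem hs', h1, fun t ht hvt => ?_, ?_⟩
        · rcases Finset.mem_insert.1 ht with rfl | ht
          · exact (ha _ hs').le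
          · exact h2 t ht hvt
        · simp only [if_neg hv, mul_zero, add_zero, h3]

/-! ### Weak limit of the empirical measures and Gromov–Hausdorff–Prokhorov convergence -/

section Limit

variable {y z : ℕ → ℝ≥0}

/-- The points used to subdivide the branches: cut points and rational points. -/
def gridPoints (y : ℕ → ℝ≥0) : Set ℝ≥0 :=
  Set.range y ∪ Set.range fun q : ℕ × ℕ => (q.1 : ℝ≥0) / q.2

/-- The grid contains the cut points up to `y n`, so the least grid point above `v` is in the same
branch as `v`, where the tree distance is the usual one. Multiples of `1 / M'` make the mesh fine.
-/
theorem exists_finset_grid (h : IsLineBreaking y z) (n : ℕ) {ε : ℝ} (hε : 0 < ε) :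
    ∃ S : Finset ℝ≥0, (∀ s ∈ S, s ∈ gridPoints y ∧ s ≤ y n) ∧ y n ∈ S ∧
      ∀ v, ∀ s ∈ S, v ≤ s → (∀ t ∈ S, v ≤ t → s ≤ t) → treeDist y z v s ≤ ε := by
  classical
  obtain ⟨M, hM⟩ := exists_nat_one_div_lt hε
  set M' : ℕ := M + 1 with hM'
  have hM0 : (0 : ℝ≥0) < M' := by rw [hM']; positivity
  set S : Finset ℝ≥0 := (Finset.range (n + 1)).image y ∪
    ((Finset.range (⌈y n * M'⌉₊ + 1)).image fun i : ℕ => (i : ℝ≥0) / M').filter (· ≤ y n) with hS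
  have hS1 : ∀ s ∈ S, s ∈ gridPoints y ∧ s ≤ y n := by
    intro s hs
    rcases Finset.mem_union.1 hs with hs | hs
    · obtain ⟨j, hj, rfl⟩ := Finset.mem_image.1 hs
      exact ⟨.inl ⟨j, rfl⟩, h.strictMono.monotone (by have := Finset.mem_range.1 hj; omega)⟩
    · obtain ⟨hs, hs'⟩ := Finset.mem_filter.1 hs
      obtain ⟨i, -, rfl⟩ := Finset.mem_image.1 hs
      exact ⟨.inr ⟨(i, M'), rfl⟩, hs'⟩
  refine ⟨S, hS1, ?_, ?_⟩
  · exact Finset.mem_union_left _ (Finset.mem_image_of_mem _ (by simp))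
  · intro v s hs hvs hmin
    have hsn := (hS1 s hs).2
    have hcut : ∀ j ≤ n, v ≤ y j → s ≤ y j := fun j hj hv =>
      hmin _ (Finset.mem_union_left _ (Finset.mem_image_of_mem _
        (Finset.mem_range.2 (by omega)))) hv
    have hsv : (s : ℝ) - v ≤ ε := by
      have h1 : v * M' ≤ ⌈v * M'⌉₊ := Nat.le_ceil _
      have h2 : (⌈v * M'⌉₊ : ℝ≥0) < v * M' + 1 := Nat.ceil_lt_add_one zero_le
      have h3 : s ≤ (⌈v * M'⌉₊ : ℝ≥0) / M' := by
        -- The next multiple of `1 / M'` may pass `y n` and be filtered out; then `s ≤ y n` is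
        -- already enough.
        rcases le_or_gt ((⌈v * M'⌉₊ : ℝ≥0) / M') (y n) with h4 | h4
        · refine hmin _ (Finset.mem_union_right _ (Finset.mem_filter.2
            ⟨Finset.mem_image.2 ⟨_, Finset.mem_range.2 ?_, rfl⟩, h4⟩)) ?_
          · refine Nat.lt_succ_of_le (Nat.ceil_mono ?_)
            gcongr
            exact hvs.trans hsn
          · rwa [le_div_iff₀ hM0]
        · exact hsn.trans h4.le
      have h5 : s ≤ v + 1 / M' := h3.trans <| by
        rw [div_le_iff₀ hM0, add_mul, one_div, inv_mul_cancel₀ hM0.ne']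
        exact h2.le
      have h6 : (s : ℝ) ≤ v + 1 / M' := by exact_mod_cast h5
      have h7 : (1 : ℝ) / M' < ε := by rw [hM']; exact_mod_cast hM
      linarith
    have habs : |(v : ℝ) - s| ≤ ε := by
      rw [abs_sub_comm, abs_of_nonneg (sub_nonneg.2 (NNReal.coe_le_coe.2 hvs))]
      exact hsv
    rcases le_or_gt v (y 0) with h0 | h0
    · rwa [treeDist_of_le h h0 (hcut 0 (Nat.zero_le _) h0)]
    · obtain ⟨j, -, h1, h2⟩ := exists_mem_branch h h0
      have hj : j + 1 ≤ n := by
        by_contra hc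
        exact absurd (h1.trans_le (hvs.trans hsn)) (not_lt.2 (h.strictMono.monotone (by omega)))
      rwa [treeDist_of_mem h h1 h2 (h1.trans_le hvs) (hcut _ hj h2)]

/-- By uniform continuity, moving `y k` to its projection and then to the next grid point changes
`f` by at most `ε`. What remains is a step function of the projection. -/
theorem hasMean_continuous (h : IsLineBreaking y z) [CompactSpace (Tree h)]
    (hn : ∀ ε > 0, ∃ n, ∀ v, treeDist y z v (proj y z n v) ≤ ε)
    (hmean : ∀ n, ∀ s ∈ gridPoints y, s ≤ y n →
      HasMean fun k => if n < k ∧ proj y z n (y k) ≤ s then 1 else 0)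
    {f : Tree h → ℝ} (hf : Continuous f) : HasMean fun k => f (point h (y k)) := by
  refine hasMean_of_approx fun ε hε => ?_
  obtain ⟨δ, hδ, hfδ⟩ := Metric.uniformContinuous_iff.1
    (CompactSpace.uniformContinuous_of_continuous hf) ε hε
  obtain ⟨n, hn⟩ := hn (δ / 3) (by positivity)
  obtain ⟨S, hS1, hS2, hS3⟩ := exists_finset_grid h n (show 0 < δ / 3 by positivity)
  obtain ⟨φ, hφ, -, hφ1⟩ := exists_step_hasMean (p := fun k => proj y z n (y k))
    (q := fun k => n < k) (fun s => f (point h s)) S fun s hs => hmean n s (hS1 s hs).1 (hS1 s hs).2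
  refine ⟨_, hφ, ?_⟩
  filter_upwards [eventually_gt_atTop n] with k hk
  rw [if_pos hk]
  obtain ⟨s, hs, h1, h2, h3⟩ := hφ1 _ ⟨y n, hS2, proj_le h n (y k)⟩
  rw [h3, ← Real.dist_eq]
  refine (hfδ ?_).le
  rw [dist_point]
  linarith [treeDist_triangle h (y k) (proj y z n (y k)) s, hn (y k), hS3 _ s hs h1 h2]

theorem integral_empirical (h : IsLineBreaking y z) (f : Tree h → ℝ) (k : ℕ) :
    ∫ t, f t ∂(empirical h k : Measure (Tree h)) =
      ((k + 1 : ℕ) : ℝ)⁻¹ * ∑ i ∈ Finset.range (k + 1), f (point h (y i)) := by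
  have h1 : (empirical h k : Measure (Tree h)) =
      ((k : ℝ≥0∞) + 1)⁻¹ • ∑ i : Fin (k + 1), Measure.dirac (point h (y i)) := rfl
  have h2 : ∀ i : Fin (k + 1), Integrable f (Measure.dirac (point h (y i))) := fun i =>
    integrable_dirac (by simp)
  rw [h1, integral_smul_measure, integral_finsetSum_measure fun i _ => h2 i,
    Finset.sum_range fun i => f (point h (y i))]
  simp only [integral_dirac, smul_eq_mul]
  congr 1
  rw [ENNReal.toReal_inv, ENNReal.toReal_add (by simp) (by simp)]
  simp

/-- Compactness of the probability measures gives a limit along an ultrafilter. Since all integrals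
of continuous functions converge along `atTop`, that limit is the full limit. -/
theorem exists_tendsto_empirical (h : IsLineBreaking y z) [CompactSpace (Tree h)]
    (hmean : ∀ f : Tree h → ℝ, Continuous f → HasMean fun k => f (point h (y k))) :
    ∃ μ : ProbabilityMeasure (Tree h), Tendsto (empirical h) atTop (𝓝 μ) := by
  set 𝒰 : Ultrafilter ℕ := Ultrafilter.of atTop
  have h𝒰 : (𝒰 : Filter ℕ) ≤ atTop := Ultrafilter.of_le _
  obtain ⟨μ, -, hμ⟩ := isCompact_univ.ultrafilter_le_nhds (𝒰.map (empirical h)) (by simp)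
  have hμ' : Tendsto (empirical h) 𝒰 (𝓝 μ) := hμ
  refine ⟨μ, ProbabilityMeasure.tendsto_iff_forall_integral_tendsto.2 fun f => ?_⟩
  obtain ⟨l, hl⟩ := hmean f f.continuous
  have h1 : Tendsto (fun k => ∫ t, f t ∂(empirical h k : Measure (Tree h))) atTop (𝓝 l) := by
    simp only [integral_empirical h f]
    exact hl.comp (tendsto_add_atTop_nat 1)
  have h2 := ProbabilityMeasure.tendsto_iff_forall_integral_tendsto.1 hμ' f
  rwa [tendsto_nhds_unique (h1.mono_left h𝒰) h2] at h1

theorem map_empiricalSubtree (h : IsLineBreaking y z) (k : ℕ) :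
    (empiricalSubtree h k).map Subtype.val = (empirical h k : Measure (Tree h)) := by
  have h1 : (empirical h k : Measure (Tree h)) =
      ((k : ℝ≥0∞) + 1)⁻¹ • ∑ i : Fin (k + 1), Measure.dirac (point h (y i)) := rfl
  rw [h1, empiricalSubtree, Measure.map_smul, Measure.map_finset_sum measurable_subtype_coe.aemeasurable]
  refine congrArg _ (Finset.sum_congr rfl fun i _ => ?_)
  exact Measure.map_dirac' measurable_subtype_coe _

/-- The tree itself serves as common space, with the inclusion and the identity; there the
Lévy–Prokhorov distance metrizes weak convergence. -/
theorem tendsto_ghpEDist (h : IsLineBreaking y z) [CompactSpace (Tree h)]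
    (hn : ∀ ε > 0, ∃ n, ∀ v, treeDist y z v (proj y z n v) ≤ ε)
    {μ : ProbabilityMeasure (Tree h)} (hμ : Tendsto (empirical h) atTop (𝓝 μ)) :
    Tendsto (fun k => ghpEDist (subtree h k) (Tree h) (empiricalSubtree h k)
      (μ : Measure (Tree h))) atTop (𝓝 0) := by
  have h1 : Tendsto (fun k => Metric.hausdorffEDist (Set.range (Subtype.val : subtree h k → Tree h))
      (Set.range (id : Tree h → Tree h))) atTop (𝓝 0) := by
    refine ENNReal.tendsto_nhds_zero.2 fun ε hε => ?_
    obtain ⟨δ, hδ0, hδ⟩ := ENNReal.lt_iff_exists_real_btwn.1 hε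
    have hδ1 : 0 < δ := ENNReal.ofReal_pos.1 hδ.1
    obtain ⟨n, hn⟩ := hn (δ / 2) (by positivity)
    filter_upwards [eventually_ge_atTop n] with k hk
    refine (Metric.hausdorffEDist_le_of_mem_edist (r := ENNReal.ofReal δ) ?_ ?_).trans hδ.2.le
    · exact fun x _ => ⟨x, ⟨x, rfl⟩, by simp⟩
    · intro x _
      obtain ⟨v, hv, hxv⟩ := exists_dist_subtree_lt h (show 0 < δ / 2 by positivity) hn x
      refine ⟨point h v, ⟨⟨point h v, v, hv.trans (h.strictMono.monotone hk), rfl⟩, rfl⟩, ?_⟩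
      rw [edist_dist]
      exact ENNReal.ofReal_le_ofReal (by linarith)
  have h2 : Tendsto (fun k => levyProkhorovEDist (empirical h k : Measure (Tree h))
      (μ : Measure (Tree h))) atTop (𝓝 0) := by
    have h3 := (LevyProkhorov.probabilityMeasureHomeomorph (Ω := Tree h)).continuous.continuousAt
      (x := μ) |>.tendsto.comp hμ
    have h4 := tendsto_iff_edist_tendsto_0.1 h3
    exact h4
  have h3 := h1.max h2
  rw [max_self] at h3
  refine tendsto_of_tendsto_of_tendsto_of_le_of_le tendsto_const_nhds h3 (fun _ => zero_le)
    fun k => ?_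
  refine iInf_le_of_le (Tree h) (iInf_le_of_le inferInstance (iInf_le_of_le inferInstance
    (iInf_le_of_le inferInstance (iInf_le_of_le Subtype.val (iInf_le_of_le id
    (iInf_le_of_le isometry_subtype_coe (iInf_le_of_le isometry_id ?_)))))))
  rw [map_empiricalSubtree, Measure.map_id]

end Limit

/-! ### Path integrals -/

theorem intervalIntegrable_path {x : ℝ≥0 → ℝ} (hx : Monotone x) (a b : ℝ) :
    IntervalIntegrable (fun r : ℝ => x r.toNNReal) volume a b :=
  Monotone.intervalIntegrable fun _ _ h => hx (Real.toNNReal_mono h)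

theorem pathIntegral_le {x : ℝ≥0 → ℝ} (hx : Monotone x) {s t : ℝ≥0} (hst : s ≤ t) :
    pathIntegral x s t ≤ ((t : ℝ) - s) * x t := by
  have h := intervalIntegral.integral_mono_on (μ := volume) (NNReal.coe_le_coe.2 hst)
    (intervalIntegrable_path hx s t) (intervalIntegrable_const (c := x t))
    fun r hr => hx (Real.toNNReal_le_iff_le_coe.2 hr.2)
  simpa [pathIntegral] using h

theorem le_pathIntegral {x : ℝ≥0 → ℝ} (hx : Monotone x) {s t : ℝ≥0} (hst : s ≤ t) :
    ((t : ℝ) - s) * x s ≤ pathIntegral x s t := by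
  have h := intervalIntegral.integral_mono_on (μ := volume) (NNReal.coe_le_coe.2 hst)
    (intervalIntegrable_const (c := x s)) (intervalIntegrable_path hx s t)
    fun r hr => hx (NNReal.le_toNNReal_of_coe_le hr.1)
  simpa [pathIntegral] using h

theorem tendsto_dyadic_ceil (t : ℝ≥0) :
    Tendsto (fun n : ℕ => ((⌊t * 2 ^ n⌋₊ + 1 : ℕ) : ℝ≥0) / 2 ^ n) atTop (𝓝[≥] t) := by
  have h0 : ∀ n : ℕ, (0 : ℝ≥0) < 2 ^ n := fun n => by positivity
  have h1 : ∀ n : ℕ, t ≤ ((⌊t * 2 ^ n⌋₊ + 1 : ℕ) : ℝ≥0) / 2 ^ n := fun n => by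
    rw [le_div_iff₀ (h0 n)]
    push_cast
    exact (Nat.lt_floor_add_one _).le
  have h2 : ∀ n : ℕ, ((⌊t * 2 ^ n⌋₊ + 1 : ℕ) : ℝ≥0) / 2 ^ n ≤ t + (1 / 2) ^ n := fun n => by
    rw [div_le_iff₀ (h0 n), add_mul, ← mul_pow]
    push_cast
    have : ((1 : ℝ≥0) / 2 * 2) ^ n = 1 := by simp
    rw [this]
    gcongr
    exact Nat.floor_le zero_le
  refine tendsto_nhdsWithin_iff.2 ⟨?_, .of_forall h1⟩
  refine tendsto_of_tendsto_of_tendsto_of_le_of_le tendsto_const_nhds ?_ h1 h2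
  have := (NNReal.tendsto_pow_atTop_nhds_zero_of_lt_one (r := 1 / 2) (by norm_num)).const_add t
  simpa using this

/-- By right-continuity the process is the limit of its values at the next dyadic time, which takes
countably many values. This allows evaluation at random times. -/
theorem measurable_uncurry_of_rightCts {Ω : Type*} [MeasurableSpace Ω] {τ : ℝ≥0 → Ω → ℝ}
    (hm : ∀ t, Measurable (τ t))
    (hr : ∀ ω t, ContinuousWithinAt (fun s => τ s ω) (Set.Ici t) t) :
    Measurable fun q : ℝ≥0 × Ω => τ q.1 q.2 := by
  refine measurable_of_tendsto_metrizable (f := fun (n : ℕ) (q : ℝ≥0 × Ω) =>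
    τ (((⌊q.1 * 2 ^ n⌋₊ + 1 : ℕ) : ℝ≥0) / 2 ^ n) q.2) (fun n => ?_) (tendsto_pi_nhds.2 fun q =>
      (hr q.2 q.1).tendsto.comp (tendsto_dyadic_ceil q.1))
  have h1 : Measurable fun q : ℕ × Ω => τ (((q.1 + 1 : ℕ) : ℝ≥0) / 2 ^ n) q.2 :=
    measurable_from_prod_countable_right fun k => hm (((k + 1 : ℕ) : ℝ≥0) / 2 ^ n)
  exact h1.comp (((measurable_fst.mul_const _).nat_floor).prodMk measurable_snd)

theorem measurable_pathIntegral {Ω : Type*} [MeasurableSpace Ω] {τ : ℝ≥0 → Ω → ℝ}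
    (hm : ∀ t, Measurable (τ t))
    (hr : ∀ ω t, ContinuousWithinAt (fun s => τ s ω) (Set.Ici t) t) (s t : ℝ≥0) :
    Measurable fun ω => pathIntegral (fun r => τ r ω) s t := by
  have h1 : StronglyMeasurable fun q : Ω × ℝ => τ q.2.toNNReal q.1 :=
    ((measurable_uncurry_of_rightCts hm hr).comp
      ((measurable_real_toNNReal.comp measurable_snd).prodMk measurable_fst)).stronglyMeasurable
  simp only [pathIntegral, intervalIntegral]
  exact (h1.integral_prod_right'.measurable).sub (h1.integral_prod_right'.measurable)

/-! ### Growth of the intensity process -/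

/-- The factor carrying `x` has modulus one. Integrability is not needed, as the norm of an integral
is always at most the integral of the norm. -/
theorem exists_abs_stableDensity_le (α : ℝ) : ∃ K, 0 ≤ K ∧ ∀ x, |stableDensity α x| ≤ K := by
  refine ⟨(2 * Real.pi)⁻¹ * ∫ u : ℝ, ‖Complex.exp ((-(Complex.I * u)) ^ (α : ℂ))‖, by positivity,
    fun x => ?_⟩
  rw [stableDensity, abs_mul, abs_of_nonneg (by positivity : 0 ≤ (2 * Real.pi)⁻¹)]
  gcongr
  refine (Complex.abs_re_le_norm _).trans ((norm_integral_le_integral_norm _).trans_eq ?_)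
  congr 1
  ext u
  rw [norm_mul, Complex.norm_exp]
  simp

section Tilted

variable {α : ℝ} {Ω' Ω : Type*} [MeasurableSpace Ω'] [MeasurableSpace Ω] {σ : ℝ≥0 → Ω' → ℝ}
  {P' : Measure Ω'} {τ : ℝ≥0 → Ω → ℝ} {P : Measure Ω}

/-- Chernoff's bound from the Laplace transform. -/
theorem measure_subordinator_le [IsProbabilityMeasure P'] (hσ : IsStableSubordinator α σ P')
    (t : ℝ≥0) (x : ℝ) {q : ℝ} (hq : 0 ≤ q) :
    P' {ω | σ t ω ≤ x} ≤ ENNReal.ofReal (Real.exp (q * x - t * α * q ^ (α - 1))) := by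
  have h0 : ∀ ω, 0 ≤ σ t ω := fun ω => by
    have := hσ.mono ω (zero_le (a := t))
    simp only [hσ.zero] at this
    exact this
  have h1 : Measurable fun ω => Real.exp (-(q * σ t ω)) :=
    (((hσ.measurable t).const_mul q).neg).exp
  have h2 : Integrable (fun ω => Real.exp (-(q * σ t ω))) P' :=
    integrable_of_abs_le h1 (B := 1) fun ω => by
      rw [Real.abs_exp, Real.exp_le_one_iff]
      have := mul_nonneg hq (h0 ω)
      linarith
  have h3 := mul_meas_ge_le_integral_of_nonneg (.of_forall fun ω => (Real.exp_pos _).le) h2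
    (Real.exp (-(q * x)))
  rw [hσ.laplace t q hq] at h3
  rw [← ofReal_measureReal]
  refine ENNReal.ofReal_le_ofReal ?_
  rw [sub_eq_add_neg, Real.exp_add]
  have h4 : P'.real {ω | σ t ω ≤ x} ≤
      P'.real {ω | Real.exp (-(q * x)) ≤ Real.exp (-(q * σ t ω))} := by
    refine measureReal_mono fun ω hω => ?_
    have h5 : σ t ω ≤ x := hω
    show Real.exp (-(q * x)) ≤ Real.exp (-(q * σ t ω))
    gcongr
  have h6 : Real.exp (q * x) * Real.exp (-(q * x)) = 1 := by rw [← Real.exp_add]; simp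
  calc _ = Real.exp (q * x) * (Real.exp (-(q * x)) * P'.real {ω | σ t ω ≤ x}) := by
        rw [← mul_assoc, h6, one_mul]
    _ ≤ Real.exp (q * x) * (Real.exp (-(q * x)) *
        P'.real {ω | Real.exp (-(q * x)) ≤ Real.exp (-(q * σ t ω))}) := by gcongr
    _ ≤ _ := by gcongr

/-- On `{σ t ≤ x}` the path integral is at most `t * x` by monotonicity, so the tilt costs at most a
constant times `exp (t * x)`. -/
theorem exists_measure_tilted_le [IsProbabilityMeasure P'] (hσ : IsStableSubordinator α σ P')
    (hτ : IsTilted α σ P' τ P) :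
    ∃ K : ℝ, 0 ≤ K ∧ ∀ (t : ℝ≥0) (x q : ℝ), 0 ≤ q →
      P {ω | τ t ω ≤ x} ≤ ENNReal.ofReal (K * Real.exp (t * x + q * x - t * α * q ^ (α - 1))) := by
  obtain ⟨K, hK, hp⟩ := exists_abs_stableDensity_le α
  refine ⟨K / |stableDensity α 0|, by positivity, fun t x q hq => ?_⟩
  have hmem : t ∈ Set.Iic t := le_refl t
  have hs : MeasurableSet {f : Set.Iic t → ℝ | f ⟨t, hmem⟩ ≤ x} :=
    measurableSet_le (measurable_pi_apply _) measurable_const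
  have h1 := congrArg (fun μ => μ {f : Set.Iic t → ℝ | f ⟨t, hmem⟩ ≤ x}) (hτ.law t)
  rw [Measure.map_apply (measurable_pi_lambda (fun ω (s : Set.Iic t) => τ s ω) fun s => hτ.measurable s) hs,
    Measure.map_apply (measurable_pi_lambda (fun ω (s : Set.Iic t) => σ s ω) fun s => hσ.measurable s) hs] at h1
  have hs' : MeasurableSet {ω | σ t ω ≤ x} := measurableSet_le (hσ.measurable t) measurable_const
  have h2 : P {ω | τ t ω ≤ x} =
      ∫⁻ ω in {ω | σ t ω ≤ x}, ENNReal.ofReal (tilt α (fun s => σ s ω) t) ∂P' :=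
    h1.trans (withDensity_apply _ hs')
  rw [h2]
  calc _ ≤ ∫⁻ _ in {ω | σ t ω ≤ x},
        ENNReal.ofReal (K / |stableDensity α 0| * Real.exp (t * x)) ∂P' := by
        refine setLIntegral_mono' hs' fun ω hω => ENNReal.ofReal_le_ofReal ?_
        have h3 := pathIntegral_le (hσ.mono ω) (zero_le (a := t))
        have h4 : (t : ℝ) * σ t ω ≤ t * x := mul_le_mul_of_nonneg_left hω t.coe_nonneg
        simp only [NNReal.coe_zero, sub_zero] at h3
        refine (le_abs_self _).trans ?_
        rw [tilt, abs_div, abs_mul, Real.abs_exp, div_mul_eq_mul_div, mul_comm K]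
        gcongr
        · exact h3.trans h4
        · exact hp _
    _ = ENNReal.ofReal (K / |stableDensity α 0| * Real.exp (t * x)) * P' {ω | σ t ω ≤ x} := by
        rw [setLIntegral_const]
    _ ≤ ENNReal.ofReal (K / |stableDensity α 0| * Real.exp (t * x)) *
        ENNReal.ofReal (Real.exp (q * x - t * α * q ^ (α - 1))) := by
        gcongr
        exact measure_subordinator_le hσ t x hq
    _ = _ := by
        rw [← ENNReal.ofReal_mul (by positivity), mul_assoc, ← Real.exp_add]
        congr 3
        ring

/-- At level `x = 0` the previous bound tends to `0` as `q → ∞`; monotonicity reduces to countably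
many times. -/
theorem ae_tilted_pos [IsProbabilityMeasure P'] (hα : α ∈ Set.Ioo (1 : ℝ) 2)
    (hσ : IsStableSubordinator α σ P') (hτ : IsTilted α σ P' τ P) :
    ∀ᵐ ω ∂P, ∀ t, 0 < t → 0 < τ t ω := by
  obtain ⟨K, hK, hb⟩ := exists_measure_tilted_le hσ hτ
  have h1 : ∀ t : ℝ≥0, 0 < t → P {ω | τ t ω ≤ 0} = 0 := by
    intro t ht
    have h2 : Tendsto (fun q : ℝ => ENNReal.ofReal
        (K * Real.exp (t * 0 + q * 0 - t * α * q ^ (α - 1)))) atTop (𝓝 0) := by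
      have h3 : Tendsto (fun q : ℝ => K * Real.exp (-(t * α * q ^ (α - 1)))) atTop
          (𝓝 (K * 0)) :=
        (Real.tendsto_exp_neg_atTop_nhds_zero.comp ((tendsto_rpow_atTop
          (sub_pos.2 hα.1)).const_mul_atTop (mul_pos (NNReal.coe_pos.2 ht)
            (by linarith [hα.1])))).const_mul K
      rw [mul_zero] at h3
      have h4 := (ENNReal.continuous_ofReal.tendsto _).comp h3
      rw [ENNReal.ofReal_zero] at h4
      refine h4.congr fun q => ?_
      simp
    refine le_antisymm (ge_of_tendsto h2 ?_) zero_le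
    filter_upwards [eventually_ge_atTop 0] with q hq
    exact hb t 0 q hq
  have h5 : ∀ᵐ ω ∂P, ∀ n : ℕ, 0 < τ (1 / ((n : ℝ≥0) + 1)) ω := by
    refine ae_all_iff.2 fun n => ?_
    rw [ae_iff]
    simp only [not_lt]
    exact h1 _ (by positivity)
  filter_upwards [h5] with ω hω t ht
  obtain ⟨n, hn⟩ := exists_nat_one_div_lt (NNReal.coe_pos.2 ht)
  exact (hω n).trans_le (hτ.mono ω (by exact_mod_cast hn.le))

theorem exists_ae_eventually_le_tilted_pow [IsProbabilityMeasure P'] (hα : α ∈ Set.Ioo (1 : ℝ) 2)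
    (hσ : IsStableSubordinator α σ P') (hτ : IsTilted α σ P' τ P) :
    ∃ p : ℕ, ∀ᵐ ω ∂P, ∀ᶠ t : ℝ≥0 in atTop, (t : ℝ) ≤ τ t ω ^ p := by
  obtain ⟨K, hK, hb⟩ := exists_measure_tilted_le hσ hτ
  have hα0 : 0 < α - 1 := sub_pos.2 hα.1
  -- Then `(m ^ (α - 1)) ^ p ≥ m ^ 2`, where the spare power of `m` absorbs the constant `4 ^ p`.
  obtain ⟨p, hp⟩ := exists_nat_gt (2 / (α - 1))
  refine ⟨p, ?_⟩
  have h1 : ∀ m : ℕ, P {ω | τ m ω ≤ (m : ℝ) ^ (α - 1) / 4} ≤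
      ENNReal.ofReal (K * Real.exp (-(1 / 2) * m)) := by
    intro m
    -- With `q = t = m` the exponent is `(1 / 2 - α) * m ^ α`.
    refine (hb m _ m (Nat.cast_nonneg m)).trans (ENNReal.ofReal_le_ofReal ?_)
    rw [NNReal.coe_natCast]
    gcongr
    rcases Nat.eq_zero_or_pos m with rfl | hm
    · simp [hα0.ne']
    have hm' : (1 : ℝ) ≤ m := by exact_mod_cast hm
    have h2 : 1 ≤ (m : ℝ) ^ (α - 1) := Real.one_le_rpow hm' hα0.le
    have h3 := hα.1
    calc _ = -((α - 1 / 2) * (m * (m : ℝ) ^ (α - 1))) := by ring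
      _ ≤ -(1 / 2 * (m * 1)) := by
        have : (1 : ℝ) / 2 * (m * 1) ≤ (α - 1 / 2) * (m * (m : ℝ) ^ (α - 1)) := by
          have h6 : (1 : ℝ) / 2 ≤ α - 1 / 2 := by linarith
          gcongr
        linarith
      _ = _ := by ring
  have h2 : Summable fun m : ℕ => K * Real.exp (-(1 / 2) * m) := by
    refine Summable.mul_left K ?_
    have := Real.summable_exp_nat_mul_iff.2 (show -(1 / 2 : ℝ) < 0 by norm_num)
    simpa only [mul_comm] using this
  have h3 := ae_eventually_notMem (ne_top_of_le_ne_top h2.tsum_ofReal_ne_top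
    (ENNReal.tsum_le_tsum h1))
  filter_upwards [h3] with ω hω
  obtain ⟨N, hN⟩ := eventually_atTop.1 hω
  filter_upwards [eventually_ge_atTop ((max N (2 * 4 ^ p) : ℕ) : ℝ≥0)] with t ht
  set m := ⌊t⌋₊ with hm
  have hm1 : max N (2 * 4 ^ p) ≤ m := Nat.le_floor ht
  have hm2 : (t : ℝ) ≤ m + 1 := by exact_mod_cast (Nat.lt_floor_add_one t).le
  have hm3 : (m : ℝ) ^ (α - 1) / 4 ≤ τ t ω := by
    have h4 : ¬ (τ m ω ≤ (m : ℝ) ^ (α - 1) / 4) := hN m ((le_max_left _ _).trans hm1)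
    exact (not_le.1 h4).le.trans (hτ.mono ω (Nat.floor_le zero_le))
  have hm4 : (2 * 4 ^ p : ℝ) ≤ m := by exact_mod_cast (le_max_right _ _).trans hm1
  have h5 : (1 : ℝ) ≤ 4 ^ p := one_le_pow₀ (by norm_num)
  have hm5 : (1 : ℝ) ≤ m := by linarith
  calc (t : ℝ) ≤ m + 1 := hm2
    _ ≤ (m : ℝ) ^ 2 / 4 ^ p := by
      rw [le_div_iff₀ (by positivity)]
      nlinarith
    _ ≤ ((m : ℝ) ^ (α - 1)) ^ p / 4 ^ p := by
      gcongr
      rw [← Real.rpow_natCast, ← Real.rpow_natCast, ← Real.rpow_mul (by positivity)]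
      refine Real.rpow_le_rpow_of_exponent_le hm5 ?_
      rw [div_lt_iff₀ hα0] at hp
      push_cast
      linarith
    _ = ((m : ℝ) ^ (α - 1) / 4) ^ p := (div_pow _ _ _).symm
    _ ≤ _ := by gcongr

end Tilted

/-! ### Cox processes -/

/-- Markov's inequality for the Poisson distribution. -/
theorem one_le_sum_poisson_add {x : ℝ} (hx : 0 ≤ x) {K : ℕ} (hK : 0 < K) :
    1 ≤ (∑ n ∈ Finset.range K, Real.exp (-x) * x ^ n / n.factorial) + x / K := by
  have hK' : (0 : ℝ) < K := by exact_mod_cast hK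
  have h1 : HasSum (fun n : ℕ => x ^ n / n.factorial) (Real.exp x) := by
    rw [Real.exp_eq_exp_ℝ]
    exact NormedSpace.expSeries_div_hasSum_exp x
  have h2 : HasSum (fun n : ℕ => (n : ℝ) * (x ^ n / n.factorial)) (x * Real.exp x) := by
    rw [← hasSum_nat_add_iff' 1]
    have h3 : ∀ n : ℕ, ((n : ℝ) + 1) * (x ^ (n + 1) / (n + 1).factorial) =
        x * (x ^ n / n.factorial) := fun n => by
      rw [Nat.factorial_succ]
      push_cast
      field_simp
      ring
    simpa [h3] using h1.mul_left x
  -- In the tail each term is at most `n / K` times itself, and the weighted series sums to `x * exp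
  -- x / K`.
  have h3 : Real.exp x ≤ (∑ n ∈ Finset.range K, x ^ n / n.factorial) +
      x * Real.exp x / K := by
    have h4 := (hasSum_nat_add_iff' K).2 h1
    have h5 := ((hasSum_nat_add_iff' K).2 h2).mul_left ((K : ℝ)⁻¹)
    have h6 := hasSum_le (fun n => ?_) h4 h5
    · have h7 : 0 ≤ ∑ n ∈ Finset.range K, (n : ℝ) * (x ^ n / n.factorial) :=
        Finset.sum_nonneg fun n _ => by positivity
      have h8 : (K : ℝ)⁻¹ * (x * Real.exp x - ∑ n ∈ Finset.range K, (n : ℝ) * (x ^ n / n.factorial))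
          ≤ x * Real.exp x / K := by
        rw [div_eq_inv_mul]
        gcongr
        linarith
      linarith
    · rw [← mul_assoc]
      refine le_mul_of_one_le_left (by positivity) ?_
      rw [inv_mul_eq_div, one_le_div hK']
      push_cast
      linarith [(Nat.cast_nonneg n : (0 : ℝ) ≤ n)]
  have h9 : Real.exp (-x) * Real.exp x = 1 := by rw [← Real.exp_add]; simp
  calc (1 : ℝ) = Real.exp (-x) * Real.exp x := h9.symm
    _ ≤ Real.exp (-x) * ((∑ n ∈ Finset.range K, x ^ n / n.factorial) + x * Real.exp x / K) := by
      gcongr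
    _ = (∑ n ∈ Finset.range K, Real.exp (-x) * x ^ n / n.factorial) +
        Real.exp (-x) * Real.exp x * (x / K) := by
      rw [mul_add, Finset.mul_sum]
      congr 1
      · exact Finset.sum_congr rfl fun n _ => by ring
      · ring
    _ = _ := by rw [h9, one_mul]

theorem measurableSet_encard_eq {Ω : Type*} [MeasurableSpace Ω] {Y : ℕ → Ω → ℝ≥0}
    (hY : ∀ k, Measurable (Y k)) {I : Set ℝ≥0} (hI : MeasurableSet I) (n : ℕ) :
    MeasurableSet {ω | Set.encard {k | Y k ω ∈ I} = n} := by
  have h1 : {ω | Set.encard {k | Y k ω ∈ I} = n} =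
      ⋃ S : Finset ℕ, ⋃ _ : S.card = n, ⋂ k, {ω | Y k ω ∈ I ↔ k ∈ S} := by
    ext ω
    simp only [Set.mem_ofPred_eq, Set.mem_iUnion, Set.mem_iInter]
    constructor
    · intro h
      have hfin : {k | Y k ω ∈ I}.Finite := Set.finite_of_encard_eq_coe h
      refine ⟨hfin.toFinset, ?_, fun k => by simp⟩
      rw [hfin.encard_eq_coe_toFinset_card] at h
      exact_mod_cast h
    · rintro ⟨S, hS, h⟩
      have : {k | Y k ω ∈ I} = (S : Set ℕ) := Set.ext h
      rw [this, Set.encard_coe_eq_coe_finsetCard, hS]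
  rw [h1]
  refine MeasurableSet.iUnion fun S => MeasurableSet.iUnion fun _ => MeasurableSet.iInter fun k => ?_
  by_cases hk : k ∈ S
  · simp only [hk, iff_true]
    exact hY k hI
  · simp only [hk, iff_false]
    exact (hY k hI).compl

section Cox

variable {Ω : Type*} [MeasurableSpace Ω] {P : Measure Ω}
  {τ : ℝ≥0 → Ω → ℝ} {Y : ℕ → Ω → ℝ≥0}

theorem IsCoxPoints.measure_count_eq (hY : IsCoxPoints P τ Y) {s t : ℝ≥0} (hst : s ≤ t)
    {A : Set (ℝ≥0 → ℝ)} (hA : MeasurableSet A) (n : ℕ) :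
    P {ω | (fun r => τ r ω) ∈ A ∧ Set.encard {k | Y k ω ∈ Set.Ioc s t} = n} =
      ∫⁻ ω in {ω | (fun r => τ r ω) ∈ A}, ENNReal.ofReal
        (Real.exp (-pathIntegral (fun r => τ r ω) s t) *
          pathIntegral (fun r => τ r ω) s t ^ n / n.factorial) ∂P := by
  -- A single interval: the subdivision is `s, t, t, ...` with `m = 1`.
  have h := hY.counts (fun i => if i = 0 then s else t) (monotone_nat_of_le_succ fun i => by
    rcases Nat.eq_zero_or_pos i with rfl | hi
    · simpa
    · simp [hi.ne']) 1 (fun _ => n) A hA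
  simpa using h

theorem IsCoxPoints.measure_count_eq_zero_le [IsProbabilityMeasure P] (hY : IsCoxPoints P τ Y)
    (hmono : ∀ ω, Monotone fun r => τ r ω) {s t : ℝ≥0} (hst : s ≤ t) {b c : ℝ}
    (hc : c ≤ (t - s) * b) (hτ : Measurable (τ s)) :
    P {ω | b ≤ τ s ω ∧ Set.encard {k | Y k ω ∈ Set.Ioc s t} = 0} ≤
      ENNReal.ofReal (Real.exp (-c)) := by
  have hA : MeasurableSet {x : ℝ≥0 → ℝ | b ≤ x s} :=
    measurableSet_le measurable_const (measurable_pi_apply s)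
  have h := hY.measure_count_eq hst hA 0
  have hA' : MeasurableSet {ω | b ≤ τ s ω} := measurableSet_le measurable_const hτ
  calc _ = _ := h
    _ ≤ ∫⁻ ω in {ω | b ≤ τ s ω}, ENNReal.ofReal (Real.exp (-c)) ∂P := by
      refine setLIntegral_mono' hA' fun ω hω => ENNReal.ofReal_le_ofReal ?_
      have h1 := le_pathIntegral (hmono ω) hst
      have h2 : ((t : ℝ) - s) * b ≤ (t - s) * τ s ω :=
        mul_le_mul_of_nonneg_left hω (sub_nonneg.2 (NNReal.coe_le_coe.2 hst))
      simp only [pow_zero, mul_one, Nat.factorial_zero, Nat.cast_one, div_one]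
      gcongr
      linarith
    _ ≤ _ := by
      rw [setLIntegral_const]
      exact mul_le_of_le_one_right zero_le prob_le_one

/-- Markov's inequality for the conditional Poisson count, whose mean is at most `(t - s) * b` on
`A`. Since `A` is an arbitrary path event, the bound can be summed over disjoint events. -/
theorem IsCoxPoints.measure_count_ge_le [IsProbabilityMeasure P] (hY : IsCoxPoints P τ Y)
    (hm : ∀ t, Measurable (τ t)) (hmono : ∀ ω, Monotone fun r => τ r ω)
    (hr : ∀ ω t, ContinuousWithinAt (fun s => τ s ω) (Set.Ici t) t)
    (h0 : ∀ ω t, 0 ≤ τ t ω) {s t : ℝ≥0} (hst : s ≤ t) {A : Set (ℝ≥0 → ℝ)} (hA : MeasurableSet A)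
    {b : ℝ} (hb : ∀ ω, (fun r => τ r ω) ∈ A → τ t ω ≤ b) {K : ℕ} (hK : 0 < K) :
    P {ω | (fun r => τ r ω) ∈ A ∧ K ≤ Set.encard {k | Y k ω ∈ Set.Ioc s t}} ≤
      ENNReal.ofReal ((t - s) * b / K) * P {ω | (fun r => τ r ω) ∈ A} := by
  set A' : Set Ω := {ω | (fun r => τ r ω) ∈ A} with hA'def
  have hA' : MeasurableSet A' := (measurable_pi_lambda (fun ω r => τ r ω) hm) hA
  set Λ : Ω → ℝ := fun ω => pathIntegral (fun r => τ r ω) s t with hΛ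
  have hΛm : Measurable Λ := measurable_pathIntegral hm hr s t
  have hΛ0 : ∀ ω, 0 ≤ Λ ω := fun ω => le_trans
    (mul_nonneg (sub_nonneg.2 (NNReal.coe_le_coe.2 hst)) (h0 ω s)) (le_pathIntegral (hmono ω) hst)
  set f : ℕ → Ω → ℝ≥0∞ := fun n ω =>
    ENNReal.ofReal (Real.exp (-Λ ω) * Λ ω ^ n / n.factorial) with hf
  have hfm : ∀ n, Measurable (f n) := fun n =>
    (((hΛm.neg.exp).mul (hΛm.pow_const n)).div_const _).ennreal_ofReal
  set E : ℕ → Set Ω := fun n => {ω | Set.encard {k | Y k ω ∈ Set.Ioc s t} = n} with hE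
  have hEm : ∀ n, MeasurableSet (E n) := fun n =>
    measurableSet_encard_eq hY.measurable measurableSet_Ioc n
  have hcount : ∀ n, P (A' ∩ E n) = ∫⁻ ω in A', f n ω ∂P := fun n =>
    hY.measure_count_eq hst hA n
  set S : Set Ω := ⋃ n ∈ Finset.range K, A' ∩ E n with hS
  have hSm : MeasurableSet S := Finset.measurableSet_biUnion _ fun n _ => hA'.inter (hEm n)
  have hSP : P S = ∑ n ∈ Finset.range K, ∫⁻ ω in A', f n ω ∂P := by
    rw [hS, measure_biUnion_finset]
    · exact Finset.sum_congr rfl fun n _ => hcount n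
    · intro i _ j _ hij
      refine Set.disjoint_left.2 fun ω hi hj => hij ?_
      have h1 : Set.encard {k | Y k ω ∈ Set.Ioc s t} = i := hi.2
      have h2 : Set.encard {k | Y k ω ∈ Set.Ioc s t} = j := hj.2
      rw [h1] at h2
      exact_mod_cast h2
    · exact fun n _ => hA'.inter (hEm n)
  have hsub : {ω | (fun r => τ r ω) ∈ A ∧ K ≤ Set.encard {k | Y k ω ∈ Set.Ioc s t}} ⊆ A' \ S := by
    rintro ω ⟨h1, h2⟩
    refine ⟨h1, fun h3 => ?_⟩
    obtain ⟨n, hn, -, h4⟩ := Set.mem_iUnion₂.1 h3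
    have h5 : Set.encard {k | Y k ω ∈ Set.Ioc s t} = n := h4
    rw [h5] at h2
    have h6 : K ≤ n := by exact_mod_cast h2
    have := Finset.mem_range.1 hn
    omega
  have hSA : S ⊆ A' := Set.iUnion₂_subset fun n _ => Set.inter_subset_left
  refine (measure_mono hsub).trans ?_
  rw [measure_sdiff hSA hSm.nullMeasurableSet (measure_ne_top _ _), tsub_le_iff_left, hSP,
    ← lintegral_finsetSum _ fun n _ => hfm n]
  calc P A' = ∫⁻ ω in A', 1 ∂P := by simp
    _ ≤ ∫⁻ ω in A', ((∑ n ∈ Finset.range K, f n ω) + ENNReal.ofReal ((t - s) * b / K)) ∂P := by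
      refine setLIntegral_mono' hA' fun ω hω => ?_
      rw [← ENNReal.ofReal_sum_of_nonneg fun n _ => by have := hΛ0 ω; positivity,
        ← ENNReal.ofReal_add (Finset.sum_nonneg fun n _ => by have := hΛ0 ω; positivity)
          (div_nonneg (mul_nonneg (sub_nonneg.2 (NNReal.coe_le_coe.2 hst))
            ((h0 ω t).trans (hb ω hω))) (Nat.cast_nonneg K)), ← ENNReal.ofReal_one]
      refine ENNReal.ofReal_le_ofReal ((one_le_sum_poisson_add (hΛ0 ω) hK).trans ?_)
      gcongr
      exact (pathIntegral_le (hmono ω) hst).trans (mul_le_mul_of_nonneg_left (hb ω hω)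
        (sub_nonneg.2 (NNReal.coe_le_coe.2 hst)))
    _ = _ := by
      rw [lintegral_add_right _ measurable_const, setLIntegral_const]

end Cox

/-- Increasing right-continuous processes with nonnegative values. -/
structure IsIncreasingProcess {Ω : Type*} [MeasurableSpace Ω] (τ : ℝ≥0 → Ω → ℝ) : Prop where
  measurable : ∀ t, Measurable (τ t)
  mono : ∀ ω, Monotone fun t => τ t ω
  rightCts : ∀ ω t, ContinuousWithinAt (fun s => τ s ω) (Set.Ici t) t
  nonneg : ∀ ω t, 0 ≤ τ t ω

/-! ### Local finiteness of the cut points and absence of jumps there -/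

section Cox

variable {Ω : Type*} [MeasurableSpace Ω] {P : Measure Ω} [IsProbabilityMeasure P]
  {τ : ℝ≥0 → Ω → ℝ} {Y : ℕ → Ω → ℝ≥0}

theorem IsCoxPoints.ae_finite (hY : IsCoxPoints P τ Y) (hτ : IsIncreasingProcess τ) (t : ℝ≥0) :
    ∀ᵐ ω ∂P, {k | Y k ω ∈ Set.Ioc 0 t}.Finite := by
  have h1 : ∀ R : ℕ, ∀ᵐ ω ∂P, τ t ω ≤ R → {k | Y k ω ∈ Set.Ioc 0 t}.Finite := by
    intro R
    rw [ae_iff]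
    have hA : MeasurableSet {x : ℝ≥0 → ℝ | x t ≤ R} :=
      measurableSet_le (measurable_pi_apply t) measurable_const
    have h2 : ∀ K : ℕ, P {ω | ¬ (τ t ω ≤ R → {k | Y k ω ∈ Set.Ioc 0 t}.Finite)} ≤
        ENNReal.ofReal (((t : ℝ) * R) / ((K : ℝ) + 1)) := by
      intro K
      have h3 := hY.measure_count_ge_le hτ.measurable hτ.mono hτ.rightCts hτ.nonneg
        (zero_le (a := t)) hA (b := R) (fun ω h => h) (Nat.succ_pos K)
      refine (measure_mono fun ω hω => ?_).trans (h3.trans ?_)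
      · have h4 : ¬ (τ t ω ≤ R → {k | Y k ω ∈ Set.Ioc 0 t}.Finite) := hω
        push Not at h4
        refine ⟨h4.1, ?_⟩
        rw [Set.encard_eq_top_iff.2 h4.2]
        exact le_top
      · simp only [NNReal.coe_zero, sub_zero, Nat.cast_succ]
        exact mul_le_of_le_one_right zero_le prob_le_one
    have h5 : Tendsto (fun K : ℕ => ENNReal.ofReal (((t : ℝ) * R) / ((K : ℝ) + 1))) atTop (𝓝 0) := by
      rw [← ENNReal.ofReal_zero]
      refine (ENNReal.continuous_ofReal.tendsto _).comp ?_
      exact tendsto_const_nhds.div_atTop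
        (tendsto_atTop_add_const_right _ _ tendsto_natCast_atTop_atTop)
    exact le_antisymm (ge_of_tendsto' h5 h2) zero_le
  filter_upwards [ae_all_iff.2 h1] with ω hω
  obtain ⟨R, hR⟩ := exists_nat_ge (τ t ω)
  exact hω R hR

theorem IsCoxPoints.ae_tendsto_atTop (hY : IsCoxPoints P τ Y) (hτ : IsIncreasingProcess τ) :
    ∀ᵐ ω ∂P, Tendsto (fun k => Y k ω) atTop atTop := by
  filter_upwards [ae_all_iff.2 fun m : ℕ => hY.ae_finite hτ m, hY.pos, hY.strictMono]
    with ω h1 h2 h3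
  refine tendsto_atTop_atTop_of_monotone h3.monotone fun b => ?_
  obtain ⟨m, hm⟩ := exists_nat_ge b
  by_contra! hcon
  refine Set.infinite_univ ((h1 m).subset fun k _ => ?_)
  exact ⟨h2.trans_le (h3.monotone (Nat.zero_le k)), (hcon k).le.trans hm⟩

/-- Cut `[0, T + 1]` into `N + 1` equal cells. If `τ (T + 1) ≤ R`, at most `R / ε` cells see an
increase of at least `ε`, and each contains a cut point with conditional probability `O(1 / N)`. A
cut point at a jump of size at least `ε` lies in such a cell; let `N → ∞`. -/
theorem IsCoxPoints.ae_leftLim_eq (hY : IsCoxPoints P τ Y) (hτ : IsIncreasingProcess τ) :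
    ∀ᵐ ω ∂P, ∀ k, 0 < Y k ω → Function.leftLim (fun t => τ t ω) (Y k ω) = τ (Y k ω) ω := by
  have h1 : ∀ (T R e : ℕ), ∀ᵐ ω ∂P, τ (T + 1 : ℕ) ω ≤ R → ∀ k, Y k ω ∈ Set.Ioc 0 ((T + 1 : ℕ) : ℝ≥0) →
      τ (Y k ω) ω < Function.leftLim (fun t => τ t ω) (Y k ω) + 1 / ((e : ℝ) + 1) := by
    intro T R e
    set ε : ℝ := 1 / ((e : ℝ) + 1) with hε
    have hε0 : 0 < ε := by positivity
    rw [ae_iff]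
    have h2 : ∀ N : ℕ, P {ω | ¬ (τ (T + 1 : ℕ) ω ≤ R → ∀ k, Y k ω ∈ Set.Ioc 0 ((T + 1 : ℕ) : ℝ≥0) →
        τ (Y k ω) ω < Function.leftLim (fun t => τ t ω) (Y k ω) + ε)} ≤
        ENNReal.ofReal (((T + 1 : ℕ) * R) / ((N : ℝ) + 1)) * ENNReal.ofReal (R / ε) := by
      intro N
      set d : ℝ≥0 := ((T + 1 : ℕ) : ℝ≥0) / ((N + 1 : ℕ) : ℝ≥0) with hd
      have hd0 : 0 < d := by rw [hd]; positivity
      have hdN : ((N + 1 : ℕ) : ℝ≥0) * d = (T + 1 : ℕ) := by rw [hd]; field_simp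
      set t : ℕ → ℝ≥0 := fun i => i * d with ht
      have htm : Monotone t := fun i j hij => by simp only [ht]; gcongr
      set A : ℕ → Set (ℝ≥0 → ℝ) := fun i =>
        {x | x (T + 1 : ℕ) ≤ R ∧ ε ≤ x (t (i + 1)) - x (t i)} with hA
      have hAm : ∀ i, MeasurableSet (A i) := fun i =>
        (measurableSet_le (measurable_pi_apply _) measurable_const).inter
          (measurableSet_le measurable_const
            ((measurable_pi_apply (t (i + 1))).sub (measurable_pi_apply (t i))))
      have hAm' : ∀ i, MeasurableSet {ω | (fun r => τ r ω) ∈ A i} := fun i =>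
        (measurable_pi_lambda (fun ω r => τ r ω) hτ.measurable) (hAm i)
      have hcell : ∀ i ∈ Finset.range (N + 1), P {ω | (fun r => τ r ω) ∈ A i ∧
          (1 : ℕ) ≤ Set.encard {k | Y k ω ∈ Set.Ioc (t i) (t (i + 1))}} ≤
          ENNReal.ofReal (((T + 1 : ℕ) * R) / ((N : ℝ) + 1)) * P {ω | (fun r => τ r ω) ∈ A i} := by
        intro i hi
        have htT : t (i + 1) ≤ (T + 1 : ℕ) := by
          rw [← hdN]
          exact htm (by have := Finset.mem_range.1 hi; omega)
        refine (hY.measure_count_ge_le hτ.measurable hτ.mono hτ.rightCts hτ.nonneg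
          (htm (Nat.le_succ i)) (hAm i) (b := R)
          (fun ω h => (hτ.mono ω htT).trans h.1) one_pos).trans_eq ?_
        congr 2
        simp only [ht, hd]
        push_cast
        field_simp
        ring
      have hsum : ∑ i ∈ Finset.range (N + 1), P {ω | (fun r => τ r ω) ∈ A i} ≤
          ENNReal.ofReal (R / ε) := by
        calc _ = ∑ i ∈ Finset.range (N + 1),
              ∫⁻ ω, {ω | (fun r => τ r ω) ∈ A i}.indicator 1 ω ∂P :=
              Finset.sum_congr rfl fun i _ => (lintegral_indicator_one (hAm' i)).symm
          _ = ∫⁻ ω, ∑ i ∈ Finset.range (N + 1),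
              {ω | (fun r => τ r ω) ∈ A i}.indicator 1 ω ∂P :=
              (lintegral_finsetSum _ fun i _ => measurable_one.indicator (hAm' i)).symm
          _ ≤ ∫⁻ _, ENNReal.ofReal (R / ε) ∂P := by
              refine lintegral_mono fun ω => ?_
              by_cases hR : τ (T + 1 : ℕ) ω ≤ R
              · have h3 : ∀ i, {ω | (fun r => τ r ω) ∈ A i}.indicator (1 : Ω → ℝ≥0∞) ω ≤
                    ENNReal.ofReal ((τ (t (i + 1)) ω - τ (t i) ω) / ε) := by
                  intro i
                  by_cases hi : ω ∈ {ω | (fun r => τ r ω) ∈ A i}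
                  · rw [Set.indicator_of_mem hi, Pi.one_apply, ← ENNReal.ofReal_one]
                    exact ENNReal.ofReal_le_ofReal ((one_le_div hε0).2 hi.2)
                  · rw [Set.indicator_of_notMem hi]
                    exact zero_le
                refine (Finset.sum_le_sum fun i _ => h3 i).trans ?_
                rw [← ENNReal.ofReal_sum_of_nonneg fun i _ => div_nonneg
                  (sub_nonneg.2 (hτ.mono ω (htm (Nat.le_succ i)))) hε0.le, ← Finset.sum_div,
                  Finset.sum_range_sub fun i => τ (t i) ω]
                refine ENNReal.ofReal_le_ofReal ?_
                have h4 : t (N + 1) = (T + 1 : ℕ) := hdN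
                rw [h4]
                gcongr
                linarith [hτ.nonneg ω (t 0)]
              · rw [Finset.sum_eq_zero]
                · exact zero_le
                · intro i _
                  exact Set.indicator_of_notMem (fun h => hR h.1) _
          _ = _ := by simp
      calc _ ≤ P (⋃ i ∈ Finset.range (N + 1), {ω | (fun r => τ r ω) ∈ A i ∧
          (1 : ℕ) ≤ Set.encard {k | Y k ω ∈ Set.Ioc (t i) (t (i + 1))}}) := by
            refine measure_mono fun ω hω => ?_
            have h3 : ¬ (τ (T + 1 : ℕ) ω ≤ R → ∀ k, Y k ω ∈ Set.Ioc 0 ((T + 1 : ℕ) : ℝ≥0) →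
              τ (Y k ω) ω < Function.leftLim (fun t => τ t ω) (Y k ω) + ε) := hω
            push Not at h3
            obtain ⟨h4, k, h5, h6⟩ := h3
            -- Cells are open on the left, hence the ceiling minus one.
            set i := ⌈Y k ω / d⌉₊ - 1 with hi
            have hc0 : 0 < ⌈Y k ω / d⌉₊ := Nat.ceil_pos.2 (div_pos h5.1 hd0)
            have hi1 : i + 1 = ⌈Y k ω / d⌉₊ := by omega
            have h7 : Y k ω ≤ t (i + 1) := by
              simp only [ht, hi1]
              rw [← div_le_iff₀ hd0]
              exact Nat.le_ceil _
            have h8 : t i < Y k ω := by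
              simp only [ht]
              rw [← lt_div_iff₀ hd0]
              exact Nat.lt_ceil.1 (by omega)
            have h9 : i < N + 1 := by
              rw [← Nat.succ_le_iff, Nat.succ_eq_add_one, hi1, Nat.ceil_le, div_le_iff₀ hd0, hdN]
              exact h5.2
            refine Set.mem_iUnion₂.2 ⟨i, Finset.mem_range.2 h9, ⟨h4, ?_⟩, ?_⟩
            · have h10 : τ (t i) ω ≤ Function.leftLim (fun t => τ t ω) (Y k ω) :=
                (hτ.mono ω).le_leftLim h8
              have h11 := hτ.mono ω h7
              simp only at h11
              show ε ≤ τ (t (i + 1)) ω - τ (t i) ω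
              linarith
            · rw [Nat.cast_one, Set.one_le_encard_iff_nonempty]
              exact ⟨k, h8, h7⟩
        _ ≤ ∑ i ∈ Finset.range (N + 1), P {ω | (fun r => τ r ω) ∈ A i ∧
          (1 : ℕ) ≤ Set.encard {k | Y k ω ∈ Set.Ioc (t i) (t (i + 1))}} :=
            measure_biUnion_finset_le _ _
        _ ≤ ∑ i ∈ Finset.range (N + 1), ENNReal.ofReal (((T + 1 : ℕ) * R) / ((N : ℝ) + 1)) *
            P {ω | (fun r => τ r ω) ∈ A i} := Finset.sum_le_sum hcell
        _ ≤ _ := by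
            rw [← Finset.mul_sum]
            gcongr
    have h5 : Tendsto (fun N : ℕ => ENNReal.ofReal (((T + 1 : ℕ) * R) / ((N : ℝ) + 1)) *
        ENNReal.ofReal (R / ε)) atTop (𝓝 (0 * ENNReal.ofReal (R / ε))) := by
      refine ENNReal.Tendsto.mul_const ?_ (.inr ENNReal.ofReal_ne_top)
      rw [← ENNReal.ofReal_zero]
      refine (ENNReal.continuous_ofReal.tendsto _).comp ?_
      exact tendsto_const_nhds.div_atTop
        (tendsto_atTop_add_const_right _ _ tendsto_natCast_atTop_atTop)
    rw [zero_mul] at h5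
    exact le_antisymm (ge_of_tendsto' h5 h2) zero_le
  filter_upwards [ae_all_iff.2 fun T => ae_all_iff.2 fun R => ae_all_iff.2 fun e => h1 T R e]
    with ω hω k hk
  refine le_antisymm ((hτ.mono ω).leftLim_le le_rfl) (le_of_forall_pos_lt_add fun ε hε => ?_)
  obtain ⟨T, hT⟩ := exists_nat_ge (Y k ω)
  obtain ⟨R, hR⟩ := exists_nat_ge (τ (T + 1 : ℕ) ω)
  obtain ⟨e, he⟩ := exists_nat_one_div_lt hε
  have := hω T R e hR k ⟨hk, hT.trans (by exact_mod_cast Nat.le_succ T)⟩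
  linarith

end Cox

/-! ### Gaps between cut points and growth of the intensity along them -/

section Cox

variable {Ω : Type*} [MeasurableSpace Ω] {P : Measure Ω} [IsProbabilityMeasure P]
  {τ : ℝ≥0 → Ω → ℝ} {Y : ℕ → Ω → ℝ≥0}

theorem tendsto_atTop_of_le_pow {x : ℝ≥0 → ℝ} (h0 : ∀ t, 0 ≤ x t) {p : ℕ}
    (hp : ∀ᶠ t : ℝ≥0 in atTop, (t : ℝ) ≤ x t ^ p) : Tendsto x atTop atTop := by
  refine tendsto_atTop.2 fun b => ?_
  filter_upwards [hp, eventually_gt_atTop (b.toNNReal ^ p)] with t h1 h2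
  by_contra hcon
  have h3 : x t ^ p ≤ (b.toNNReal : ℝ) ^ p := by
    have := h0 t
    gcongr
    exact (not_le.1 hcon).le.trans (Real.le_coe_toNNReal b)
  have h4 : ((b.toNNReal ^ p : ℝ≥0) : ℝ) < t := NNReal.coe_lt_coe.2 h2
  push_cast at h4
  linarith

theorem tendsto_intensity (hτ : IsIncreasingProcess τ) {p : ℕ} {ω : Ω}
    (hp : ∀ᶠ t : ℝ≥0 in atTop, (t : ℝ) ≤ τ t ω ^ p) (hY : Tendsto (fun k => Y k ω) atTop atTop) :
    Tendsto (fun k => τ (Y k ω) ω) atTop atTop :=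
  (tendsto_atTop_of_le_pow (x := fun t => τ t ω) (hτ.nonneg ω) hp).comp hY

/-- Where `τ ≥ 4 ^ r`, a cell of length `2 ^ (-r)` has mean count at least `2 ^ r` and is empty with
probability at most `exp (-2 ^ r)`. Polynomial growth keeps the number of relevant cells geometric
in `r`, so Borel–Cantelli applies. -/
theorem IsCoxPoints.ae_gap_le (hY : IsCoxPoints P τ Y) (hτ : IsIncreasingProcess τ) {p : ℕ}
    (hp : ∀ᵐ ω ∂P, ∀ᶠ t : ℝ≥0 in atTop, (t : ℝ) ≤ τ t ω ^ p) :
    ∀ᵐ ω ∂P, ∀ᶠ k in atTop, (Y (k + 1) ω : ℝ) - Y k ω ≤ 4 / √(τ (Y k ω) ω) := by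
  set B : ℕ → Set Ω := fun r => ⋃ i ∈ Finset.range (4 ^ ((r + 1) * p) * 2 ^ r + 2),
    {ω | (4 : ℝ) ^ r ≤ τ ((i : ℝ≥0) / 2 ^ r) ω ∧
      Set.encard {k | Y k ω ∈ Set.Ioc ((i : ℝ≥0) / 2 ^ r) (((i + 1 : ℕ) : ℝ≥0) / 2 ^ r)} = 0} with hB
  have h1 : ∀ r, P (B r) ≤ ENNReal.ofReal
      ((4 ^ p + 2) * ((4 ^ p * 2) ^ r * Real.exp (-2 ^ r))) := by
    intro r
    have h2 : ∀ i ∈ Finset.range (4 ^ ((r + 1) * p) * 2 ^ r + 2),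
        P {ω | (4 : ℝ) ^ r ≤ τ ((i : ℝ≥0) / 2 ^ r) ω ∧
      Set.encard {k | Y k ω ∈ Set.Ioc ((i : ℝ≥0) / 2 ^ r) (((i + 1 : ℕ) : ℝ≥0) / 2 ^ r)} = 0} ≤
        ENNReal.ofReal (Real.exp (-2 ^ r)) := by
      intro i _
      refine hY.measure_count_eq_zero_le hτ.mono ?_ (le_of_eq ?_) (hτ.measurable _)
      · gcongr
        exact Nat.le_succ i
      · push_cast
        rw [show (4 : ℝ) ^ r = 2 ^ r * 2 ^ r by rw [← mul_pow]; norm_num]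
        field_simp
        ring
    refine (measure_biUnion_finset_le _ _).trans ((Finset.sum_le_card_nsmul _ _ _ h2).trans ?_)
    rw [Finset.card_range, nsmul_eq_mul, ← ENNReal.ofReal_natCast,
      ← ENNReal.ofReal_mul (Nat.cast_nonneg _), ← mul_assoc]
    refine ENNReal.ofReal_le_ofReal ?_
    gcongr
    push_cast
    have h3 : (1 : ℝ) ≤ (4 ^ p * 2) ^ r :=
      one_le_pow₀ (by nlinarith [one_le_pow₀ (show (1 : ℝ) ≤ 4 by norm_num) (n := p)])
    calc (4 : ℝ) ^ ((r + 1) * p) * 2 ^ r + 2 = 4 ^ p * (4 ^ p * 2) ^ r + 2 := by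
          rw [mul_pow, ← pow_mul]; ring
      _ ≤ _ := by rw [add_mul]; linarith
  have h4 := ae_eventually_notMem (ne_top_of_le_ne_top
    ((summable_pow_mul_exp_neg_pow (4 ^ p * 2) one_lt_two).mul_left
      (4 ^ p + 2)).tsum_ofReal_ne_top (ENNReal.tsum_le_tsum h1))
  filter_upwards [h4, hp, hY.ae_tendsto_atTop hτ, hY.strictMono] with ω h5 h6 h7 h8
  obtain ⟨N, hN⟩ := eventually_atTop.1 h5
  filter_upwards [h7.eventually h6,
    (tendsto_intensity hτ h6 h7).eventually (eventually_ge_atTop ((4 ^ N : ℕ) : ℝ))]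
    with k hk1 hk2
  set w := τ (Y k ω) ω with hw
  set v := Y k ω with hv
  have hw1 : (1 : ℝ) ≤ w := by
    refine le_trans ?_ hk2
    exact_mod_cast Nat.one_le_pow _ _ (by norm_num)
  set m := ⌊w⌋₊ with hm
  have hm0 : m ≠ 0 := (Nat.floor_pos.2 hw1).ne'
  set r := Nat.log 4 m with hr
  have hrN : N ≤ r := by
    rw [hr]
    exact Nat.le_log_of_pow_le (by norm_num) (Nat.le_floor hk2)
  have hr1 : (4 : ℝ) ^ r ≤ w := by
    have h9 : 4 ^ r ≤ m := Nat.pow_log_le_self 4 hm0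
    exact le_trans (by exact_mod_cast h9) (Nat.floor_le (by linarith))
  have hr2 : w < (4 : ℝ) ^ (r + 1) := by
    have h9 : m < 4 ^ (r + 1) := Nat.lt_pow_succ_log_self (by norm_num) m
    exact (Nat.lt_floor_add_one w).trans_le (by exact_mod_cast h9)
  -- The first cell starting strictly after `v`: a point in it has index above `k`, and it ends
  -- before `v + 2 / 2 ^ r`.
  set i := ⌊v * 2 ^ r⌋₊ + 1 with hi
  have hpow : (0 : ℝ≥0) < 2 ^ r := by positivity
  have hi1 : v < (i : ℝ≥0) / 2 ^ r := by
    rw [lt_div_iff₀ hpow, hi]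
    exact_mod_cast Nat.lt_floor_add_one (v * 2 ^ r)
  have hi2 : i < 4 ^ ((r + 1) * p) * 2 ^ r + 2 := by
    have h9 : v * 2 ^ r ≤ ((4 ^ ((r + 1) * p) * 2 ^ r : ℕ) : ℝ≥0) := by
      push_cast
      gcongr
      rw [← NNReal.coe_le_coe]
      push_cast
      rw [pow_mul]
      exact hk1.trans (by gcongr)
    have := Nat.floor_le_floor h9
    rw [Nat.floor_natCast] at this
    omega
  have hnot := hN r hrN
  have h9 : (4 : ℝ) ^ r ≤ τ ((i : ℝ≥0) / 2 ^ r) ω := hr1.trans (hτ.mono ω hi1.le)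
  have h10 : ¬ Set.encard {k | Y k ω ∈ Set.Ioc ((i : ℝ≥0) / 2 ^ r)
      (((i + 1 : ℕ) : ℝ≥0) / 2 ^ r)} = 0 := fun h =>
    hnot (Set.mem_iUnion₂.2 ⟨i, Finset.mem_range.2 hi2, h9, h⟩)
  obtain ⟨l, hl1, hl2⟩ := Set.encard_ne_zero.1 h10
  have hkl : k < l := h8.lt_iff_lt.1 (hi1.trans hl1)
  have h11 : Y (k + 1) ω ≤ v + 2 / 2 ^ r := by
    refine (h8.monotone hkl).trans (hl2.trans ?_)
    rw [div_le_iff₀ hpow, add_mul, div_mul_cancel₀ _ hpow.ne', hi]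
    push_cast
    rw [add_assoc, one_add_one_eq_two]
    gcongr
    exact Nat.floor_le zero_le
  have h12 : (Y (k + 1) ω : ℝ) ≤ v + 2 / 2 ^ r := by exact_mod_cast h11
  have h13 : √w ≤ 2 * 2 ^ r := by
    rw [Real.sqrt_le_left (by positivity)]
    refine hr2.le.trans (le_of_eq ?_)
    rw [mul_pow, ← pow_mul, mul_comm r 2, pow_mul, pow_succ]
    norm_num
    ring
  have h14 : 0 < √w := Real.sqrt_pos.2 (by linarith)
  have h15 : (2 : ℝ) / 2 ^ r ≤ 4 / √w := by
    rw [div_le_div_iff₀ (by positivity) h14]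
    linarith
  linarith

/-- The bound does not pay for the number of dyadic times: counts increase with time, so only the
last time of the mesh with `τ < b` matters. The events `A i` locating it are disjoint path events.
-/
theorem IsCoxPoints.measure_exists_dyadic_le (hY : IsCoxPoints P τ Y) (hτ : IsIncreasingProcess τ)
    (T : ℕ) (b : ℝ) (hb : 0 ≤ b) {K : ℕ} (hK : 0 < K) :
    P {ω | ∃ n : ℕ, ∃ i ≤ T * 2 ^ n, τ ((i : ℝ≥0) / 2 ^ n) ω < b ∧
      K ≤ Set.encard {k | Y k ω ∈ Set.Ioc 0 ((i : ℝ≥0) / 2 ^ n)}} ≤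
      ENNReal.ofReal (T * b / K) := by
  classical
  set C : ℕ → Set Ω := fun n => {ω | ∃ i ≤ T * 2 ^ n, τ ((i : ℝ≥0) / 2 ^ n) ω < b ∧
      K ≤ Set.encard {k | Y k ω ∈ Set.Ioc 0 ((i : ℝ≥0) / 2 ^ n)}} with hC
  -- Meshes are nested, so it suffices to bound each level uniformly.
  have hmono : Monotone C := by
    refine monotone_nat_of_le_succ fun n => ?_
    rintro ω ⟨i, h1, h2, h3⟩
    have h4 : ((i * 2 : ℕ) : ℝ≥0) / 2 ^ (n + 1) = (i : ℝ≥0) / 2 ^ n := by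
      push_cast
      rw [pow_succ]
      field_simp
    refine ⟨i * 2, ?_, ?_, ?_⟩
    · rw [pow_succ, ← mul_assoc]
      omega
    · rwa [h4]
    · rwa [h4]
  have hunion : {ω | ∃ n : ℕ, ∃ i ≤ T * 2 ^ n, τ ((i : ℝ≥0) / 2 ^ n) ω < b ∧
      K ≤ Set.encard {k | Y k ω ∈ Set.Ioc 0 ((i : ℝ≥0) / 2 ^ n)}} = ⋃ n, C n := by
    ext ω
    simp [hC]
  rw [hunion, hmono.measure_iUnion]
  refine iSup_le fun n => ?_
  set t : ℕ → ℝ≥0 := fun i => (i : ℝ≥0) / 2 ^ n with ht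
  have htm : Monotone t := fun i j hij => by simp only [ht]; gcongr
  set A : ℕ → Set (ℝ≥0 → ℝ) := fun i =>
    {x | x (t i) < b ∧ (i < T * 2 ^ n → b ≤ x (t (i + 1)))} with hA
  have hAm : ∀ i, MeasurableSet (A i) := fun i => by
    refine (measurableSet_lt (measurable_pi_apply _) measurable_const).inter ?_
    have h1 : MeasurableSet {x : ℝ≥0 → ℝ | b ≤ x (t (i + 1))} :=
      measurableSet_le measurable_const (measurable_pi_apply _)
    exact MeasurableSet.imp (MeasurableSet.const _) h1
  have hAm' : ∀ i, MeasurableSet {ω | (fun r => τ r ω) ∈ A i} := fun i =>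
    (measurable_pi_lambda (fun ω r => τ r ω) hτ.measurable) (hAm i)
  have hsub : C n ⊆ ⋃ i ∈ Finset.range (T * 2 ^ n + 1), {ω | (fun r => τ r ω) ∈ A i ∧
      K ≤ Set.encard {k | Y k ω ∈ Set.Ioc 0 (t i)}} := by
    rintro ω ⟨i, h1, h2, h3⟩
    set j := Nat.findGreatest (fun i => τ (t i) ω < b) (T * 2 ^ n) with hj
    have h4 : τ (t j) ω < b := Nat.findGreatest_spec (P := fun i => τ (t i) ω < b) h1 h2
    have h5 : i ≤ j := Nat.le_findGreatest h1 h2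
    have h6 : j ≤ T * 2 ^ n := Nat.findGreatest_le _
    refine Set.mem_iUnion₂.2 ⟨j, Finset.mem_range.2 (by omega), ⟨h4, fun h7 => ?_⟩, h3.trans ?_⟩
    · exact not_lt.1 (Nat.findGreatest_is_greatest (P := fun i => τ (t i) ω < b)
        (Nat.lt_succ_self j) h7)
    · exact Set.encard_le_encard fun k hk => ⟨hk.1, hk.2.trans (htm h5)⟩
  have hcell : ∀ i ∈ Finset.range (T * 2 ^ n + 1), P {ω | (fun r => τ r ω) ∈ A i ∧
      K ≤ Set.encard {k | Y k ω ∈ Set.Ioc 0 (t i)}} ≤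
      ENNReal.ofReal (T * b / K) * P {ω | (fun r => τ r ω) ∈ A i} := by
    intro i hi
    refine (hY.measure_count_ge_le hτ.measurable hτ.mono hτ.rightCts hτ.nonneg
      (zero_le (a := t i)) (hAm i) (b := b) (fun ω h => h.1.le) hK).trans ?_
    have h1 : (t i : ℝ) ≤ T := by
      have h2 : t i ≤ T := by
        simp only [ht]
        rw [div_le_iff₀ (by positivity)]
        have := Finset.mem_range.1 hi
        exact_mod_cast (show i ≤ T * 2 ^ n by omega)
      exact_mod_cast h2
    gcongr
    simpa using h1
  calc P (C n) ≤ _ := measure_mono hsub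
    _ ≤ ∑ i ∈ Finset.range (T * 2 ^ n + 1), P {ω | (fun r => τ r ω) ∈ A i ∧
      K ≤ Set.encard {k | Y k ω ∈ Set.Ioc 0 (t i)}} := measure_biUnion_finset_le _ _
    _ ≤ ∑ i ∈ Finset.range (T * 2 ^ n + 1),
        ENNReal.ofReal (T * b / K) * P {ω | (fun r => τ r ω) ∈ A i} := Finset.sum_le_sum hcell
    _ = ENNReal.ofReal (T * b / K) *
        P (⋃ i ∈ Finset.range (T * 2 ^ n + 1), {ω | (fun r => τ r ω) ∈ A i}) := by
      rw [← Finset.mul_sum, measure_biUnion_finset _ fun i _ => hAm' i]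
      have key : ∀ i j, i < j → j < T * 2 ^ n + 1 →
          Disjoint {ω | (fun r => τ r ω) ∈ A i} {ω | (fun r => τ r ω) ∈ A j} := by
        intro i j hij hj
        refine Set.disjoint_left.2 fun ω h1 h2 => ?_
        have h3 : b ≤ τ (t (i + 1)) ω := h1.2 (by omega)
        have h4 : τ (t j) ω < b := h2.1
        have h5 := hτ.mono ω (htm (show i + 1 ≤ j from hij))
        simp only at h5
        linarith
      intro i hi j hj hij
      have hi' := Finset.mem_range.1 (Finset.mem_coe.1 hi)
      have hj' := Finset.mem_range.1 (Finset.mem_coe.1 hj)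
      rcases lt_or_gt_of_ne hij with h | h
      · exact key i j h hj'
      · exact (key j i h hi').symm
    _ ≤ _ := mul_le_of_le_one_right zero_le prob_le_one

/-- While `τ < 2 ^ m`, time is eventually below `2 ^ (m * (p + 1))`, so the mean number of points is
at most `2 ^ (m * (p + 2))`. The exponent `p + 3` leaves a summable `2 ^ (-m)`. -/
theorem IsCoxPoints.ae_index_le (hY : IsCoxPoints P τ Y) (hτ : IsIncreasingProcess τ) {p : ℕ}
    (hp : ∀ᵐ ω ∂P, ∀ᶠ t : ℝ≥0 in atTop, (t : ℝ) ≤ τ t ω ^ p) :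
    ∀ᵐ ω ∂P, ∀ᶠ k : ℕ in atTop, (k : ℝ) ≤ (2 * τ (Y k ω) ω) ^ (p + 3) := by
  have h1 : ∀ m : ℕ, P {ω | ∃ n : ℕ, ∃ i : ℕ, i ≤ 2 ^ (m * (p + 1)) * 2 ^ n ∧
      τ ((i : ℝ≥0) / 2 ^ n) ω < (2 : ℝ) ^ m ∧ (2 ^ (m * (p + 3)) : ℕ) ≤
        Set.encard {k | Y k ω ∈ Set.Ioc 0 ((i : ℝ≥0) / 2 ^ n)}} ≤
      ENNReal.ofReal ((1 / 2) ^ m) := by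
    intro m
    refine (hY.measure_exists_dyadic_le hτ (2 ^ (m * (p + 1))) (2 ^ m) (by positivity)
      (K := 2 ^ (m * (p + 3))) (by positivity)).trans_eq ?_
    congr 1
    push_cast
    rw [show m * (p + 3) = m * (p + 1) + m + m by ring, pow_add, pow_add, one_div, inv_pow]
    field_simp
  have h2 := ae_eventually_notMem (ne_top_of_le_ne_top
    summable_geometric_two.tsum_ofReal_ne_top (ENNReal.tsum_le_tsum h1))
  filter_upwards [h2, hp, hY.ae_tendsto_atTop hτ, hY.strictMono, hY.pos] with ω h5 h6 h7 h8 h9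
  obtain ⟨N, hN⟩ := eventually_atTop.1 h5
  filter_upwards [h7.eventually h6,
    (tendsto_intensity hτ h6 h7).eventually (eventually_ge_atTop ((2 ^ N : ℕ) : ℝ))]
    with k hk1 hk2
  set w := τ (Y k ω) ω with hw
  set v := Y k ω with hv
  have hw1 : (1 : ℝ) ≤ w := by
    refine le_trans ?_ hk2
    exact_mod_cast Nat.one_le_pow _ _ (by norm_num)
  have hm0 : ⌊w⌋₊ ≠ 0 := (Nat.floor_pos.2 hw1).ne'
  set r := Nat.log 2 ⌊w⌋₊ with hr
  have hrN : N ≤ r := Nat.le_log_of_pow_le (by norm_num) (Nat.le_floor hk2)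
  have hr1 : (2 : ℝ) ^ r ≤ w := by
    have h9 : 2 ^ r ≤ ⌊w⌋₊ := Nat.pow_log_le_self 2 hm0
    exact le_trans (by exact_mod_cast h9) (Nat.floor_le (by linarith))
  have hr2 : w < (2 : ℝ) ^ (r + 1) := by
    have h9 : ⌊w⌋₊ < 2 ^ (r + 1) := Nat.lt_pow_succ_log_self (by norm_num) _
    exact (Nat.lt_floor_add_one w).trans_le (by exact_mod_cast h9)
  have hv1 : v < 2 ^ ((r + 1) * (p + 1)) := by
    rw [← NNReal.coe_lt_coe]
    push_cast
    calc (v : ℝ) ≤ w ^ p := hk1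
      _ ≤ (2 ^ (r + 1)) ^ p := by gcongr
      _ = 2 ^ ((r + 1) * p) := (pow_mul _ _ _).symm
      _ < 2 ^ ((r + 1) * (p + 1)) := pow_lt_pow_right₀ one_lt_two (by
        rw [mul_add]; omega)
  -- Right-continuity supplies a dyadic time just after `Y k` at which the intensity is still below
  -- `2 ^ (r + 1)`.
  obtain ⟨n, hn⟩ := (((hτ.rightCts ω v).tendsto.comp (tendsto_dyadic_ceil v)).eventually
    (gt_mem_nhds hr2)).exists
  simp only [Function.comp] at hn
  set i := ⌊v * 2 ^ n⌋₊ + 1 with hi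
  have hpow : (0 : ℝ≥0) < 2 ^ n := by positivity
  have hi1 : v < (i : ℝ≥0) / 2 ^ n := by
    rw [lt_div_iff₀ hpow, hi]
    exact_mod_cast Nat.lt_floor_add_one (v * 2 ^ n)
  have hi2 : i ≤ 2 ^ ((r + 1) * (p + 1)) * 2 ^ n := by
    refine Nat.succ_le_of_lt ((Nat.floor_lt zero_le).2 ?_)
    push_cast
    gcongr
  have h10 : ¬ ((2 ^ ((r + 1) * (p + 3)) : ℕ) ≤
      Set.encard {k | Y k ω ∈ Set.Ioc 0 ((i : ℝ≥0) / 2 ^ n)}) := fun h =>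
    hN (r + 1) (by omega) ⟨n, i, hi2, hn, h⟩
  have h11 : ((k + 1 : ℕ) : ℕ∞) ≤ Set.encard {k | Y k ω ∈ Set.Ioc 0 ((i : ℝ≥0) / 2 ^ n)} := by
    calc ((k + 1 : ℕ) : ℕ∞) = Set.encard (Finset.range (k + 1) : Set ℕ) := by
          rw [Set.encard_coe_eq_coe_finsetCard, Finset.card_range]
      _ ≤ _ := Set.encard_le_encard fun l hl => by
          have hl' := Finset.mem_range.1 (Finset.mem_coe.1 hl)
          exact ⟨h9.trans_le (h8.monotone (Nat.zero_le l)),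
            (h8.monotone (show l ≤ k by omega)).trans hi1.le⟩
  have h12 : k + 1 < 2 ^ ((r + 1) * (p + 3)) := by
    have := h11.trans_lt (not_le.1 h10)
    exact_mod_cast this
  have h13 : k ≤ 2 ^ ((r + 1) * (p + 3)) := by omega
  calc (k : ℝ) ≤ (2 : ℝ) ^ ((r + 1) * (p + 3)) := by exact_mod_cast h13
    _ = (2 * 2 ^ r) ^ (p + 3) := by rw [pow_mul, pow_succ' (2 : ℝ) r]
    _ ≤ _ := by gcongr

end Cox

/-! ### Typical marks -/

/-- The indices of the cut points and of the rational times. -/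
abbrev GridIndex : Type := ℕ ⊕ ℕ × ℕ

/-- The cut points and the rational times. -/
def gridPoint (y : ℕ → ℝ≥0) : GridIndex → ℝ≥0 :=
  Sum.elim y fun q => (q.1 : ℝ≥0) / q.2

theorem range_gridPoint (y : ℕ → ℝ≥0) : Set.range (gridPoint y) = gridPoints y :=
  Set.Sum.elim_range _ _

/-- The marks `u` are typical for the cut points `y` and the intensities `c` at the cut points and
at the rational times. -/
structure IsTypical (κ : ℝ) (y : ℕ → ℝ≥0) (c : GridIndex → ℝ) (u : ℕ → ℝ) : Prop where
  le_one : ∀ k, u k ≤ 1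
  ne : ∀ k q, u k * c (.inl k) ≠ c q
  exp_le : ∀ᶠ i : ℕ in atTop, ∀ k ∈ Finset.Ico (2 ^ i) (2 ^ (i + 1)),
    label (2 ^ i) (c (.inl (2 ^ i))) (fun j => Real.exp (κ ^ (2 * i) * ((y j : ℝ) - y (j - 1))))
      (fun j => c (.inl j)) u (k + 1) ≤ Real.exp (κ ^ i)
  hasMean : ∀ n q, c q ≤ c (.inl n) → HasMean (label n (c q) 1 (fun j => c (.inl j)) u)

/-- Needed for Fubini; only the values of `τ` at countably many grid points enter, so countable
operations suffice. -/
theorem measurableSet_isTypical (κ : ℝ) :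
    MeasurableSet {x : ((ℕ → ℝ≥0) × (GridIndex → ℝ)) × (ℕ → ℝ) |
      IsTypical κ x.1.1 x.1.2 x.2} := by
  have hy : ∀ j, Measurable fun x : ((ℕ → ℝ≥0) × (GridIndex → ℝ)) × (ℕ → ℝ) => (x.1.1 j : ℝ) :=
    fun j => by fun_prop
  have hc : ∀ q, Measurable fun x : ((ℕ → ℝ≥0) × (GridIndex → ℝ)) × (ℕ → ℝ) => x.1.2 q :=
    fun q => by fun_prop
  have hu : ∀ j, Measurable fun x : ((ℕ → ℝ≥0) × (GridIndex → ℝ)) × (ℕ → ℝ) => x.2 j :=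
    fun j => by fun_prop
  have h1 : MeasurableSet {x : ((ℕ → ℝ≥0) × (GridIndex → ℝ)) × (ℕ → ℝ) | ∀ k, x.2 k ≤ 1} := by
    simp only [Set.ofPred_forall]
    exact MeasurableSet.iInter fun k => measurableSet_le (hu k) measurable_const
  have h2 : MeasurableSet {x : ((ℕ → ℝ≥0) × (GridIndex → ℝ)) × (ℕ → ℝ) |
      ∀ k q, x.2 k * x.1.2 (.inl k) ≠ x.1.2 q} := by
    simp only [Set.ofPred_forall]
    exact MeasurableSet.iInter fun k => MeasurableSet.iInter fun q =>
      (measurableSet_eq_fun ((hu k).mul (hc _)) (hc q)).compl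
  have h3 : MeasurableSet {x : ((ℕ → ℝ≥0) × (GridIndex → ℝ)) × (ℕ → ℝ) |
      ∀ᶠ i : ℕ in atTop, ∀ k ∈ Finset.Ico (2 ^ i) (2 ^ (i + 1)),
        label (2 ^ i) (x.1.2 (.inl (2 ^ i)))
          (fun j => Real.exp (κ ^ (2 * i) * ((x.1.1 j : ℝ) - x.1.1 (j - 1))))
          (fun j => x.1.2 (.inl j)) x.2 (k + 1) ≤ Real.exp (κ ^ i)} := by
    simp only [eventually_atTop, Set.ofPred_exists, Set.ofPred_forall]
    refine MeasurableSet.iUnion fun a => MeasurableSet.iInter fun i => MeasurableSet.iInter fun _ =>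
      MeasurableSet.iInter fun k => MeasurableSet.iInter fun _ => ?_
    refine measurableSet_le (measurable_label (hc _) (fun j => ?_) (fun j => hc _) _
      fun j _ => hu j) measurable_const
    exact (((hy j).sub (hy (j - 1))).const_mul _).exp
  have h4 : MeasurableSet {x : ((ℕ → ℝ≥0) × (GridIndex → ℝ)) × (ℕ → ℝ) |
      ∀ n q, x.1.2 q ≤ x.1.2 (.inl n) →
        HasMean (label n (x.1.2 q) 1 (fun j => x.1.2 (.inl j)) x.2)} := by
    simp only [Set.ofPred_forall]
    refine MeasurableSet.iInter fun n => MeasurableSet.iInter fun q =>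
      MeasurableSet.imp (measurableSet_le (hc q) (hc _)) ?_
    refine measurableSet_exists_tendsto fun m => ?_
    refine (Finset.measurable_sum _ fun k _ => ?_).const_mul _
    exact measurable_label (g := fun _ _ => 1) (hc _) (fun j => measurable_const) (fun j => hc _) _
      fun j _ => hu j
  refine (((h1.inter h2).inter h3).inter h4).congr (Set.ext fun x => ?_)
  exact ⟨fun h => ⟨h.1.1.1, h.1.1.2, h.1.2, h.2⟩, fun h => ⟨⟨⟨h.1, h.2⟩, h.3⟩, h.4⟩⟩

/-- Finitely many exceptions are absorbed in the constant. -/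
theorem exists_le_mul_of_eventually {f g : ℕ → ℝ} {K : ℝ} (hg : ∀ k, 0 < g k)
    (hfg : ∀ᶠ k in atTop, |f k| ≤ K * g k) : ∃ C > 0, ∀ k, f k ≤ C * g k := by
  obtain ⟨C, hC, h⟩ := Asymptotics.bound_of_isBigO_nat_atTop
    (Asymptotics.IsBigO.of_bound K (f := f) (g := g) (l := atTop)
      (hfg.mono fun k hk => by rwa [Real.norm_eq_abs, Real.norm_of_nonneg (hg k).le]))
  refine ⟨C, hC, fun k => (le_abs_self _).trans ?_⟩
  simpa only [Real.norm_eq_abs, abs_of_pos (hg k)] using h (hg k).ne'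

/-! ### Almost sure typicality of independent uniform marks -/

section Marks

variable {Ω : Type*} [MeasurableSpace Ω] {P : Measure Ω} {U : ℕ → Ω → ℝ}

theorem ae_le_one (hm : ∀ k, Measurable (U k))
    (hu : ∀ k, P.map (U k) = volume.restrict (Set.Icc 0 1)) : ∀ᵐ ω ∂P, ∀ k, U k ω ≤ 1 := by
  refine ae_all_iff.2 fun k => ae_of_ae_map (hm k).aemeasurable (p := fun x => x ≤ 1) ?_
  rw [hu k]
  exact (ae_restrict_mem measurableSet_Icc).mono fun x hx => hx.2

theorem ae_ne_of_uniform (hm : ∀ k, Measurable (U k))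
    (hu : ∀ k, P.map (U k) = volume.restrict (Set.Icc 0 1)) (k : ℕ) (a : ℝ) :
    ∀ᵐ ω ∂P, U k ω ≠ a := by
  refine ae_of_ae_map (hm k).aemeasurable (p := fun x => x ≠ a) ?_
  rw [hu k]
  exact ae_restrict_of_ae (Measure.ae_ne volume a)

variable [IsProbabilityMeasure P]

/-- Independent uniform marks are typical for polynomially growing intensities. -/
theorem ae_isTypical (hm : ∀ k, Measurable (U k))
    (hu : ∀ k, P.map (U k) = volume.restrict (Set.Icc 0 1)) (hi : iIndepFun U P)
    {y : ℕ → ℝ≥0} {c : GridIndex → ℝ} {κ : ℝ} {q : ℕ} (hκ : 1 < κ) (hq : q ≠ 0)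
    (hκq : κ ^ (6 * q) = 2) (hy : Monotone y) (hw : Monotone fun j => c (.inl j))
    (hw0 : ∀ j, 0 < c (.inl j)) (hc : ∀ q, 0 ≤ c q)
    (hgap : ∀ᶠ k in atTop, (y (k + 1) : ℝ) - y k ≤ 4 / √(c (.inl k)))
    (hgrowth : ∀ᶠ k : ℕ in atTop, (k : ℝ) ≤ (2 * c (.inl k)) ^ q) :
    ∀ᵐ ω ∂P, IsTypical κ y c fun k => U k ω := by
  have hs : ∀ k, 0 < √(c (.inl k)) := fun k => Real.sqrt_pos.2 (hw0 k)
  obtain ⟨C, hC, h1⟩ := exists_le_mul_of_eventually (f := fun k => (y (k + 1) : ℝ) - y k)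
    (g := fun k => (√(c (.inl k)))⁻¹) (K := 4) (fun k => inv_pos.2 (hs k))
    (hgap.mono fun k hk => by
      rwa [abs_of_nonneg (sub_nonneg.2 (NNReal.coe_le_coe.2 (hy (Nat.le_succ k)))),
        ← div_eq_mul_inv])
  obtain ⟨D, hD, h2⟩ := exists_le_mul_of_eventually (f := fun i => κ ^ (3 * i))
    (g := fun i => √(c (.inl (2 ^ i)))) (K := 2) (fun i => hs _)
    (((tendsto_pow_atTop_atTop_of_one_lt one_lt_two).eventually hgrowth).mono fun i h => by
      -- The choice `κ ^ (6 * q) = 2` turns the growth bound at `k = 2 ^ i` into `κ ^ (6 * i) ≤ 2 *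
      -- w`, so `√w` is at least `κ ^ (3 * i) / 2`.
      have h3 : (κ ^ (6 * i)) ^ q ≤ (2 * c (.inl (2 ^ i))) ^ q := by
        rw [← pow_mul, show 6 * i * q = 6 * q * i by ring, pow_mul, hκq]
        exact_mod_cast h
      have h4 : κ ^ (6 * i) ≤ 2 * c (.inl (2 ^ i)) :=
        le_of_pow_le_pow_left₀ hq (by linarith [hw0 (2 ^ i)]) h3
      rw [abs_of_nonneg (by positivity)]
      have h5 : κ ^ (3 * i) / 2 ≤ √(c (.inl (2 ^ i))) := by
        refine Real.le_sqrt_of_sq_le ?_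
        rw [div_pow, ← pow_mul, show 3 * i * 2 = 6 * i by ring]
        linarith [hw0 (2 ^ i)]
      linarith)
  have h3 := eventually_label_exp_le hm hu hi hw hw0 (L := fun j => (y j : ℝ) - y (j - 1))
    (C := C) (c₀ := D⁻¹) (κ := κ) hC.le (fun k => by
      simpa only [Nat.add_sub_cancel, ← div_eq_mul_inv] using h1 k) hκ (inv_pos.2 hD)
    (fun i => by
      rw [inv_mul_le_iff₀ hD]
      exact h2 i)
  have h4 : ∀ᵐ ω ∂P, ∀ k q, U k ω * c (.inl k) ≠ c q :=
    ae_all_iff.2 fun k => ae_all_iff.2 fun q =>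
      (ae_ne_of_uniform hm hu k (c q / c (.inl k))).mono fun ω h h' =>
        h (by rw [← h', mul_div_cancel_right₀ _ (hw0 k).ne'])
  have h5 : ∀ᵐ ω ∂P, ∀ n q, c q ≤ c (.inl n) →
      HasMean (label n (c q) 1 (fun j => c (.inl j)) fun k => U k ω) := by
    refine ae_all_iff.2 fun n => ae_all_iff.2 fun q => ?_
    by_cases hq : c q ≤ c (.inl n)
    · filter_upwards [ae_tendsto_average_label hm hu hi hw hw0 (hc q) hq] with ω h _ using h
    · exact ae_of_all _ fun ω h => absurd h hq
  filter_upwards [ae_le_one hm hu, h3, h4, h5] with ω a1 a2 a3 a4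
  exact ⟨a1, a3, a2, a4⟩

/-- Fubini for the joint law, which is a product: `X` may be frozen while `V` is random. -/
theorem ae_mem_of_indepFun {E F : Type*} [MeasurableSpace E] [MeasurableSpace F] {X : Ω → E}
    {V : Ω → F} (hX : Measurable X) (hV : Measurable V) (hXV : IndepFun X V P) {S : Set (E × F)}
    (hS : MeasurableSet S) (h : ∀ᵐ ω ∂P, ∀ᵐ ω' ∂P, (X ω, V ω') ∈ S) :
    ∀ᵐ ω ∂P, (X ω, V ω) ∈ S := by
  have h1 := (indepFun_iff_map_prod_eq_prod_map_map hX.aemeasurable hV.aemeasurable).1 hXV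
  refine ae_of_ae_map (hX.prodMk hV).aemeasurable (p := fun x => x ∈ S) ?_
  have := Measure.isProbabilityMeasure_map hX.aemeasurable (μ := P)
  have := Measure.isProbabilityMeasure_map hV.aemeasurable (μ := P)
  rw [h1, Measure.ae_prod_mem_iff_ae_ae_mem hS]
  refine (ae_map_iff hX.aemeasurable
    (measurable_measure_prodMk_left hS.compl (measurableSet_singleton 0))).2 ?_
  exact h.mono fun ω hω => (ae_map_iff hV.aemeasurable (measurable_prodMk_left hS)).2 hω

end Marks

/-! ### From the attachment rule to comparisons of intensities -/

section Attach

variable {x : ℝ≥0 → ℝ}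

/-- If the infimum is at most `s`, the path exceeds `u * w` right after `s`, so right-continuity
gives `u * w ≤ x s`; `hne` makes it strict. Without `hex` the infimum would be the default `0`. -/
theorem attach_le_iff (hm : Monotone x) (hr : ∀ t, ContinuousWithinAt x (Set.Ici t) t)
    {y s : ℝ≥0} {u w : ℝ} (hw : Function.leftLim x y = w) (hne : u * w ≠ x s)
    (hex : ∃ t, u * w < x t) : attach x y u ≤ s ↔ u * w < x s := by
  have hbdd : BddBelow {t : ℝ≥0 | 0 < t ∧ u * w < x t} := OrderBot.bddBelow _
  obtain ⟨t₀, ht₀⟩ := hex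
  have hne' : {t : ℝ≥0 | 0 < t ∧ u * w < x t}.Nonempty :=
    ⟨t₀ + 1, by positivity, ht₀.trans_le (hm (by simp))⟩
  rw [attach, hw]
  constructor
  · intro h
    refine lt_of_le_of_ne ?_ hne
    have h1 : Tendsto x (𝓝[>] s) (𝓝 (x s)) := (hr s).tendsto.mono_left (nhdsWithin_mono _
      Set.Ioi_subset_Ici_self)
    refine ge_of_tendsto h1 (eventually_nhdsWithin_of_forall fun t ht => ?_)
    obtain ⟨t', h2, h3⟩ := exists_lt_of_csInf_lt hne' (h.trans_lt ht)
    exact (h2.2.trans_le (hm h3.le)).le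
  · intro h
    refine le_of_forall_gt_imp_ge_of_dense fun t ht => csInf_le hbdd ⟨?_, h.trans_le (hm ht.le)⟩
    exact (zero_le (a := s)).trans_lt ht

end Attach

/-- Convergence of the line-breaking construction for typical marks. -/
theorem exists_tendsto_of_isTypical {x : ℝ≥0 → ℝ} {y : ℕ → ℝ≥0} {u : ℕ → ℝ} {κ : ℝ} (hκ : 1 < κ)
    (hm : Monotone x) (hr : ∀ t, ContinuousWithinAt x (Set.Ici t) t) (hx : Tendsto x atTop atTop)
    (hpos : ∀ t, 0 < t → 0 < x t) (hy0 : 0 < y 0) (hy : StrictMono y) (hyt : Tendsto y atTop atTop)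
    (hlim : ∀ k, Function.leftLim x (y k) = x (y k))
    (hu : IsTypical κ y (fun q => x (gridPoint y q)) u) :
    ∃ h : IsLineBreaking y fun k => attach x (y k) (u k),
      CompactSpace (Tree h) ∧ ∃ μ : ProbabilityMeasure (Tree h),
        Tendsto (fun k => empirical h k) atTop (𝓝 μ) ∧
        Tendsto (fun k => ghpEDist (subtree h k) (Tree h) (empiricalSubtree h k)
          (μ : Measure (Tree h))) atTop (𝓝 0) := by
  have hyk : ∀ k, 0 < y k := fun k => hy0.trans_le (hy.monotone (Nat.zero_le k))
  set w : ℕ → ℝ := fun k => x (y k) with hw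
  have hwm : Monotone w := hm.comp hy.monotone
  have hw0 : ∀ k, 0 < w k := fun k => hpos _ (hyk k)
  have hex : ∀ a : ℝ, ∃ t, a < x t := fun a => (hx.eventually (eventually_gt_atTop a)).exists
  have hz : ∀ k q, attach x (y k) (u k) ≤ gridPoint y q ↔ u k * w k < x (gridPoint y q) :=
    fun k q => attach_le_iff hm hr (hlim k) (hu.ne k q) (hex _)
  have huw : ∀ k, u k * w k < w k := fun k =>
    lt_of_le_of_ne (mul_le_of_le_one_left (hw0 k).le (hu.le_one k)) (hu.ne k (.inl k))
  -- The level `u k * w k` is below the left limit at `y k`, hence already exceeded strictly before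
  -- `y k`.
  have hlt : ∀ k, attach x (y k) (u k) < y k := by
    intro k
    obtain ⟨a, ha1, ha2⟩ := exists_between (huw k)
    have hlim' : Tendsto x (𝓝[<] (y k)) (𝓝 (w k)) := by
      have := hm.tendsto_leftLim (y k)
      rwa [hlim k] at this
    have : (𝓝[<] (y k)).NeBot := nhdsLT_neBot_of_exists_lt ⟨0, hyk k⟩
    obtain ⟨t, ⟨h1, h2⟩, h3⟩ := (((hlim'.eventually (lt_mem_nhds (huw k))).and
      (eventually_nhdsWithin_of_forall fun t ht => ht)).and
      (Ioo_mem_nhdsLT (hyk k))).exists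
    have h4 : t ∈ {t | 0 < t ∧ u k * Function.leftLim x (y k) < x t} := ⟨h3.1, by rwa [hlim k]⟩
    exact (csInf_le (OrderBot.bddBelow _) h4).trans_lt h2
  have h : IsLineBreaking y fun k => attach x (y k) (u k) := ⟨hy, hyt, hlt⟩
  have hn : ∀ ε > (0 : ℝ), ∃ n, ∀ v, treeDist y (fun k => attach x (y k) (u k)) v
      (proj y (fun k => attach x (y k) (u k)) n v) ≤ ε := by
    intro ε hε
    refine exists_forall_treeDist_proj_le h (r := fun i => (κ⁻¹) ^ i)
      (summable_geometric_of_lt_one (by positivity) (inv_lt_one_of_one_lt₀ hκ))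
      (fun i => by positivity) ?_ hε
    filter_upwards [hu.exp_le] with i hi k hk v h1 h2
    have h3 := (exp_treeDist_proj_le h hwm (fun k j => hz k (.inl j)) huw
      (l := κ ^ (2 * i)) (by positivity) (Finset.mem_Ico.1 hk).1 h1 h2).trans (hi k hk)
    -- Now `κ ^ (2 * i)` times the distance is at most `κ ^ i`.
    have h4 := Real.exp_le_exp.1 h3
    rw [inv_pow, ← one_div, le_div_iff₀ (by positivity)]
    have h5 : 0 < κ ^ i := by positivity
    refine le_of_mul_le_mul_right ?_ h5
    calc _ = κ ^ (2 * i) * treeDist y (fun k => attach x (y k) (u k)) v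
          (proj y (fun k => attach x (y k) (u k)) (2 ^ i) v) := by
          rw [two_mul, pow_add]; ring
      _ ≤ _ := by rwa [one_mul]
  have hcpt := compactSpace_tree h hn
  have hmean : ∀ n, ∀ s ∈ gridPoints y, s ≤ y n → HasMean fun k =>
      if n < k ∧ proj y (fun k => attach x (y k) (u k)) n (y k) ≤ s then 1 else 0 := by
    rintro n s hs hsn
    rw [← range_gridPoint] at hs
    obtain ⟨q, rfl⟩ := hs
    have hc : x (gridPoint y q) ≤ w n := hm hsn
    convert hu.hasMean n q hc using 2 with k
    rcases le_or_gt k n with hk | hk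
    · rw [label_of_le hk, if_neg fun h => absurd h.1 (by omega)]
    · obtain ⟨k, rfl⟩ := Nat.exists_eq_succ_of_ne_zero (show k ≠ 0 by omega)
      have h1 := label_eq_ite_proj h hwm (fun k j => hz k (.inl j)) huw hc (fun k => hz k q)
        (show n ≤ k by omega) (hy (Nat.lt_succ_self k)) le_rfl
      refine Eq.trans ?_ h1.symm
      simp [hk]
  obtain ⟨μ, hμ⟩ := exists_tendsto_empirical h fun f hf => hasMean_continuous h hn hmean hf
  exact ⟨h, hcpt, μ, hμ, tendsto_ghpEDist h hn hμ⟩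

/-! ### Typicality of the marks given the intensity and the cut points -/

section Cox

variable {Ω : Type*} [MeasurableSpace Ω] {P : Measure Ω} [IsProbabilityMeasure P]
  {τ : ℝ≥0 → Ω → ℝ} {Y : ℕ → Ω → ℝ≥0} {U : ℕ → Ω → ℝ}

theorem IsUniformMarks.ae_isTypical (hU : IsUniformMarks P τ Y U) (hτ : IsIncreasingProcess τ)
    (hY : IsCoxPoints P τ Y) (hpos : ∀ᵐ ω ∂P, ∀ t, 0 < t → 0 < τ t ω) {p : ℕ}
    (hp : ∀ᵐ ω ∂P, ∀ᶠ t : ℝ≥0 in atTop, (t : ℝ) ≤ τ t ω ^ p) {κ : ℝ} (hκ : 1 < κ)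
    (hκp : κ ^ (6 * (p + 3)) = 2) :
    ∀ᵐ ω ∂P, IsTypical κ (fun k => Y k ω)
      (fun q => τ (gridPoint (fun k => Y k ω) q) ω) fun k => U k ω := by
  set Ψ : Ω → (ℝ≥0 → ℝ) × (ℕ → ℝ≥0) := fun ω => ((fun t => τ t ω), fun k => Y k ω) with hΨ
  have hΨm : Measurable Ψ := (measurable_pi_lambda _ hτ.measurable).prodMk
    (measurable_pi_lambda _ hY.measurable)
  set X : Ω → (ℕ → ℝ≥0) × (GridIndex → ℝ) := fun ω =>
    (fun k => Y k ω, fun q => τ (gridPoint (fun k => Y k ω) q) ω) with hX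
  -- Independence is given for `(τ, Y)`, so the intensities at the random cut points must be shown
  -- to be functions of this pair, in the product `σ`-algebra on paths.
  have hXm : Measurable[MeasurableSpace.comap Ψ inferInstance] X := by
    have hΨ' : Measurable[MeasurableSpace.comap Ψ inferInstance] Ψ := comap_measurable Ψ
    have h1 : ∀ t, Measurable[MeasurableSpace.comap Ψ inferInstance] (τ t) := fun t =>
      ((measurable_pi_apply t).comp measurable_fst).comp hΨ'
    have h2 : ∀ k, Measurable[MeasurableSpace.comap Ψ inferInstance] (Y k) := fun k =>
      ((measurable_pi_apply k).comp measurable_snd).comp hΨ'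
    have h3 := @measurable_uncurry_of_rightCts Ω (MeasurableSpace.comap Ψ inferInstance) τ h1
      hτ.rightCts
    have h4 : ∀ q, Measurable[MeasurableSpace.comap Ψ inferInstance] fun ω =>
        τ (gridPoint (fun k => Y k ω) q) ω := by
      intro q
      cases q with
      | inl k => exact h3.comp (@Measurable.prodMk _
          (MeasurableSpace.comap Ψ inferInstance) _ _ _ _ _ _ (h2 k)
          (@measurable_id _ (MeasurableSpace.comap Ψ inferInstance)))
      | inr q => exact h1 _
    exact @Measurable.prodMk _ (MeasurableSpace.comap Ψ inferInstance) _ _ _ _ _ _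
      (@measurable_pi_lambda _ _ _ (MeasurableSpace.comap Ψ inferInstance) _ _ h2)
      (@measurable_pi_lambda _ _ _ (MeasurableSpace.comap Ψ inferInstance) _ _ h4)
  have hVm : Measurable fun ω k => U k ω := measurable_pi_lambda _ hU.measurable
  have hind : IndepFun X (fun ω k => U k ω) P :=
    indep_of_indep_of_le_left ((IndepFun_iff_Indep _ _ _).1 hU.indep.symm) hXm.comap_le
  refine ae_mem_of_indepFun (hXm.mono hΨm.comap_le le_rfl) hVm hind (measurableSet_isTypical κ) ?_
  filter_upwards [hpos, hY.pos, hY.strictMono, hY.ae_gap_le hτ hp, hY.ae_index_le hτ hp]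
    with ω h1 h2 h3 h4 h5
  exact LineBreaking.ae_isTypical hU.measurable hU.uniform hU.iIndep hκ (by omega) hκp h3.monotone
    ((hτ.mono ω).comp h3.monotone) (fun j => h1 _ (h2.trans_le (h3.monotone (Nat.zero_le j))))
    (fun q => hτ.nonneg ω _) h4 h5

end Cox

theorem IsTilted.isIncreasingProcess {Ω' Ω : Type*} [MeasurableSpace Ω'] [MeasurableSpace Ω] {α : ℝ}
    {σ : ℝ≥0 → Ω' → ℝ} {P' : Measure Ω'} {τ : ℝ≥0 → Ω → ℝ} {P : Measure Ω}
    (h : IsTilted α σ P' τ P) : IsIncreasingProcess τ :=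
  ⟨h.measurable, h.mono, h.rightCts, h.nonneg⟩

end LineBreaking

end

theorem theorem2p13 (α : ℝ) (hα : α ∈ Set.Ioo (1 : ℝ) 2)
    {Ω' : Type*} [MeasurableSpace Ω'] (P' : Measure Ω') [IsProbabilityMeasure P']
    (σ : ℝ≥0 → Ω' → ℝ) (hσ : LineBreaking.IsStableSubordinator α σ P')
    {Ω : Type*} [MeasurableSpace Ω] (P : Measure Ω) [IsProbabilityMeasure P]
    (τ : ℝ≥0 → Ω → ℝ) (hτ : LineBreaking.IsTilted α σ P' τ P)
    (Y : ℕ → Ω → ℝ≥0) (hY : LineBreaking.IsCoxPoints P τ Y)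
    (U : ℕ → Ω → ℝ) (hU : LineBreaking.IsUniformMarks P τ Y U) :
    ∀ᵐ ω ∂P, ∃ h : LineBreaking.IsLineBreaking (fun k => Y k ω)
        (fun k => LineBreaking.attach (fun t => τ t ω) (Y k ω) (U k ω)),
      CompactSpace (LineBreaking.Tree h) ∧
      ∃ μ : ProbabilityMeasure (LineBreaking.Tree h),
        Tendsto (fun k => LineBreaking.empirical h k) atTop (𝓝 μ) ∧
        Tendsto (fun k => LineBreaking.ghpEDist (LineBreaking.subtree h k) (LineBreaking.Tree h)
          (LineBreaking.empiricalSubtree h k) (μ : Measure (LineBreaking.Tree h))) atTop (𝓝 0) := by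
  have hpos := LineBreaking.ae_tilted_pos hα hσ hτ
  obtain ⟨p, hp⟩ := LineBreaking.exists_ae_eventually_le_tilted_pow hα hσ hτ
  have hτ' := hτ.isIncreasingProcess
  -- Here `p + 3` is the growth exponent of `IsCoxPoints.ae_index_le`, and `6` makes `√w` at least
  -- of order `κ ^ (3 * i)` at index `2 ^ i`.
  obtain ⟨κ, hκ0, hκp⟩ : ∃ κ : ℝ, 0 ≤ κ ∧ κ ^ (6 * (p + 3)) = 2 :=
    ⟨2 ^ (((6 * (p + 3) : ℕ) : ℝ)⁻¹), by positivity,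
      Real.rpow_inv_natCast_pow (by norm_num) (by omega)⟩
  have hκ : 1 < κ := by
    by_contra hcon
    have := pow_le_one₀ (n := 6 * (p + 3)) hκ0 (not_lt.1 hcon)
    linarith
  filter_upwards [hU.ae_isTypical hτ' hY hpos hp hκ hκp, hpos, hp, hY.pos, hY.strictMono,
    hY.ae_tendsto_atTop hτ', hY.ae_leftLim_eq hτ'] with ω h1 h2 h3 h4 h5 h6 h7
  exact LineBreaking.exists_tendsto_of_isTypical hκ (hτ.mono ω) (hτ.rightCts ω)
    (LineBreaking.tendsto_atTop_of_le_pow (hτ.nonneg ω) h3) h2 h4 h5 h6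
    (fun k => h7 k (h4.trans_le (h5.monotone (Nat.zero_le k)))) h1
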